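/- Let $G=(A\cup B,E)$ be a finite simple bipartite graph with $|A|=n$. For $S\subseteq B$ let $N(S)\subseteq A$ be the set of vertices that have a neighbour in $S$. Call $S\subseteq B$ feasible if the subgraph of $G$ induced by $A\cup(B\setminus S)$ has a matching that covers $A$. The problem 2PPM asks, given $G$, for a feasible set $S$ that maximizes $|N(S)|$; write $\mathrm{OPT}_{2PPM}(G)$ for the maximum. The $(3,2)$-regular 2PPM is its restriction to graphs in which every vertex of $A$ has degree $3$ and every vertex of $B$ has degree $2$. For such a $G$, let $G'$ be the multigraph (parallel edges allowed) with vertex set $A$ that has, for each $b\in B$, one edge $e_b$ joining the two neighbours of $b$, and let $\nu(G')$ be the maximum number of edges in a matching of $G'$. **Theorem.** The $(3,2)$-regular 2PPM can be solved exactly in polynomial time: there is an algorithm that, given any such graph $G$, computes a feasible set $S$ with $|N(S)|=\mathrm{OPT}_{2PPM}(G)$ in a number of steps bounded by a polynomial in the size of the input. Furthermore, for every such $G$, $$\mathrm{OPT}_{2PPM}(G)=\frac n2+\nu(G').$$ -/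

import Mathlib

/-! ## Bipartite graphs and the problem 2PPM

A bipartite graph with parts `A` and `B` is its adjacency relation `E : A → B → Prop`. -/

namespace TwoPPM

/-- Every vertex of the part `A` has degree `d`. -/
def LeftRegular {A B : Type*} (E : A → B → Prop) (d : ℕ) : Prop :=
  ∀ a, {b | E a b}.ncard = d

/-- Every vertex of the part `B` has degree `d`. -/
def RightRegular {A B : Type*} (E : A → B → Prop) (d : ℕ) : Prop :=
  ∀ b, {a | E a b}.ncard = d

/-- The neighbourhood `N(S) ⊆ A` of a set `S ⊆ B`. -/
def nbhd {A B : Type*} (E : A → B → Prop) (S : Set B) : Set A :=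
  {a | ∃ b ∈ S, E a b}

/-- `S ⊆ B` is a feasible solution of 2PPM: the subgraph induced by `A ∪ (B \ S)` has a matching
that covers `A`; the map `f` sends every `a` to its partner. -/
def Feasible {A B : Type*} (E : A → B → Prop) (S : Set B) : Prop :=
  ∃ f : A → B, Function.Injective f ∧ ∀ a, E a (f a) ∧ f a ∉ S

/-- The values `|N(S)|` of the feasible solutions; 2PPM asks for a largest one. -/
def feasibleValues {A B : Type*} (E : A → B → Prop) : Set ℕ :=
  {k | ∃ S : Set B, Feasible E S ∧ (nbhd E S).ncard = k}

/-- `S` is an optimal solution of 2PPM. -/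
def IsOptimal {A B : Type*} (E : A → B → Prop) (S : Set B) : Prop :=
  Feasible E S ∧ ∀ T : Set B, Feasible E T → (nbhd E T).ncard ≤ (nbhd E S).ncard

/-! ## The auxiliary multigraph and its matching number -/

/-- The auxiliary multigraph of a bipartite graph whose part `B` is 2-regular: its vertex set is
`A`, its edge set is `B`, and the edge `b` joins the two neighbours of `b`. -/
def auxGraph {A B : Type*} (E : A → B → Prop) (hB : RightRegular E 2) : Graph A B where
  vertexSet := Set.univ
  IsLink b x y := x ≠ y ∧ E x b ∧ E y b
  edgeSet := Set.univ
  isLink_symm b _ := ⟨fun _ _ h => ⟨h.1.symm, h.2.2, h.2.1⟩⟩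
  eq_or_eq_of_isLink_of_isLink := by
    rintro b x y v w ⟨-, hx, -⟩ ⟨hvw, hv, hw⟩
    obtain ⟨p, q, -, hpq⟩ := Set.ncard_eq_two.1 (hB b)
    have key : ∀ z, E z b → z = p ∨ z = q := fun z hz => by
      have h : z ∈ {a | E a b} := hz
      rw [hpq] at h
      simpa using h
    have h1 := key x hx
    have h2 := key v hv
    have h3 := key w hw
    grind
  edge_mem_iff_exists_isLink := fun b => by
    obtain ⟨p, q, hne, hpq⟩ := Set.ncard_eq_two.1 (hB b)
    have hp : p ∈ {a | E a b} := by rw [hpq]; simp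
    have hq : q ∈ {a | E a b} := by rw [hpq]; simp
    exact ⟨fun _ => ⟨p, q, hne, hp, hq⟩, fun _ => Set.mem_univ b⟩
  left_mem_of_isLink := fun _ x _ _ => Set.mem_univ x

/-- A matching of a multigraph: a set of edges, none of them a loop, no two of which share an
end. -/
def IsMatching {A B : Type*} (G : Graph A B) (M : Set B) : Prop :=
  M ⊆ G.edgeSet ∧ (∀ e ∈ M, ∀ x, ¬ G.IsLoopAt e x) ∧
    ∀ e ∈ M, ∀ e' ∈ M, e ≠ e' → ∀ x, ¬ (G.Inc e x ∧ G.Inc e' x)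

/-- The matching number `ν(G)` of a multigraph with finitely many edges. -/
noncomputable def matchingNumber {A B : Type*} (G : Graph A B) : ℕ :=
  sSup {k | ∃ M : Set B, IsMatching G M ∧ M.ncard = k}

end TwoPPM

/-! ## A random access machine with a step count

Programs are structured programs of a RAM with registers and an indirectly addressed memory, both
holding natural numbers. Every elementary operation costs one step. The only arithmetic is
addition and truncated subtraction (no multiplication), so the numbers that occur in `t` steps
have `O(t)` more bits than the input, and polynomially many steps of this
machine mean polynomial time on a Turing machine and conversely. -/

namespace RAM

/-- Arithmetic expressions. -/
inductive Expr : Type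
  /-- a constant -/
  | const : ℕ → Expr
  /-- the content of a register -/
  | reg : ℕ → Expr
  /-- the content of the memory cell whose address is the value of the expression -/
  | load : Expr → Expr
  /-- addition -/
  | add : Expr → Expr → Expr
  /-- truncated subtraction -/
  | sub : Expr → Expr → Expr

/-- Programs. -/
inductive Prog : Type
  /-- do nothing -/
  | skip : Prog
  /-- `assign i e`: write the value of `e` to register `i` -/
  | assign : ℕ → Expr → Prog
  /-- `store e₁ e₂`: write the value of `e₂` to the memory cell with address the value of `e₁` -/
  | store : Expr → Expr → Prog
  /-- run the first program, then the second -/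
  | seq : Prog → Prog → Prog
  /-- `ite e p q`: run `p` if the value of `e` is not `0`, otherwise `q` -/
  | ite : Expr → Prog → Prog → Prog
  /-- `while e p`: run `p` as long as the value of `e` is not `0` -/
  | while : Expr → Prog → Prog

/-- The contents of the registers and of the memory. -/
structure State where
  /-- registers -/
  reg : ℕ → ℕ
  /-- memory cells -/
  mem : ℕ → ℕ

/-- The value of an expression. -/
def Expr.eval (s : State) : Expr → ℕ
  | .const k => k
  | .reg i => s.reg i
  | .load e => s.mem (e.eval s)
  | .add e e' => e.eval s + e'.eval s
  | .sub e e' => e.eval s - e'.eval s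

/-- The number of steps spent on evaluating an expression: one per elementary operation. -/
def Expr.cost : Expr → ℕ
  | .const _ => 1
  | .reg _ => 1
  | .load e => e.cost + 1
  | .add e e' => e.cost + e'.cost + 1
  | .sub e e' => e.cost + e'.cost + 1

/-- `Runs p s t s'`: started in the state `s`, the program `p` halts after exactly `t` steps, in
the state `s'`. -/
inductive Runs : Prog → State → ℕ → State → Prop
  | skip (s : State) : Runs .skip s 1 s
  | assign (i : ℕ) (e : Expr) (s : State) :
      Runs (.assign i e) s (e.cost + 1) ⟨Function.update s.reg i (e.eval s), s.mem⟩
  | store (e₁ e₂ : Expr) (s : State) :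
      Runs (.store e₁ e₂) s (e₁.cost + e₂.cost + 1)
        ⟨s.reg, Function.update s.mem (e₁.eval s) (e₂.eval s)⟩
  | seq {p q : Prog} {s s' s'' : State} {t t' : ℕ} :
      Runs p s t s' → Runs q s' t' s'' → Runs (.seq p q) s (t + t') s''
  | ite_true {e : Expr} {p q : Prog} {s s' : State} {t : ℕ} :
      e.eval s ≠ 0 → Runs p s t s' → Runs (.ite e p q) s (e.cost + 1 + t) s'
  | ite_false {e : Expr} {p q : Prog} {s s' : State} {t : ℕ} :
      e.eval s = 0 → Runs q s t s' → Runs (.ite e p q) s (e.cost + 1 + t) s'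
  | while_true {e : Expr} {p : Prog} {s s' s'' : State} {t t' : ℕ} :
      e.eval s ≠ 0 → Runs p s t s' → Runs (.while e p) s' t' s'' →
        Runs (.while e p) s (e.cost + 1 + t + t') s''
  | while_false {e : Expr} {p : Prog} {s : State} :
      e.eval s = 0 → Runs (.while e p) s (e.cost + 1) s

/-- The initial state on an input word: the word is in the cells `0, 1, 2, …`, all other cells and
all registers hold `0`. -/
def State.init (w : List ℕ) : State :=
  ⟨fun _ => 0, fun i => w.getD i 0⟩

end RAM

namespace TwoPPM

open Classical in
/-- The input word of a bipartite graph with parts `{0, …, n-1}` and `{0, …, m-1}`: the numbers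
`n` and `m`, then the adjacency matrix, one row of `n` entries for each vertex of the second
part. -/
noncomputable def encode {n m : ℕ} (E : Fin n → Fin m → Prop) : List ℕ :=
  [n, m] ++ (List.finRange m).flatMap fun b =>
    (List.finRange n).map fun a => if E a b then 1 else 0

/-- The set `S ⊆ B` that a final state describes: `b ∈ S` iff cell `b` holds `1`. -/
def output (m : ℕ) (s : RAM.State) : Set (Fin m) :=
  {b | s.mem b = 1}

/-- The instances of 2PPM in the class `P` can be solved exactly in polynomial time: one program
computes, for every instance in the class, an optimal solution, in a number of steps bounded by a
polynomial in the length of the input. -/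
def SolvableInPolyTime (P : ∀ {n m : ℕ}, (Fin n → Fin m → Prop) → Prop) : Prop :=
  ∃ (prog : RAM.Prog) (p : Polynomial ℕ), ∀ (n m : ℕ) (E : Fin n → Fin m → Prop), P E →
    ∃ (t : ℕ) (s : RAM.State), RAM.Runs prog (RAM.State.init (encode E)) t s ∧
      t ≤ p.eval (encode E).length ∧ IsOptimal E (output m s)

end TwoPPM

/-! ## Partial involutions as matchings, and tight barriers -/

namespace TwoPPM

open Finset

/-! Regard `B` as the edge set of the cubic multigraph $G'$ on `A`, and put $m=|B|$, so that
$3n=2m$. A set $S$ of edges is feasible if every vertex can choose an incident edge outside $S$, all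
choices being distinct; hence $|S|\le m-n=n/2$. Upper bound (`Feasible.exists_matching`): let $M$ be
a largest matching inside $S$. It covers $2|M|$ vertices. No edge of $S\setminus M$ has both ends
uncovered, so such edges reach at most $|S|-|M|$ further vertices. Thus $|N(S)|\le |S|+|M|\le
n/2+|M|$. Lower bound (`feasible_of_orientation`): given a matching $M$, fix two edges outside $M$
at every vertex. Linking the two edges of every such pair decomposes the edges into trails;
orienting the trails consistently makes every vertex the tail of exactly one edge of its pair
(`exists_orientation`), and it chooses that one. Let $S$ consist of the edges that are not chosen.
An edge of $S\setminus M$ is the third edge at its tail, so these tails are distinct and not covered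
by $M$. Hence $|N(S)|\ge 2|M|+(m-n-|M|)=n/2+|M|$. The algorithm therefore needs a maximum matching
and a balanced orientation. Whether a matching is maximum is decided by a blossom search that stores
only blossom labels and bases, no paths. A stuck search yields a Tutte–Berge counting certificate of
maximality (`BlossomInv.exposed_le`). Conversely, if the matching is maximum, the Tutte–Berge
formula provides a tight barrier (`exists_tightBarrier`) whose components the blossoms never leave,
so the search cannot report an augmentation. A larger matching is then found by self-reduction:
edges outside $M$ are deleted as long as $M$ does not become maximum; those that remain lie in every
larger matching, and this determines one (`exists_augmentation`). The algorithm is written in a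
small language of bounded loops, whose compilation to the random access machine gives correctness
and a polynomial step bound at once (`Cmd.toProg_runs`). -/

/-- An involution that moves every vertex that it does not fix along an edge: a matching, whose
exposed vertices are the fixed points. -/
structure IsMate {V : Type*} (G : SimpleGraph V) (μ : V → V) : Prop where
  invol : ∀ x, μ (μ x) = x
  adj : ∀ x, μ x ≠ x → G.Adj x (μ x)

/-- The vertices exposed by a matching. -/
def exposed {V : Type*} [Fintype V] [DecidableEq V] (μ : V → V) : Finset V :=
  univ.filter fun x => μ x = x

lemma mem_exposed {V : Type*} [Fintype V] [DecidableEq V] {μ : V → V} {x : V} :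
    x ∈ exposed μ ↔ μ x = x := by
  simp [exposed]

/-- Modulo 2 the terms of a sum of ones cancel along the pairs of a fixed-point-free involution. -/
lemma even_card_of_involution {V : Type*} (μ : V → V) (hμ : ∀ x, μ (μ x) = x) (s : Finset V)
    (hs : ∀ x ∈ s, μ x ∈ s) (hf : ∀ x ∈ s, μ x ≠ x) : Even #s := by
  have h : ∑ x ∈ s, (1 : ZMod 2) = 0 :=
    Finset.sum_involution (fun x _ => μ x) (fun _ _ => by decide) (fun x hx _ => hf x hx) hs
      (fun x _ => hμ x)
  simpa [ZMod.natCast_eq_zero_iff_even] using h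

/-- The number of exposed vertices has the parity of the number of vertices. -/
lemma even_card_exposed_iff {V : Type*} [Fintype V] [DecidableEq V] (μ : V → V)
    (hμ : ∀ x, μ (μ x) = x) : Even #(exposed μ) ↔ Even (Fintype.card V) := by
  have h1 := even_card_of_involution μ hμ (exposed μ)ᶜ
    (fun x hx => by
      simp only [mem_compl, mem_exposed] at hx ⊢
      intro h; exact hx (by rw [hμ] at h; exact h.symm))
    (fun x hx => by simpa [mem_exposed] using hx)
  rw [card_compl] at h1
  have h2 := card_le_univ (exposed μ)
  grind

/-! ### The Tutte–Berge formula from Tutte's theorem -/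

/-- The graph with `k` further vertices, each joined to all other vertices. -/
def joinClique {V : Type*} (G : SimpleGraph V) (k : ℕ) : SimpleGraph (V ⊕ Fin k) where
  Adj x y := x ≠ y ∧ ∀ a b, x = .inl a → y = .inl b → G.Adj a b
  symm := ⟨fun _ _ h => ⟨h.1.symm, fun a b ha hb => (h.2 b a hb ha).symm⟩⟩
  loopless := ⟨fun _ h => h.1 rfl⟩

/-- A perfect matching of `joinClique G k` leaves a matching of `G` that exposes at most `k`
vertices. -/
lemma exists_isMate_of_isPerfectMatching {V : Type*} [Fintype V] [DecidableEq V]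
    (G : SimpleGraph V) (k : ℕ) (M : (joinClique G k).Subgraph) (hM : M.IsPerfectMatching) :
    ∃ μ, IsMate G μ ∧ #(exposed μ) ≤ k := by
  rw [SimpleGraph.Subgraph.isPerfectMatching_iff] at hM
  choose f hf hu using hM
  have hinv : ∀ x, f (f x) = x := fun x => (hu (f x) x (hf x).symm).symm
  have hadj : ∀ x, (joinClique G k).Adj x (f x) := fun x => (hf x).adj_sub
  let μ : V → V := fun v => Sum.elim id (fun _ => v) (f (.inl v))
  have h1 : ∀ v w, f (.inl v) = .inl w → μ v = w := fun v w h => by simp [μ, h]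
  have h2 : ∀ v i, f (.inl v) = .inr i → μ v = v := fun v w h => by simp [μ, h]
  refine ⟨μ, ⟨fun v => ?_, fun v hv => ?_⟩, ?_⟩
  · rcases h : f (.inl v) with w | i
    · rw [h1 v w h]; apply h1; rw [← h, hinv]
    · rw [h2 v i h, h2 v i h]
  · rcases h : f (.inl v) with w | i
    · rw [h1 v w h]; have := hadj (.inl v); rw [h] at this; exact this.2 v w rfl rfl
    · exact absurd (h2 v i h) hv
  · have : ∀ v ∈ exposed μ, ∃ i, f (.inl v) = .inr i := fun v hv => by
      rcases h : f (.inl v) with w | i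
      · have h3 := h1 v w h
        rw [mem_exposed.1 hv] at h3
        have := (hadj (.inl v)).1
        rw [h, h3] at this
        exact absurd rfl this
      · exact ⟨i, rfl⟩
    have := card_le_card_of_injOn (t := (univ : Finset (Fin k)).map Function.Embedding.inr)
      (fun v => f (.inl v))
      (fun v hv => by obtain ⟨i, hi⟩ := this v hv; simp [hi])
      (fun v _ w _ h => by
        have := congrArg f h
        rw [hinv, hinv] at this
        exact Sum.inl_injective this)
    simpa using this

/-- The Tutte–Berge formula: if every matching exposes at least `d` vertices, where `d` has the
parity of the number of vertices, then for some set `U` the graph without `U` falls apart into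
pieces of which `|U| + d` are odd. -/
theorem exists_barrier {V : Type} [Fintype V] [DecidableEq V] (G : SimpleGraph V) (d : ℕ)
    (hd : ∀ μ, IsMate G μ → d ≤ #(exposed μ)) (hpar : Even d ↔ Even (Fintype.card V)) :
    ∃ (U : Finset V) (ι : Type) (_ : DecidableEq ι) (c : V → ι) (s : Finset ι),
      (∀ x y, G.Adj x y → x ∉ U → y ∉ U → c x = c y) ∧
      (∀ i ∈ s, Odd #{x | x ∉ U ∧ c x = i}) ∧ #U + d ≤ #s := by
  classical
  -- For `d ≤ 1` the barrier is empty: for `d = 0` nothing is needed, for `d = 1` the whole vertex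
  -- set is one odd piece by parity.
  rcases lt_or_ge d 2 with hd2 | hd2
  · refine ⟨∅, Unit, inferInstance, fun _ => (), if d = 0 then ∅ else {()}, fun _ _ _ _ _ => rfl,
      fun i hi => ?_, ?_⟩
    · have : d = 1 := by by_contra h; have : d = 0 := by omega
                         simp [this] at hi
      simp only [notMem_empty, not_false_eq_true, and_self, filter_true, card_univ]
      subst this
      simpa using hpar
    · split_ifs with h <;> simp [h]; omega
  -- With `d - 2` universal vertices added there is still no perfect matching, since it would leave
  -- at most `d - 2` exposed vertices. The missing 2 is recovered from parity below.
  · obtain ⟨k, rfl⟩ : ∃ k, d = k + 2 := ⟨d - 2, by omega⟩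
    have hno : ¬ ∃ M : (joinClique G k).Subgraph, M.IsPerfectMatching := by
      rintro ⟨M, hM⟩
      obtain ⟨μ, h1, h2⟩ := exists_isMate_of_isPerfectMatching G k M hM
      have := hd μ h1
      omega
    rw [SimpleGraph.tutte] at hno
    push Not at hno
    obtain ⟨S, hS⟩ := hno
    unfold SimpleGraph.IsTutteViolator at hS
    set H := ((⊤ : (joinClique G k).Subgraph).deleteVerts S).coe with hH
    have hcardV : Nat.card (((⊤ : (joinClique G k).Subgraph).deleteVerts S).verts) + S.ncard
        = Fintype.card V + k := by
      have : (((⊤ : (joinClique G k).Subgraph).deleteVerts S).verts) = Sᶜ := by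
        ext; simp
      rw [this, Nat.card_coe_set_eq, add_comm, Set.ncard_add_ncard_compl]
      simp
    have hodd := H.odd_ncard_oddComponents
    -- A Tutte violator has excess at least 1, and the excess has the parity of `Fintype.card V +
    -- k`, which is even; so it is at least 2.
    have hS2 : S.ncard + 2 ≤ H.oddComponents.ncard := by
      grind
    have hadjH : ∀ (x y : V ⊕ Fin k) (hx : x ∈ ((⊤ : (joinClique G k).Subgraph).deleteVerts S).verts)
        (hy : y ∈ ((⊤ : (joinClique G k).Subgraph).deleteVerts S).verts),
        (joinClique G k).Adj x y → H.Adj ⟨x, hx⟩ ⟨y, hy⟩ := by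
      intro x y hx hy h
      simp only [SimpleGraph.Subgraph.deleteVerts_verts, SimpleGraph.Subgraph.verts_top,
        Set.mem_sdiff, Set.mem_univ, true_and] at hx hy
      simp [hH, hx, hy, h]
    -- A universal vertex outside `S` would make the remaining graph connected, leaving no room for
    -- two odd components. So `S` contains all new vertices, and they contribute `k` to its size.
    have hnew : ∀ i : Fin k, (.inr i : V ⊕ Fin k) ∈ S := by
      intro i
      by_contra hi
      have hi' : (.inr i : V ⊕ Fin k) ∈ ((⊤ : (joinClique G k).Subgraph).deleteVerts S).verts := by
        simpa using hi
      have : H.oddComponents.ncard ≤ 1 := by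
        rw [Set.ncard_le_one_iff]
        have key : ∀ C : H.ConnectedComponent, C = H.connectedComponentMk ⟨_, hi'⟩ := by
          intro C
          induction C using SimpleGraph.ConnectedComponent.ind with | _ v
          obtain ⟨v, hv⟩ := v
          rw [SimpleGraph.ConnectedComponent.eq]
          by_cases hvi : v = .inr i
          · subst hvi; rfl
          · exact (hadjH _ _ hv hi' ⟨hvi, fun a b _ h => by simp at h⟩).reachable
        intro a b _ _
        rw [key a, key b]
      omega
    let U : Finset V := univ.filter fun v => .inl v ∈ S
    have hUS : #U + k ≤ S.ncard := by
      rw [Set.ncard_eq_toFinset_card']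
      have h := card_le_card (s := U.disjSum (univ : Finset (Fin k))) (t := S.toFinset) (by
        intro x hx
        rcases x with v | i
        · simpa [U] using hx
        · simpa using hnew i)
      simpa using h
    have hmem : ∀ v, v ∉ U → (.inl v : V ⊕ Fin k) ∈
        ((⊤ : (joinClique G k).Subgraph).deleteVerts S).verts := fun v hv => by simpa [U] using hv
    let c : V → Option H.ConnectedComponent := fun v =>
      if h : v ∈ U then none else some (H.connectedComponentMk ⟨.inl v, hmem v h⟩)
    have hc : ∀ v (h : v ∉ U), c v = some (H.connectedComponentMk ⟨.inl v, hmem v h⟩) :=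
      fun v h => by simp [c, h]
    refine ⟨U, Option H.ConnectedComponent, Classical.decEq _, c, H.oddComponents.toFinset.map
      Function.Embedding.some, fun x y hxy hx hy => ?_, fun i hi => ?_, ?_⟩
    · rw [hc x hx, hc y hy, Option.some_inj, SimpleGraph.ConnectedComponent.eq]
      refine (hadjH _ _ (hmem x hx) (hmem y hy) ⟨fun h => hxy.ne (Sum.inl_injective h), ?_⟩).reachable
      rintro a b ha hb
      cases ha; cases hb; exact hxy
    · simp only [mem_map, Set.mem_toFinset, Function.Embedding.some_apply] at hi
      obtain ⟨C, hC, rfl⟩ := hi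
      have hC' : Odd C.supp.ncard := hC
      have : #{x | x ∉ U ∧ c x = some C} = C.supp.ncard := by
        rw [← Set.ncard_coe_finset]
        refine Set.ncard_congr (fun v hv => ⟨.inl v, hmem v (by simpa using (by simpa using hv : v ∉ U ∧ _).1)⟩) ?_ ?_ ?_
        · intro v hv
          have hv' : v ∉ U ∧ c v = some C := by simpa using hv
          rw [hc v hv'.1] at hv'
          simpa using hv'.2
        · intro a b _ _ h
          simpa using h
        · rintro ⟨v | i, hv⟩ hvC
          · have hvU : v ∉ U := by simpa [U] using hv
            refine ⟨v, ?_, rfl⟩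
            simp only [coe_filter, mem_univ, true_and, Set.mem_ofPred_eq]
            refine ⟨hvU, ?_⟩
            rw [hc v hvU]
            simpa using hvC
          · exact absurd (hnew i) (by simpa using hv)
      rw [← this] at hC'
      convert hC'
    · rw [card_map, ← Set.ncard_eq_toFinset_card']
      omega

/-! ### Tight barriers of maximum matchings -/

/-- A barrier that certifies that a matching is maximum: `O` says that a vertex lies in an odd
component outside the barrier, and `β` sends it to the one vertex of this component that is not
matched inside the component. -/
structure TightBarrier {V : Type*} (G : SimpleGraph V) (μ : V → V) (O : V → Prop) (β : V → V) :
    Prop where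
  root : ∀ x, μ x = x → O x ∧ β x = x
  step : ∀ x v, O x → G.Adj x v →
    (O v ∧ β v = β x) ∨ (¬ O v ∧ O (μ v) ∧ β (μ v) = μ v)
  mate : ∀ x, O x → β x ≠ x → O (μ x) ∧ β (μ x) = β x

/-- A set of odd size that is not entered by the matching edges contains an exposed vertex. -/
lemma exists_exit_of_odd {V : Type*} [DecidableEq V] (μ : V → V) (hμ : ∀ x, μ (μ x) = x)
    (s : Finset V) (hs : Odd #s) : ∃ x ∈ s, μ x = x ∨ μ x ∉ s := by
  by_contra! h
  exact Nat.not_even_iff_odd.2 hs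
    (even_card_of_involution μ hμ s (fun x hx => (h x hx).2) (fun x hx => (h x hx).1))

/-- Equality in the Tutte–Berge formula. Every odd piece has a vertex that is exposed or matched
into the barrier `U`; the formula leaves room for only one such vertex per piece, and every vertex
of `U` and every exposed vertex is used. `O` is the union of the chosen odd pieces and `β` picks
that vertex. -/
theorem exists_tightBarrier {V : Type} [Fintype V] [DecidableEq V] (G : SimpleGraph V) (μ : V → V)
    (hμ : IsMate G μ) (hmax : ∀ ν, IsMate G ν → #(exposed μ) ≤ #(exposed ν)) :
    ∃ O β, TightBarrier G μ O β := by
  obtain ⟨U, ι, _, c, s, hc, hodd, hcard⟩ :=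
    exists_barrier G #(exposed μ) hmax (even_card_exposed_iff μ hμ.invol)
  have hb : ∀ i ∈ s, ∃ x, (x ∉ U ∧ c x = i) ∧ (μ x = x ∨ μ x ∈ U) := by
    intro i hi
    obtain ⟨x, hx, h⟩ := exists_exit_of_odd μ hμ.invol _ (hodd i hi)
    simp only [mem_filter, mem_univ, true_and] at hx h
    refine ⟨x, hx, ?_⟩
    by_cases h1 : μ x = x
    · exact .inl h1
    · by_contra h2
      push Not at h2
      have := hc x (μ x) (hμ.adj x h1) hx.1 h2.2
      exact (h.resolve_left h1) ⟨h2.2, this ▸ hx.2⟩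
  rcases isEmpty_or_nonempty V with hV | hV
  · exact ⟨fun _ => True, id, ⟨fun x => hV.elim x, fun x => hV.elim x, fun x => hV.elim x⟩⟩
  choose! b hbK hbU using hb
  -- The map is injective on `s`, lands in `exposed μ ∪ U`, and `s` has at least `#U + #(exposed μ)`
  -- elements; hence it is onto.
  have himg : s.image (fun i => μ (b i)) = exposed μ ∪ U := by
    refine eq_of_subset_of_card_le ?_ ?_
    · intro x hx
      obtain ⟨i, hi, rfl⟩ := mem_image.1 hx
      rw [mem_union, mem_exposed]
      rcases hbU i hi with h | h
      · left; rw [h, h]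
      · exact .inr h
    · rw [card_image_of_injOn]
      · have := card_union_le (exposed μ) U
        omega
      · intro i hi j hj h
        have : b i = b j := by rw [← hμ.invol (b i), ← hμ.invol (b j)]; exact congrArg μ h
        rw [← (hbK i hi).2, ← (hbK j hj).2, this]
  have hsurj : ∀ x, μ x = x ∨ x ∈ U → ∃ i ∈ s, b i = μ x := by
    intro x hx
    have : x ∈ s.image (fun i => μ (b i)) := by
      rw [himg, mem_union, mem_exposed]; exact hx
    obtain ⟨i, hi, rfl⟩ := mem_image.1 this
    exact ⟨i, hi, (hμ.invol _).symm⟩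
  have hroot : ∀ x, μ x = x → (x ∉ U ∧ c x ∈ s) ∧ b (c x) = x := by
    intro x hx
    obtain ⟨i, hi, h⟩ := hsurj x (.inl hx)
    rw [hx] at h
    obtain ⟨h1, h2⟩ := hbK i hi
    rw [h] at h1 h2
    subst h2
    exact ⟨⟨h1, hi⟩, h⟩
  refine ⟨fun x => x ∉ U ∧ c x ∈ s, fun x => b (c x), ⟨hroot, ?_, ?_⟩⟩
  · rintro x v ⟨hxU, hx⟩ hv
    by_cases hvU : v ∈ U
    · obtain ⟨i, hi, h⟩ := hsurj v (.inr hvU)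
      obtain ⟨h1, h2⟩ := hbK i hi
      refine .inr ⟨fun h' => h'.1 hvU, ?_, ?_⟩
      · rw [← h, h2]; exact ⟨h1, hi⟩
      · rw [← h, h2]
    · have := hc x v hv hxU hvU
      exact .inl ⟨⟨hvU, this ▸ hx⟩, by rw [this]⟩
  · rintro x ⟨hxU, hx⟩ hne
    have h1 : μ x ≠ x := fun h => hne (hroot x h).2
    have h2 : μ x ∉ U := by
      intro h
      obtain ⟨i, hi, h'⟩ := hsurj (μ x) (.inr h)
      rw [hμ.invol] at h'
      apply hne
      rw [← h', (hbK i hi).2]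
    have := hc x (μ x) (hμ.adj x h1) hxU h2
    exact ⟨⟨h2, this ▸ hx⟩, by rw [this]⟩

/-! ### Blossom labels and their compatibility with tight barriers -/

/-- The state of the search for blossoms: `cl` gives the blossom of every vertex that is reached
from an exposed vertex by an even alternating path (and `0` for the other vertices), `bs` the base
of every blossom. -/
structure BlossomInv {V : Type*} (μ : V → V) (cl : V → ℕ) (bs : ℕ → V) (cnt : ℕ) : Prop where
  exp : ∀ x, μ x = x → cl x ≠ 0
  le : ∀ x, cl x ≤ cnt
  cl_bs : ∀ x, cl x ≠ 0 → cl (bs (cl x)) = cl x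
  nonbase : ∀ x, cl x ≠ 0 → bs (cl x) ≠ x → μ x ≠ x ∧ cl (μ x) = cl x
  base : ∀ x, cl x ≠ 0 → bs (cl x) = x → μ x ≠ x → cl (μ x) = 0

/-- Blossoms stay inside the components of a tight barrier, and the first blossom of a component
contains its unmatched vertex. -/
structure BarrierInv {V : Type*} (O : V → Prop) (β : V → V) (cl : V → ℕ) : Prop where
  odd : ∀ x, cl x ≠ 0 → O x ∧ cl (β x) ≠ 0 ∧ cl (β x) ≤ cl x
  same : ∀ x y, cl x ≠ 0 → cl x = cl y → β x = β y

variable {V : Type*} {μ : V → V} {cl cl' : V → ℕ} {bs bs' : ℕ → V} {cnt : ℕ}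
  {G : SimpleGraph V} {O : V → Prop} {β : V → V}

lemma BlossomInv.init (h0 : ∀ x, cl x ≠ 0 ↔ μ x = x) (hle : ∀ x, cl x ≤ cnt)
    (hbs : ∀ x, cl x ≠ 0 → bs (cl x) = x) : BlossomInv μ cl bs cnt where
  exp x := (h0 x).2
  le := hle
  cl_bs x hx := by rw [hbs x hx]
  nonbase x hx h := absurd (hbs x hx) h
  base x hx _ h := absurd ((h0 x).1 hx) h

lemma BarrierInv.init (hB : TightBarrier G μ O β) (h0 : ∀ x, cl x ≠ 0 ↔ μ x = x)
    (hbs : ∀ x, cl x ≠ 0 → bs (cl x) = x) : BarrierInv O β cl where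
  odd x hx := by
    obtain ⟨h1, h2⟩ := hB.root x ((h0 x).1 hx)
    rw [h2]; exact ⟨h1, hx, le_rfl⟩
  same x y hx h := by rw [← hbs x hx, ← hbs y (h ▸ hx), h]

/-- The partner of `v` becomes a blossom by itself, with the fresh label `cnt + 1`. Its own partner
`v` stays unlabelled, as the clause on bases demands. -/
lemma BlossomInv.grow (h : BlossomInv μ cl bs cnt) (hμ : ∀ x, μ (μ x) = x) {v : V}
    (hv : cl v = 0) (hw : cl (μ v) = 0)
    (hcl : ∀ x, (x = μ v → cl' x = cnt + 1) ∧ (x ≠ μ v → cl' x = cl x))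
    (hbs : ∀ c, (c = cnt + 1 → bs' c = μ v) ∧ (c ≠ cnt + 1 → bs' c = bs c)) :
    BlossomInv μ cl' bs' (cnt + 1) := by
  obtain ⟨h1, h2, h3, h4, h5⟩ := h
  have hvw : v ≠ μ v := fun e => h1 v e.symm hv
  have hne : ∀ x, cl x ≠ cnt + 1 := fun x => by have := h2 x; omega
  have hbw : bs' (cnt + 1) = μ v := (hbs _).1 rfl
  have hbs' : ∀ x, bs' (cl x) = bs (cl x) := fun x => (hbs _).2 (hne x)
  have hclw : cl' (μ v) = cnt + 1 := (hcl _).1 rfl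
  have hcl' : ∀ x, x ≠ μ v → cl' x = cl x := fun x => (hcl x).2
  have hcv : cl' v = 0 := by rw [hcl' v hvw, hv]
  constructor <;> intro x <;> rcases eq_or_ne x (μ v) with rfl | hx
  · omega
  · rw [hcl' x hx]; exact h1 x
  · omega
  · rw [hcl' x hx]; have := h2 x; omega
  · rw [hclw, hbw, hclw]; exact fun _ => rfl
  · rw [hcl' x hx, hbs']
    intro h0
    rw [hcl' _ (fun e => by have := h3 x h0; rw [e, hw] at this; exact h0 this.symm)]
    exact h3 x h0
  · rw [hclw, hbw]; exact fun _ h => absurd rfl h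
  · rw [hcl' x hx, hbs']
    intro h0 hb
    obtain ⟨a, b⟩ := h4 x h0 hb
    exact ⟨a, by rw [hcl' _ (fun e => by rw [e, hw] at b; exact h0 b.symm), b]⟩
  · rw [hμ, hcv]; exact fun _ _ _ => rfl
  · rw [hcl' x hx, hbs']
    intro h0 hb hm
    rw [hcl' _ (fun e => h0 (by rw [← hμ x, e, hμ, hv])), h5 x h0 hb hm]

/-- An edge from `u` either stays in the component or enters the barrier. In the first case `v` is
unlabelled and so not the unmatched vertex of the component, which is labelled already; hence its
partner lies in the same component. In the second case the partner is the unmatched vertex of its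
component, and it carries the new label itself. The new label exceeds all old ones, so the order
condition persists. -/
lemma BarrierInv.grow (h : BlossomInv μ cl bs cnt) (hk : BarrierInv O β cl)
    (hB : TightBarrier G μ O β) {u v : V} (huv : G.Adj u v)
    (hu : cl u ≠ 0) (hv : cl v = 0) (hw : cl (μ v) = 0)
    (hcl : ∀ x, (x = μ v → cl' x = cnt + 1) ∧ (x ≠ μ v → cl' x = cl x)) :
    BarrierInv O β cl' := by
  have h2 := h.le
  obtain ⟨k1, k2, k3⟩ := hk.odd u hu
  have hOw : O (μ v) ∧ (β (μ v) = μ v ∨ (β (μ v) ≠ μ v ∧ cl (β (μ v)) ≠ 0)) := by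
    rcases hB.step u v k1 huv with ⟨a, b⟩ | ⟨a, b, c⟩
    · obtain ⟨c, d⟩ := hB.mate v a (by intro e; rw [b] at e; rw [e] at k2; exact k2 hv)
      have : cl (β (μ v)) ≠ 0 := by rw [d, b]; exact k2
      exact ⟨c, .inr ⟨fun e => this (by rw [e]; exact hw), this⟩⟩
    · exact ⟨b, .inl c⟩
  have hne : ∀ x, cl x ≠ cnt + 1 := fun x => by have := h2 x; omega
  have hclw : cl' (μ v) = cnt + 1 := (hcl _).1 rfl
  have hcl' : ∀ x, x ≠ μ v → cl' x = cl x := fun x => (hcl x).2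
  constructor
  · intro x hx
    rcases eq_or_ne x (μ v) with rfl | hxw
    · refine ⟨hOw.1, ?_⟩
      rcases hOw.2 with e | ⟨e, f⟩
      · rw [e]; exact ⟨hx, le_rfl⟩
      · rw [hcl' _ e, hclw]; have := h2 (β (μ v)); exact ⟨f, by omega⟩
    · rw [hcl' x hxw] at hx ⊢
      obtain ⟨a, b, c⟩ := hk.odd x hx
      rw [hcl' _ (fun e => b (by rw [e, hw]))]
      exact ⟨a, b, c⟩
  · intro x y hx hxy
    have := hne x; have := hne y
    rcases eq_or_ne x (μ v) with rfl | hxw <;> rcases eq_or_ne y (μ v) with rfl | hyw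
    · rfl
    · rw [hclw, hcl' y hyw] at hxy; omega
    · rw [hclw, hcl' x hxw] at hxy; omega
    · rw [hcl' x hxw] at hx hxy; rw [hcl' y hyw] at hxy
      exact hk.same x y hx hxy

/-- The later blossom, the partner of its base and the earlier blossom are united. The base of the
later blossom is now matched inside, so the base of the earlier one is the only base left. The rest
of the cycle that Edmonds' algorithm would contract is left to further steps. -/
lemma BlossomInv.merge (h : BlossomInv μ cl bs cnt) (hμ : ∀ x, μ (μ x) = x) {u v : V}
    (hv : cl v ≠ 0) (huv : cl v < cl u) (hw : μ (bs (cl u)) ≠ bs (cl u))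
    (hcl : ∀ x, ((cl x = cl u ∨ x = μ (bs (cl u))) → cl' x = cl v) ∧
      (cl x ≠ cl u → x ≠ μ (bs (cl u)) → cl' x = cl x)) :
    BlossomInv μ cl' bs cnt := by
  obtain ⟨h1, h2, h3, h4, h5⟩ := h
  have hu0 : cl u ≠ 0 := by omega
  have hwc := h3 u hu0
  have hy : cl (μ (bs (cl u))) = 0 := h5 _ (by rw [hwc]; exact hu0) (by rw [hwc]) hw
  have hyw := hμ (bs (cl u))
  have hcy := (hcl (μ (bs (cl u)))).1 (.inr rfl)
  constructor <;> intro x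
  · have a := hcl x; have b := h1 x; clear hcl h1 h2 h3 h4 h5 hμ; grind
  · have a := hcl x; have b := h2 x; have c := h2 v; clear hcl h1 h2 h3 h4 h5 hμ; grind
  · have a := hcl x; have b := hcl (bs (cl x)); have c := hcl (bs (cl v))
    have d := h3 v; have e := h3 x
    clear hcl h1 h2 h3 h4 h5 hμ
    grind
  · have a := hcl x; have b := hcl (μ x); have c := h4 x; have d := hμ x
    clear hcl h1 h2 h3 h4 h5 hμ
    grind
  · have a := hcl x; have b := hcl (μ x); have c := h5 x; have d := hμ x; have e := h3 v
    clear hcl h1 h2 h3 h4 h5 hμ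
    grind

/-- Adjacent vertices of different blossoms: the later blossom does not contain the unmatched
vertex of the component. -/
lemma BarrierInv.base_ne (h : BlossomInv μ cl bs cnt) (hk : BarrierInv O β cl)
    (hB : TightBarrier G μ O β) {u v : V} (huv : G.Adj u v)
    (hv : cl v ≠ 0) (hlt : cl v < cl u) :
    β v = β u ∧ β (bs (cl u)) = β u ∧ O (bs (cl u)) ∧ β (bs (cl u)) ≠ bs (cl u) := by
  have hu0 : cl u ≠ 0 := by omega
  obtain ⟨k1, k2, k3⟩ := hk.odd u hu0
  obtain ⟨l1, l2, l3⟩ := hk.odd v hv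
  have hwc := h.cl_bs u hu0
  have hbw : β (bs (cl u)) = β u := (hk.same u _ hu0 hwc.symm).symm
  rcases hB.step u v k1 huv with ⟨a, b⟩ | ⟨a, -⟩
  -- If the base of the later blossom were the unmatched vertex of the component, this vertex would
  -- carry the label `cl u`; but its label is at most `cl v`.
  · refine ⟨b, hbw, (hk.odd _ (by rw [hwc]; exact hu0)).1, fun e => ?_⟩
    rw [hbw, ← b] at e
    rw [e, hwc] at l3
    omega
  · exact absurd l1 a

/-- By `BarrierInv.base_ne` both blossoms lie in one component, and the base of the later one is not
its unmatched vertex; so the partner of that base lies in the same component too. -/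
lemma BarrierInv.merge (h : BlossomInv μ cl bs cnt) (hk : BarrierInv O β cl)
    (hB : TightBarrier G μ O β) {u v : V} (huv : G.Adj u v)
    (hv : cl v ≠ 0) (hlt : cl v < cl u) (hw : μ (bs (cl u)) ≠ bs (cl u))
    (hcl : ∀ x, ((cl x = cl u ∨ x = μ (bs (cl u))) → cl' x = cl v) ∧
      (cl x ≠ cl u → x ≠ μ (bs (cl u)) → cl' x = cl x)) :
    BarrierInv O β cl' := by
  have hu0 : cl u ≠ 0 := by omega
  obtain ⟨e1, e2, e3, e4⟩ := hk.base_ne h hB huv hv hlt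
  obtain ⟨m1, m2⟩ := hB.mate _ e3 e4
  have hwc := h.cl_bs u hu0
  have hy : cl (μ (bs (cl u))) = 0 := h.base _ (by rw [hwc]; exact hu0) (by rw [hwc]) hw
  have hodd := hk.odd
  have hsame := hk.same
  constructor
  · intro x hx
    have h1 := hcl x
    have h2 := hcl (β x)
    have h4 := hodd x
    have h5 := hodd v hv
    have h6 := hsame x u
    clear hcl hsame hodd hk hB h
    grind
  · intro x y hx hxy
    have h1 := hcl x
    have h2 := hcl y
    have h6 := hsame x u
    have h7 := hsame y u
    have h8 := hsame x v
    have h9 := hsame y v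
    have h10 := hsame x y
    clear hcl hsame hodd hk hB h
    grind

/-- A search that is stuck without having found an augmentation certifies that the matching is
maximum. -/
theorem BlossomInv.exposed_le [Fintype V] [DecidableEq V] (h : BlossomInv μ cl bs cnt)
    (hμ : ∀ x, μ (μ x) = x)
    (hclosed : ∀ u v, G.Adj u v → cl u ≠ 0 → cl v = cl u ∨ (cl v = 0 ∧ cl (μ v) ≠ 0))
    {ν : V → V} (hν : IsMate G ν) : #(exposed μ) ≤ #(exposed ν) := by
  let C : Finset ℕ := (univ.filter fun x => cl x ≠ 0).image cl
  let A : Finset V := univ.filter fun v => cl v = 0 ∧ cl (μ v) ≠ 0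
  have hA : ∀ v, v ∈ A ↔ cl v = 0 ∧ cl (μ v) ≠ 0 := by simp [A]
  have hC : ∀ i, i ∈ C ↔ ∃ x, cl x = i ∧ i ≠ 0 := by
    intro i
    simp only [C, mem_image, mem_filter, mem_univ, true_and]
    exact ⟨fun ⟨x, a, b⟩ => ⟨x, b, b ▸ a⟩, fun ⟨x, a, b⟩ => ⟨x, a ▸ b, a⟩⟩
  have hdisj : Disjoint (exposed μ) A := by
    rw [disjoint_left]
    intro x hx hxA
    exact h.exp x (mem_exposed.1 hx) ((hA x).1 hxA).1
  -- `C` is the set of blossoms and `A` acts as the Tutte–Berge barrier. The partner under `μ` of a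
  -- vertex in `exposed μ ∪ A` is always the base of its blossom, so different vertices give
  -- different blossoms.
  have h1 : #(exposed μ) + #A ≤ #C := by
    rw [← card_union_of_disjoint hdisj]
    have key : ∀ x ∈ exposed μ ∪ A, cl (μ x) ≠ 0 ∧ bs (cl (μ x)) = μ x := by
      intro x hx
      rw [mem_union, mem_exposed, hA] at hx
      have h0 : cl (μ x) ≠ 0 := by
        rcases hx with hx | hx
        · rw [hx]; exact h.exp x hx
        · exact hx.2
      refine ⟨h0, ?_⟩
      by_contra hne
      have := h.nonbase (μ x) h0 hne
      rw [hμ] at this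
      rcases hx with hx | hx
      · exact this.1 hx.symm
      · exact h0 (this.2 ▸ hx.1)
    refine card_le_card_of_injOn (fun x => cl (μ x)) (fun x hx => ?_) (fun x hx y hy hxy => ?_)
    · exact (hC _).2 ⟨μ x, rfl, (key x hx).1⟩
    · have : μ x = μ y := by
        rw [← (key x hx).2, ← (key y hy).2]; exact congrArg bs hxy
      rw [← hμ x, this, hμ]
  -- Every blossom has odd size, because `μ` pairs off everything but the base. So `ν` exposes one
  -- of its vertices or matches one out of it, and by closedness the latter leads into `A`.
  have h2 : #C ≤ #(exposed ν ∪ A) := by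
    have hex : ∀ i ∈ C, ∃ x, cl x = i ∧ ν x ∈ exposed ν ∪ A := by
      intro i hi
      obtain ⟨z, hz, hi0⟩ := (hC i).1 hi
      have hbi : cl (bs i) = i := by have := h.cl_bs z (hz ▸ hi0); rwa [hz] at this
      have hodd : Odd #{x | cl x = i} := by
        have hmem : bs i ∈ (univ.filter fun x => cl x = i) := by simpa using hbi
        have := even_card_of_involution μ hμ ((univ.filter fun x => cl x = i).erase (bs i))
          (fun x hx => by
            simp only [mem_erase, mem_filter, mem_univ, true_and] at hx ⊢
            obtain ⟨hx1, hx2⟩ := hx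
            have hn := h.nonbase x (hx2 ▸ hi0) (by rw [hx2]; exact hx1.symm)
            refine ⟨fun e => ?_, by rw [hn.2, hx2]⟩
            have hb := h.base (bs i) (by rw [hbi]; exact hi0) (by rw [hbi])
            rw [← e, hμ] at hb
            exact hi0 (hx2 ▸ hb hn.1.symm))
          (fun x hx => by
            simp only [mem_erase, mem_filter, mem_univ, true_and] at hx
            exact (h.nonbase x (hx.2 ▸ hi0) (by rw [hx.2]; exact hx.1.symm)).1)
        rw [card_erase_of_mem hmem] at this
        have hpos := card_pos.2 ⟨_, hmem⟩
        grind
      obtain ⟨x, hx, hex⟩ := exists_exit_of_odd ν hν.invol _ hodd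
      simp only [mem_filter, mem_univ, true_and] at hx hex
      refine ⟨x, hx, ?_⟩
      rw [mem_union, mem_exposed, hA, hν.invol]
      by_cases hfx : ν x = x
      · exact .inl hfx.symm
      · rcases hclosed x (ν x) (hν.adj x hfx) (by rw [hx]; exact hi0) with h' | h'
        · exact absurd (h'.trans hx) (hex.resolve_left hfx)
        · exact .inr h'
    rcases isEmpty_or_nonempty V with hV | hV
    · have : C = ∅ := eq_empty_of_forall_notMem fun i hi => hV.elim ((hC i).1 hi).choose
      simp [this]
    choose! b hb1 hb2 using hex
    refine card_le_card_of_injOn (fun i => ν (b i)) (fun i hi => hb2 i hi) (fun i hi j hj hij => ?_)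
    have : b i = b j := by rw [← hν.invol (b i), ← hν.invol (b j)]; exact congrArg ν hij
    rw [← hb1 i hi, ← hb1 j hj, this]
  have h3 := card_union_le (exposed ν) A
  omega

end TwoPPM

/-! ## Matchings as sets of edges -/

namespace TwoPPM

open Finset

section Ends

variable {V β : Type*} (e0 e1 : β → V)

/-- The edge `b` with the ends `e0 b` and `e1 b` is incident with `x`. -/
def IncEnds (b : β) (x : V) : Prop := e0 b = x ∨ e1 b = x

/-- No two edges share an end. -/
def IsMatEnds (M : Finset β) : Prop :=
  ∀ b ∈ M, ∀ b' ∈ M, ∀ x, IncEnds e0 e1 b x → IncEnds e0 e1 b' x → b = b'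

/-- `M` is at least as large as every matching that uses only the edges in `act`. -/
def MaxEnds (act M : Finset β) : Prop :=
  ∀ N ⊆ act, IsMatEnds e0 e1 N → #N ≤ #M

/-- The simple graph of the edges in `act`. -/
def endsGraph (act : Finset β) : SimpleGraph V where
  Adj x y := x ≠ y ∧ ∃ b ∈ act, (e0 b = x ∧ e1 b = y) ∨ (e0 b = y ∧ e1 b = x)
  symm := ⟨fun _ _ h => ⟨h.1.symm, h.2.imp fun _ hb => ⟨hb.1, hb.2.symm⟩⟩⟩
  loopless := ⟨fun _ h => h.1 rfl⟩

/-- `μ` exchanges the ends of the edges in `M` and fixes all other vertices. -/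
structure IsMateOf (M : Finset β) (μ : V → V) : Prop where
  fst : ∀ b ∈ M, μ (e0 b) = e1 b
  snd : ∀ b ∈ M, μ (e1 b) = e0 b
  fix : ∀ x, (∀ b ∈ M, ¬ IncEnds e0 e1 b x) → μ x = x

variable {e0 e1}

lemma MaxEnds.mono {act act' M : Finset β} (h : MaxEnds e0 e1 act M) (hs : act' ⊆ act) :
    MaxEnds e0 e1 act' M :=
  fun N hN => h N (hN.trans hs)

lemma IsMatEnds.exists_mate {M : Finset β} (hM : IsMatEnds e0 e1 M) :
    ∃ μ, IsMateOf e0 e1 M μ := by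
  classical
  refine ⟨fun x => if h : ∃ b ∈ M, IncEnds e0 e1 b x then
    (if e0 h.choose = x then e1 h.choose else e0 h.choose) else x, ?_, ?_, ?_⟩
  · intro b hb
    have h : ∃ b' ∈ M, IncEnds e0 e1 b' (e0 b) := ⟨b, hb, .inl rfl⟩
    have : h.choose = b := hM _ h.choose_spec.1 b hb _ h.choose_spec.2 (.inl rfl)
    simp only [h, dif_pos, this, if_true]
  · intro b hb
    have h : ∃ b' ∈ M, IncEnds e0 e1 b' (e1 b) := ⟨b, hb, .inr rfl⟩
    have : h.choose = b := hM _ h.choose_spec.1 b hb _ h.choose_spec.2 (.inr rfl)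
    simp only [h, dif_pos, this]
    split_ifs with h'
    · exact h'.symm
    · rfl
  · intro x hx
    rw [dif_neg]
    rintro ⟨b, hb, h⟩
    exact hx b hb h

lemma IsMateOf.isMate {act M : Finset β} {μ : V → V} (hne : ∀ b, e0 b ≠ e1 b)
    (hμ : IsMateOf e0 e1 M μ) (hs : M ⊆ act) : IsMate (endsGraph e0 e1 act) μ := by
  have key : ∀ x, μ x = x ∨ ∃ b ∈ M, (e0 b = x ∧ μ x = e1 b) ∨ (e1 b = x ∧ μ x = e0 b) := by
    intro x
    by_cases h : ∀ b ∈ M, ¬ IncEnds e0 e1 b x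
    · exact .inl (hμ.fix x h)
    · push Not at h
      obtain ⟨b, hb, rfl | rfl⟩ := h
      · exact .inr ⟨b, hb, .inl ⟨rfl, hμ.fst b hb⟩⟩
      · exact .inr ⟨b, hb, .inr ⟨rfl, hμ.snd b hb⟩⟩
  constructor
  · intro x
    rcases key x with h | ⟨b, hb, ⟨rfl, h⟩ | ⟨rfl, h⟩⟩
    · rw [h, h]
    · rw [h, hμ.snd b hb]
    · rw [h, hμ.fst b hb]
  · intro x hx
    rcases key x with h | ⟨b, hb, ⟨rfl, h⟩ | ⟨rfl, h⟩⟩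
    · exact absurd h hx
    · rw [h]; exact ⟨hne b, b, hs hb, .inl ⟨rfl, rfl⟩⟩
    · rw [h]; exact ⟨(hne b).symm, b, hs hb, .inr ⟨rfl, rfl⟩⟩

lemma IsMateOf.card_add [Fintype V] [DecidableEq V] {M : Finset β} {μ : V → V}
    (hne : ∀ b, e0 b ≠ e1 b) (hM : IsMatEnds e0 e1 M) (hμ : IsMateOf e0 e1 M μ) :
    2 * #M + #(exposed μ) = Fintype.card V := by
  have h : (exposed μ)ᶜ = M.image e0 ∪ M.image e1 := by
    ext x
    simp only [mem_compl, mem_exposed, mem_union, mem_image]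
    constructor
    · intro hx
      by_contra h'
      push Not at h'
      refine hx (hμ.fix x fun b hb => ?_)
      rintro (h | h)
      · exact h'.1 b hb h
      · exact h'.2 b hb h
    · rintro (⟨b, hb, rfl⟩ | ⟨b, hb, rfl⟩)
      · rw [hμ.fst b hb]; exact (hne b).symm
      · rw [hμ.snd b hb]; exact hne b
  have hd : Disjoint (M.image e0) (M.image e1) := by
    rw [disjoint_left]
    rintro x hx hx'
    obtain ⟨b, hb, rfl⟩ := mem_image.1 hx
    obtain ⟨b', hb', h⟩ := mem_image.1 hx'
    have := hM b hb b' hb' _ (.inl rfl) (.inr h)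
    subst this
    exact hne b h.symm
  have h1 := card_compl (exposed μ)
  rw [h, card_union_of_disjoint hd,
    card_image_of_injOn (fun b hb b' hb' e => hM b hb b' hb' _ (.inl e) (.inl rfl)),
    card_image_of_injOn (fun b hb b' hb' e => hM b hb b' hb' _ (.inr e) (.inr rfl))] at h1
  have h2 := card_le_univ (exposed μ)
  omega

/-- Parallel edges leave a choice of the edges that realize `ν`. A largest matching compatible with
`ν` works: an edge realizing `ν` at an uncovered vertex that is not fixed could be added. -/
lemma IsMate.exists_isMatEnds [Fintype V] [DecidableEq V] {act : Finset β} {ν : V → V}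
    (hne : ∀ b, e0 b ≠ e1 b) (hν : IsMate (endsGraph e0 e1 act) ν) :
    ∃ N ⊆ act, IsMatEnds e0 e1 N ∧ 2 * #N + #(exposed ν) = Fintype.card V := by
  classical
  obtain ⟨N, hN, hmax⟩ := exists_max_image (act.powerset.filter fun N =>
      IsMatEnds e0 e1 N ∧ ∀ b ∈ N, ν (e0 b) = e1 b) card
    ⟨∅, mem_filter.2 ⟨by simp, by simp [IsMatEnds], by simp⟩⟩
  simp only [mem_filter, mem_powerset] at hN hmax
  obtain ⟨hNa, hNM, hNν⟩ := hN
  have hNν' : ∀ b ∈ N, ν (e1 b) = e0 b := fun b hb => by rw [← hNν b hb, hν.invol]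
  refine ⟨N, hNa, hNM, IsMateOf.card_add hne hNM ⟨hNν, hNν', fun x hx => ?_⟩⟩
  by_contra hfx
  obtain ⟨-, b, hb, hbx⟩ := hν.adj x hfx
  have hνb : ν (e0 b) = e1 b := by
    rcases hbx with ⟨h1, h2⟩ | ⟨h1, h2⟩
    · rw [h1, h2]
    · rw [h1, h2, hν.invol]
  have hνb' : ν (e1 b) = e0 b := by rw [← hνb, hν.invol]
  have hfree : ∀ b' ∈ N, ∀ y, IncEnds e0 e1 b' y → IncEnds e0 e1 b y → False := by
    intro b' hb' y h1 h2
    have h3 : x = y ∨ x = ν y := by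
      rcases hbx with ⟨rfl, _⟩ | ⟨_, rfl⟩ <;> rcases h2 with rfl | rfl <;> simp [hνb, hνb']
    rcases h3 with rfl | rfl
    · exact hx b' hb' h1
    · rcases h1 with rfl | rfl
      · exact hx b' hb' (.inr (hNν b' hb').symm)
      · exact hx b' hb' (.inl (hNν' b' hb').symm)
  have hbN : b ∉ N := fun h => hfree b h _ (.inl rfl) (.inl rfl)
  have := hmax (insert b N) ⟨insert_subset hb hNa, ?_, ?_⟩
  · rw [card_insert_of_notMem hbN] at this
    omega
  · intro c hc c' hc' y h h'
    rcases mem_insert.1 hc with e | e <;> rcases mem_insert.1 hc' with e' | e'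
    · rw [e, e']
    · exact (hfree c' e' y h' (e ▸ h)).elim
    · exact (hfree c e y h (e' ▸ h')).elim
    · exact hNM c e c' e' y h h'
  · intro c hc
    rcases mem_insert.1 hc with rfl | hc
    · exact hνb
    · exact hNν c hc

theorem MaxEnds.exists_tightBarrier {V : Type} {e0 e1 : β → V} [Fintype V] [DecidableEq V]
    {act M : Finset β} {μ : V → V}
    (hne : ∀ b, e0 b ≠ e1 b) (hs : M ⊆ act) (hM : IsMatEnds e0 e1 M) (hμ : IsMateOf e0 e1 M μ)
    (hmax : MaxEnds e0 e1 act M) : ∃ O π, TightBarrier (endsGraph e0 e1 act) μ O π := by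
  refine TwoPPM.exists_tightBarrier _ μ (hμ.isMate hne hs) fun ν hν => ?_
  obtain ⟨N, h1, h2, h3⟩ := hν.exists_isMatEnds hne
  have := hmax N h1 h2
  have := hμ.card_add hne hM
  omega

theorem BlossomInv.maxEnds [Fintype V] [DecidableEq V] {act M : Finset β} {μ : V → V}
    {cl : V → ℕ} {bs : ℕ → V} {cnt : ℕ} (h : BlossomInv μ cl bs cnt)
    (hne : ∀ b, e0 b ≠ e1 b) (hs : M ⊆ act) (hM : IsMatEnds e0 e1 M) (hμ : IsMateOf e0 e1 M μ)
    (hclosed : ∀ u v, (endsGraph e0 e1 act).Adj u v → cl u ≠ 0 →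
      cl v = cl u ∨ (cl v = 0 ∧ cl (μ v) ≠ 0)) : MaxEnds e0 e1 act M := by
  intro N hN hN'
  obtain ⟨ν, hν⟩ := hN'.exists_mate
  have h1 := h.exposed_le (hμ.isMate hne hs).invol hclosed (hν.isMate hne hN)
  have h2 := hν.card_add hne hN'
  have h3 := hμ.card_add hne hM
  omega

/-- If `M` is not maximum in `act`, but becomes so when any edge outside `M` is deleted, then these
edges together with the edges of `M` that they do not meet form a larger matching. -/
theorem exists_augmentation {act M M' : Finset β} (hM : IsMatEnds e0 e1 M)
    (hnot : ¬ MaxEnds e0 e1 act M)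
    (hcrit : ∀ b ∈ act, b ∉ M → ∀ N ⊆ act, b ∉ N → IsMatEnds e0 e1 N → #N ≤ #M)
    (hM' : ∀ b, b ∈ M' ↔ b ∈ act ∧
      (b ∉ M ∨ ∀ c ∈ act, c ∉ M → ∀ x, IncEnds e0 e1 b x → ¬ IncEnds e0 e1 c x)) :
    IsMatEnds e0 e1 M' ∧ #M < #M' := by
  unfold MaxEnds at hnot
  push Not at hnot
  obtain ⟨N, hN, hNM, hcard⟩ := hnot
  -- By criticality every larger matching uses all active edges outside `M`. So these are pairwise
  -- disjoint, and the part of `N` in `M` is disjoint from them, whence `N ⊆ M'`.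
  have hR : ∀ b ∈ act, b ∉ M → b ∈ N := by
    intro b hb hbM
    by_contra hbN
    have := hcrit b hb hbM N hN hbN hNM
    omega
  refine ⟨?_, hcard.trans_le (card_le_card fun b hb => ?_)⟩
  · intro b hb b' hb' x h h'
    obtain ⟨h1, h2⟩ := (hM' b).1 hb
    obtain ⟨h1', h2'⟩ := (hM' b').1 hb'
    by_cases hbM : b ∈ M <;> by_cases hbM' : b' ∈ M
    · exact hM b hbM b' hbM' x h h'
    · exact absurd h' (h2.resolve_left (not_not.2 hbM) b' h1' hbM' x h)
    · exact absurd h (h2'.resolve_left (not_not.2 hbM') b h1 hbM x h')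
    · exact hNM b (hR b h1 hbM) b' (hR b' h1' hbM') x h h'
  · refine (hM' b).2 ⟨hN hb, ?_⟩
    by_cases hbM : b ∈ M
    · right
      intro c hc hcM x hx hx'
      have := hNM b hb c (hR c hc hcM) x hx hx'
      exact hcM (this ▸ hbM)
    · exact .inl hbM

end Ends

end TwoPPM

/-! ## Balanced orientations -/

namespace TwoPPM

open Finset

section Orientation

variable {V β : Type*} (e0 e1 : β → V)

/-- The pair `p v`, `q v` of edges at `v` is balanced by the orientation that gives every edge `b`
the tail `tl b`, for all processed vertices `v`; `co` numbers the classes of edges whose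
orientations depend on each other. Two ends of edges of one class that are not paired yet
are oriented oppositely. -/
structure OrientInv (p q : V → β) (done : V → Prop) (co : β → ℕ) (tl : β → V) : Prop where
  tail : ∀ b, IncEnds e0 e1 b (tl b)
  paired : ∀ v, done v → co (p v) = co (q v) ∧ (tl (p v) = v ↔ tl (q v) ≠ v)
  free : ∀ b x b' x', IncEnds e0 e1 b x → IncEnds e0 e1 b' x' → (b ≠ b' ∨ x ≠ x') →
    ¬ (done x ∧ (b = p x ∨ b = q x)) → ¬ (done x' ∧ (b' = p x' ∨ b' = q x')) → co b = co b' →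
    (tl b = x ↔ tl b' ≠ x')

variable {e0 e1} {p q : V → β} {done done' : V → Prop} {co co' : β → ℕ} {tl tl' : β → V}

/-- In a class with a single edge the only two different ends are those of this edge, and exactly
one of them is the tail. -/
lemma OrientInv.init (hne : ∀ b, e0 b ≠ e1 b) (hd : ∀ v, ¬ done v)
    (hco : ∀ b b', co b = co b' → b = b') (htl : ∀ b, IncEnds e0 e1 b (tl b)) :
    OrientInv e0 e1 p q done co tl where
  tail := htl
  paired v hv := absurd hv (hd v)
  free b x b' x' h h' hdiff _ _ hc := by
    obtain rfl := hco _ _ hc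
    have := htl b
    have := hne b
    unfold IncEnds at *
    grind

/-- All conditions compare two ends of one class, and reversing the whole class negates both sides.
-/
lemma OrientInv.flip (h : OrientInv e0 e1 p q done co tl) (k : ℕ)
    (hp : ∀ v, IncEnds e0 e1 (p v) v) (hq : ∀ v, IncEnds e0 e1 (q v) v)
    (htl : ∀ b, (co b = k → IncEnds e0 e1 b (tl' b) ∧ tl' b ≠ tl b) ∧ (co b ≠ k → tl' b = tl b)) :
    OrientInv e0 e1 p q done co tl' := by
  have key : ∀ b x, IncEnds e0 e1 b x → co b = k → (tl' b = x ↔ tl b ≠ x) := by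
    intro b x hx hb
    have h1 := h.tail b
    have h2 := (htl b).1 hb
    unfold IncEnds at *
    grind
  refine ⟨fun b => ?_, fun v hv => ?_, fun b x b' x' hx hx' hd hf hf' hc => ?_⟩
  · by_cases hb : co b = k
    · exact ((htl b).1 hb).1
    · rw [(htl b).2 hb]; exact h.tail b
  · obtain ⟨h1, h2⟩ := h.paired v hv
    refine ⟨h1, ?_⟩
    by_cases hk : co (p v) = k
    · have a := key _ _ (hp v) hk
      have b := key _ _ (hq v) (h1 ▸ hk)
      tauto
    · rw [(htl _).2 hk, (htl _).2 (h1 ▸ hk), h2]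
  · have h2 := h.free b x b' x' hx hx' hd hf hf' hc
    by_cases hk : co b = k
    · have a := key _ _ hx hk
      have b := key _ _ hx' (hc ▸ hk)
      tauto
    · rw [(htl _).2 hk, (htl _).2 (hc ▸ hk), h2]

/-- A trail closes up at `v`: the two ends at `v` are free ends of one class, so by `OrientInv.free`
they are oriented oppositely already. This is why that clause is carried along. -/
lemma OrientInv.close (h : OrientInv e0 e1 p q done co tl) {v : V}
    (hpq : p v ≠ q v) (hp : IncEnds e0 e1 (p v) v) (hq : IncEnds e0 e1 (q v) v)
    (hv : ¬ done v) (hc : co (p v) = co (q v)) (hd : ∀ w, done' w ↔ done w ∨ w = v) :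
    OrientInv e0 e1 p q done' co tl := by
  refine ⟨h.tail, fun w hw => ?_, fun b x b' x' hx hx' hdf hf hf' hcc => ?_⟩
  · rcases (hd w).1 hw with hw | rfl
    · exact h.paired w hw
    · exact ⟨hc, h.free _ _ _ _ hp hq (.inl hpq) (fun e => hv e.1) (fun e => hv e.1) hc⟩
  · exact h.free b x b' x' hx hx' hdf (fun e => hf ⟨(hd x).2 (.inl e.1), e.2⟩)
      (fun e => hf' ⟨(hd x').2 (.inl e.1), e.2⟩) hcc

/-- Two trails are joined at `v`. A free end of the first is opposite to `p v` at `v`, a free end of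
the second to `q v` at `v`, and these two are opposite to each other; so the free ends of the joined
trail are opposite. -/
lemma OrientInv.merge (h : OrientInv e0 e1 p q done co tl) {v : V}
    (hp : IncEnds e0 e1 (p v) v) (hq : IncEnds e0 e1 (q v) v)
    (hv : ¬ done v) (hc : co (p v) ≠ co (q v)) (ht : tl (p v) = v ↔ tl (q v) ≠ v)
    (hco : ∀ b, (co b = co (q v) → co' b = co (p v)) ∧ (co b ≠ co (q v) → co' b = co b))
    (hd : ∀ w, done' w ↔ done w ∨ w = v) :
    OrientInv e0 e1 p q done' co' tl := by
  refine ⟨h.tail, fun w hw => ?_, fun b x b' x' hx hx' hdf hf hf' hcc => ?_⟩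
  · rcases (hd w).1 hw with hw | rfl
    · obtain ⟨h1, h2⟩ := h.paired w hw
      refine ⟨?_, h2⟩
      have a := hco (p w)
      have b := hco (q w)
      grind
    · have a := hco (p w)
      have b := hco (q w)
      exact ⟨by grind, ht⟩
  · have g : ¬ (done x ∧ (b = p x ∨ b = q x)) := fun e => hf ⟨(hd x).2 (.inl e.1), e.2⟩
    have g' : ¬ (done x' ∧ (b' = p x' ∨ b' = q x')) := fun e => hf' ⟨(hd x').2 (.inl e.1), e.2⟩
    have n1 : b ≠ p v ∨ x ≠ v := by
      by_contra e; push Not at e; exact hf ⟨(hd x).2 (.inr e.2), .inl (by rw [e.1, e.2])⟩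
    have n2 : b ≠ q v ∨ x ≠ v := by
      by_contra e; push Not at e; exact hf ⟨(hd x).2 (.inr e.2), .inr (by rw [e.1, e.2])⟩
    have n1' : b' ≠ p v ∨ x' ≠ v := by
      by_contra e; push Not at e; exact hf' ⟨(hd x').2 (.inr e.2), .inl (by rw [e.1, e.2])⟩
    have n2' : b' ≠ q v ∨ x' ≠ v := by
      by_contra e; push Not at e; exact hf' ⟨(hd x').2 (.inr e.2), .inr (by rw [e.1, e.2])⟩
    have a1 := h.free b x (p v) v hx hp n1 g (fun e => hv e.1)
    have a2 := h.free b x (q v) v hx hq n2 g (fun e => hv e.1)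
    have a1' := h.free b' x' (p v) v hx' hp n1' g' (fun e => hv e.1)
    have a2' := h.free b' x' (q v) v hx' hq n2' g' (fun e => hv e.1)
    have a3 := h.free b x b' x' hx hx' hdf g g'
    have c1 := hco b
    have c2 := hco b'
    by_cases k1 : co b = co (q v) <;> by_cases k2 : co b' = co (q v)
    · exact a3 (k1.trans k2.symm)
    · rw [c1.1 k1, c2.2 k2] at hcc
      rw [a2 k1, ne_eq (tl b'), a1' hcc.symm, ← ht, not_ne_iff]
    · rw [c1.2 k1, c2.1 k2] at hcc
      rw [a1 hcc, ne_eq (tl b'), a2' k2, ← ht]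
    · rw [c1.2 k1, c2.2 k2] at hcc
      exact a3 hcc

/-- If the two edges at `v` lie in different classes and are not balanced yet, reversing the class
of `q v` balances them without disturbing the class of `p v`. -/
lemma exists_step (h : OrientInv e0 e1 p q done co tl) (hne : ∀ b, e0 b ≠ e1 b)
    (hpq : ∀ v, p v ≠ q v) (hp : ∀ v, IncEnds e0 e1 (p v) v) (hq : ∀ v, IncEnds e0 e1 (q v) v)
    {v : V} (hv : ¬ done v) (hd : ∀ w, done' w ↔ done w ∨ w = v) :
    ∃ co' tl', OrientInv e0 e1 p q done' co' tl' := by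
  classical
  by_cases hc : co (p v) = co (q v)
  · exact ⟨co, tl, h.close (hpq v) (hp v) (hq v) hv hc hd⟩
  · let tl' : β → V := fun b => if co b = co (q v) then
      (if e0 b = tl b then e1 b else e0 b) else tl b
    have htl' : ∀ b, (co b = co (q v) → IncEnds e0 e1 b (tl' b) ∧ tl' b ≠ tl b) ∧
        (co b ≠ co (q v) → tl' b = tl b) := by
      intro b
      have := hne b
      refine ⟨fun hb => ?_, fun hb => by simp [tl', hb]⟩
      by_cases e : e0 b = tl b
      · simp only [tl', hb, e, if_true]
        exact ⟨.inr rfl, e ▸ this.symm⟩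
      · simp only [tl', hb, e, if_true, if_false]
        exact ⟨.inl rfl, e⟩
    by_cases ht : tl (p v) = v ↔ tl (q v) ≠ v
    · exact ⟨_, tl, h.merge (co' := fun b => if co b = co (q v) then co (p v) else co b)
        (hp v) (hq v) hv hc ht (fun b => ⟨fun e => by simp [e], fun e => by simp [e]⟩) hd⟩
    · refine ⟨_, tl', (h.flip (co (q v)) hp hq htl').merge
        (co' := fun b => if co b = co (q v) then co (p v) else co b)
        (hp v) (hq v) hv hc ?_ (fun b => ⟨fun e => by simp [e], fun e => by simp [e]⟩) hd⟩
      rw [(htl' (p v)).2 hc]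
      have h1 := (htl' (q v)).1 rfl
      have h2 := h.tail (q v)
      have h3 := hq v
      have h4 := hne (q v)
      unfold IncEnds at *
      grind

lemma exists_orientation [Finite V] [Finite β] (hne : ∀ b, e0 b ≠ e1 b)
    (hpq : ∀ v, p v ≠ q v) (hp : ∀ v, IncEnds e0 e1 (p v) v) (hq : ∀ v, IncEnds e0 e1 (q v) v) :
    ∃ tl : β → V, (∀ b, IncEnds e0 e1 b (tl b)) ∧ ∀ v, (tl (p v) = v ↔ tl (q v) ≠ v) := by
  classical
  cases nonempty_fintype V
  obtain ⟨f⟩ : Nonempty (β ↪ ℕ) := ⟨(Finite.equivFin β).toEmbedding.trans Fin.valEmbedding⟩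
  have key : ∀ s : Finset V, ∃ co tl, OrientInv e0 e1 p q (· ∈ s) co tl := by
    intro s
    induction s using Finset.induction_on with
    | empty => exact ⟨f, e0, .init hne (by simp) (fun b b' h => f.injective h) fun b => .inl rfl⟩
    | insert v s hv ih =>
      obtain ⟨co, tl, h⟩ := ih
      exact exists_step h hne hpq hp hq hv (fun w => by simp [or_comm])
  obtain ⟨co, tl, h⟩ := key univ
  exact ⟨tl, h.tail, fun v => (h.paired v (mem_univ v)).2⟩

end Orientation

/-! ## The value of an optimal solution -/

section Value

variable {A B : Type*} {E : A → B → Prop} {e0 e1 : B → A}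

lemma RightRegular.exists_ends (hB : RightRegular E 2) :
    ∃ e0 e1 : B → A, (∀ b, e0 b ≠ e1 b) ∧ ∀ a b, E a b ↔ IncEnds e0 e1 b a := by
  have : ∀ b, ∃ x y, x ≠ y ∧ ∀ a, E a b ↔ (x = a ∨ y = a) := by
    intro b
    obtain ⟨x, y, hne, h⟩ := Set.ncard_eq_two.1 (hB b)
    refine ⟨x, y, hne, fun a => ?_⟩
    have : a ∈ {a | E a b} ↔ a ∈ ({x, y} : Set A) := by rw [h]
    simpa [eq_comm] using this
  choose e0 e1 h1 h2 using this
  exact ⟨e0, e1, h1, fun a b => h2 b a⟩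

/-- Double counting of the incidences. -/
lemma three_mul_card [Fintype A] [Fintype B] (hA : LeftRegular E 3) (hB : RightRegular E 2) :
    3 * Fintype.card A = 2 * Fintype.card B := by
  classical
  have := card_mul_eq_card_mul (s := (univ : Finset A)) (t := (univ : Finset B)) (m := 3) (n := 2) E
    (fun a _ => by rw [← hA a, ← Set.ncard_coe_finset]; congr; ext; simp [bipartiteAbove])
    (fun b _ => by rw [← hB b, ← Set.ncard_coe_finset]; congr; ext; simp [bipartiteBelow])
  simp only [card_univ] at this
  omega

lemma LeftRegular.card_filter [Fintype B] (hA : LeftRegular E 3) (a : A) [DecidablePred (E a)] :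
    #{b | E a b} = 3 := by
  rw [← hA a, ← Set.ncard_coe_finset]; congr; ext; simp

/-! ### From matchings to feasible sets and back -/

/-- The edges that are not chosen by the vertices form a feasible set. -/
theorem feasible_of_orientation [Fintype A] [Fintype B] (hA : LeftRegular E 3)
    (hB : RightRegular E 2) (hE : ∀ a b, E a b ↔ IncEnds e0 e1 b a) (hne : ∀ b, e0 b ≠ e1 b)
    {M : Finset B} (hM : IsMatEnds e0 e1 M) {p q : A → B} (hpq : ∀ v, p v ≠ q v)
    (hp : ∀ v, IncEnds e0 e1 (p v) v) (hq : ∀ v, IncEnds e0 e1 (q v) v)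
    (hpM : ∀ v, p v ∉ M) (hqM : ∀ v, q v ∉ M)
    {tl : B → A} (htl : ∀ b, IncEnds e0 e1 b (tl b)) (hpair : ∀ v, (tl (p v) = v ↔ tl (q v) ≠ v))
    {S : Set B} (hS : ∀ b, b ∉ S ↔ ∃ v, (tl (p v) = v ∧ b = p v) ∨ (tl (p v) ≠ v ∧ b = q v)) :
    Feasible E S ∧ Fintype.card A + 2 * #M ≤ 2 * (nbhd E S).ncard := by
  classical
  let f : A → B := fun v => if tl (p v) = v then p v else q v
  have hf : ∀ v, tl (f v) = v := by
    intro v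
    have := hpair v
    by_cases h : tl (p v) = v
    · simp [f, h]
    · simp only [f, h, if_false]; tauto
  have hfinc : ∀ v, IncEnds e0 e1 (f v) v := by
    intro v
    simp only [f]
    split_ifs
    · exact hp v
    · exact hq v
  have hfM : ∀ v, f v ∉ M := by
    intro v
    simp only [f]
    split_ifs
    · exact hpM v
    · exact hqM v
  have hinj : Function.Injective f := fun v w h => by rw [← hf v, h, hf]
  have hSf : ∀ b, b ∈ S ↔ ∀ v, f v ≠ b := by
    intro b
    rw [← not_iff_not, hS]
    push Not
    refine exists_congr fun v => ?_
    simp only [f]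
    split_ifs with h
    · simp [h, eq_comm]
    · simp [h, eq_comm]
  refine ⟨⟨f, hinj, fun v => ⟨(hE v (f v)).2 (hfinc v), fun h => (hSf _).1 h v rfl⟩⟩, ?_⟩
  -- the third edge at a vertex is determined by `p` and `q`
  have hthird : ∀ v b c, IncEnds e0 e1 b v → IncEnds e0 e1 c v → b ≠ p v → b ≠ q v → c ≠ p v →
      c ≠ q v → b = c := by
    intro v b c hb hc b1 b2 c1 c2
    by_contra hbc
    have h4 : #({b, c, p v, q v} : Finset B) = 4 := by
      rw [card_insert_of_notMem, card_insert_of_notMem, card_pair (hpq v)]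
      · simp [c1, c2]
      · simp [hbc, b1, b2]
    have := card_le_card (s := ({b, c, p v, q v} : Finset B))
      (t := univ.filter fun b => E v b) (by
        intro x hx
        simp only [mem_insert, mem_singleton] at hx
        simp only [mem_filter, mem_univ, true_and, hE]
        rcases hx with rfl | rfl | rfl | rfl
        exacts [hb, hc, hp _, hq _])
    rw [h4, hA.card_filter] at this
    omega
  let T : Finset B := univ.filter fun b => b ∈ S ∧ b ∉ M
  -- Each edge of `T` is credited to its tail. Of the pair at a vertex, the edge with its tail there
  -- is chosen; so an edge that is not chosen is the third edge at its tail.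
  have hTpq : ∀ b ∈ T, b ≠ p (tl b) ∧ b ≠ q (tl b) := by
    intro b hb
    simp only [T, mem_filter, mem_univ, true_and, hSf] at hb
    have h1 := hb.1 (tl b)
    have h2 := hpair (tl b)
    simp only [f] at h1
    constructor
    · intro e
      rw [← e] at h1
      simp at h1
    · intro e
      rw [← e] at h1 h2
      have : tl (p (tl b)) ≠ tl b := by tauto
      simp [this] at h1
  have hMpq : ∀ c ∈ M, ∀ v, c ≠ p v ∧ c ≠ q v :=
    fun c hc v => ⟨fun e => hpM v (e ▸ hc), fun e => hqM v (e ▸ hc)⟩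
  have hTM : ∀ b ∈ T, ∀ c ∈ M, b ≠ c := by
    rintro b hb c hc rfl
    simp only [T, mem_filter] at hb
    exact hb.2.2 hc
  have hMS : ∀ c ∈ M, c ∈ S := fun c hc => (hSf c).2 fun v e => hfM v (e ▸ hc)
  let N : Finset A := (M.image e0 ∪ M.image e1) ∪ T.image tl
  have hN : (N : Set A) ⊆ nbhd E S := by
    intro x hx
    simp only [N, coe_union, coe_image, Set.mem_union, Set.mem_image, mem_coe] at hx
    rcases hx with (⟨b, hb, rfl⟩ | ⟨b, hb, rfl⟩) | ⟨b, hb, rfl⟩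
    · exact ⟨b, hMS b hb, (hE _ _).2 (.inl rfl)⟩
    · exact ⟨b, hMS b hb, (hE _ _).2 (.inr rfl)⟩
    · simp only [T, mem_filter] at hb
      exact ⟨b, hb.2.1, (hE _ _).2 (htl b)⟩
  have hcardN : #N = 2 * #M + #T := by
    have hd1 : Disjoint (M.image e0) (M.image e1) := by
      rw [disjoint_left]
      rintro x hx hx'
      obtain ⟨b, hb, rfl⟩ := mem_image.1 hx
      obtain ⟨b', hb', h⟩ := mem_image.1 hx'
      have := hM b hb b' hb' _ (.inl rfl) (.inr h)
      subst this
      exact hne b h.symm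
    have hd2 : Disjoint (M.image e0 ∪ M.image e1) (T.image tl) := by
      rw [disjoint_left]
      intro x hx hx'
      obtain ⟨b, hb, rfl⟩ := mem_image.1 hx'
      have : ∃ c ∈ M, IncEnds e0 e1 c (tl b) := by
        rcases mem_union.1 hx with h | h
        · obtain ⟨c, hc, h⟩ := mem_image.1 h; exact ⟨c, hc, .inl h⟩
        · obtain ⟨c, hc, h⟩ := mem_image.1 h; exact ⟨c, hc, .inr h⟩
      obtain ⟨c, hc, h⟩ := this
      exact hTM b hb c hc (hthird _ b c (htl b) h (hTpq b hb).1 (hTpq b hb).2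
        (hMpq c hc _).1 (hMpq c hc _).2)
    rw [card_union_of_disjoint hd2, card_union_of_disjoint hd1,
      card_image_of_injOn (fun b hb b' hb' e => hM b hb b' hb' _ (.inl e) (.inl rfl)),
      card_image_of_injOn (fun b hb b' hb' e => hM b hb b' hb' _ (.inr e) (.inr rfl)),
      card_image_of_injOn]
    · ring
    · intro b hb b' hb' e
      have e : tl b = tl b' := e
      have h2 := hTpq b' hb'
      rw [← e] at h2
      exact hthird (tl b) b b' (htl b) (e ▸ htl b') (hTpq b hb).1 (hTpq b hb).2 h2.1 h2.2
  -- The edges split into `T`, `M` and the `n` chosen ones. With $3n=2m$ this gives $|T|=n/2-|M|$,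
  -- so `N` has $n/2+|M|$ elements.
  have hcardT : #T + #M + Fintype.card A = Fintype.card B := by
    have h1 : (univ : Finset B) = (T ∪ M) ∪ univ.image f := by
      ext b
      simp only [mem_univ, mem_union, mem_image, true_and, T, mem_filter, true_iff, hSf]
      by_cases hb : b ∈ M
      · simp [hb]
      · by_cases h : ∃ v, f v = b
        · exact .inr h
        · push Not at h
          exact .inl (.inl ⟨h, hb⟩)
    have h2 : Disjoint T M := disjoint_left.2 fun b hb hb' => hTM b hb b hb' rfl
    have h3 : Disjoint (T ∪ M) (univ.image f) := by
      rw [disjoint_left]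
      intro b hb hb'
      obtain ⟨v, -, rfl⟩ := mem_image.1 hb'
      rcases mem_union.1 hb with h | h
      · simp only [T, mem_filter, hSf] at h
        exact h.2.1 v rfl
      · exact hfM v h
    have := congrArg card h1
    rw [card_union_of_disjoint h3, card_union_of_disjoint h2, card_image_of_injective _ hinj,
      card_univ, card_univ] at this
    omega
  have h3 := three_mul_card hA hB
  have h4 : #N ≤ (nbhd E S).ncard := by
    rw [← Set.ncard_coe_finset]
    exact Set.ncard_le_ncard hN (Set.toFinite _)
  omega

/-- Some pair of edges at `v` avoids a given matching. -/
lemma LeftRegular.exists_pair [Fintype B] (hA : LeftRegular E 3)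
    (hE : ∀ a b, E a b ↔ IncEnds e0 e1 b a) {M : Finset B} (hM : IsMatEnds e0 e1 M) (v : A) :
    ∃ b c, b ≠ c ∧ IncEnds e0 e1 b v ∧ IncEnds e0 e1 c v ∧ b ∉ M ∧ c ∉ M := by
  classical
  have h1 := hA.card_filter v
  have h2 : #((univ.filter fun b => E v b) ∩ M) ≤ 1 := by
    rw [card_le_one]
    intro b hb c hc
    simp only [mem_inter, mem_filter, mem_univ, true_and, hE] at hb hc
    exact hM b hb.2 c hc.2 v hb.1 hc.1
  have h3 : 1 < #((univ.filter fun b => E v b) \ M) := by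
    have := card_sdiff_add_card_inter (univ.filter fun b => E v b) M
    omega
  obtain ⟨b, hb, c, hc, hbc⟩ := one_lt_card.1 h3
  simp only [mem_sdiff, mem_filter, mem_univ, true_and, hE] at hb hc
  exact ⟨b, c, hbc, hb.1, hc.1, hb.2, hc.2⟩

/-- Every matching yields a feasible set. -/
theorem exists_feasible [Fintype A] [Fintype B] (hA : LeftRegular E 3) (hB : RightRegular E 2)
    (hE : ∀ a b, E a b ↔ IncEnds e0 e1 b a) (hne : ∀ b, e0 b ≠ e1 b)
    {M : Finset B} (hM : IsMatEnds e0 e1 M) :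
    ∃ S, Feasible E S ∧ Fintype.card A + 2 * #M ≤ 2 * (nbhd E S).ncard := by
  choose p q hpq hp hq hpM hqM using hA.exists_pair hE hM
  obtain ⟨tl, h1, h2⟩ := exists_orientation hne hpq hp hq
  exact ⟨{b | ∃ v, (tl (p v) = v ∧ b = p v) ∨ (tl (p v) ≠ v ∧ b = q v)}ᶜ,
    feasible_of_orientation hA hB hE hne hM hpq hp hq hpM hqM h1 h2
      (fun b => by rw [Set.mem_compl_iff, not_not]; rfl)⟩

/-- Every feasible set yields a matching. -/
theorem Feasible.exists_matching [Fintype A] [Fintype B] (hA : LeftRegular E 3)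
    (hB : RightRegular E 2) (hE : ∀ a b, E a b ↔ IncEnds e0 e1 b a)
    {S : Set B} (hS : Feasible E S) :
    ∃ M : Finset B, IsMatEnds e0 e1 M ∧ 2 * (nbhd E S).ncard ≤ Fintype.card A + 2 * #M := by
  classical
  obtain ⟨f, hinj, hf⟩ := hS
  let S' : Finset B := univ.filter (· ∈ S)
  have hcardS : #S' + Fintype.card A ≤ Fintype.card B := by
    have hd : Disjoint S' (univ.image f) := by
      rw [disjoint_left]
      intro b hb hb'
      obtain ⟨v, -, rfl⟩ := mem_image.1 hb'
      exact (hf v).2 (by simpa [S'] using hb)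
    have := card_le_univ (S' ∪ univ.image f)
    rwa [card_union_of_disjoint hd, card_image_of_injective _ hinj, card_univ] at this
  obtain ⟨M, hM, hmax⟩ := exists_max_image (S'.powerset.filter (IsMatEnds e0 e1)) card
    ⟨∅, mem_filter.2 ⟨by simp, by simp [IsMatEnds]⟩⟩
  simp only [mem_filter, mem_powerset] at hM hmax
  obtain ⟨hMS, hM⟩ := hM
  refine ⟨M, hM, ?_⟩
  have hedge : ∀ x ∈ nbhd E S, ∃ b ∈ S', IncEnds e0 e1 b x := by
    rintro x ⟨b, hb, h⟩
    exact ⟨b, by simpa [S'] using hb, (hE _ _).1 h⟩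
  let R : Finset A := univ.filter fun x => x ∈ nbhd E S ∧ ∀ c ∈ M, ¬ IncEnds e0 e1 c x
  -- Every vertex of `R`, which `M` misses, gets an edge of `S' \ M`. If two of them got the same
  -- edge, its two ends would both be uncovered and it could be added to `M`.
  have hR : #R ≤ #(S' \ M) := by
    have h1 : ∀ x ∈ R, ∃ b ∈ S' \ M, IncEnds e0 e1 b x := by
      intro x hx
      simp only [R, mem_filter, mem_univ, true_and] at hx
      obtain ⟨b, hb, h⟩ := hedge x hx.1
      exact ⟨b, mem_sdiff.2 ⟨hb, fun hbM => hx.2 b hbM h⟩, h⟩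
    rcases R.eq_empty_or_nonempty with h0 | ⟨x0, hx0⟩
    · simp [h0]
    have : Nonempty B := ⟨(h1 x0 hx0).choose⟩
    choose! g hg hgi using h1
    refine card_le_card_of_injOn g hg fun x hx y hy hxy => ?_
    by_contra hne
    have hx' : x ∈ R := hx
    have hy' : y ∈ R := hy
    have i1 := hgi x hx'
    have i2 := hgi y hy'
    rw [← hxy] at i2
    have hgS := mem_sdiff.1 (hg x hx')
    simp only [R, mem_filter, mem_univ, true_and] at hx' hy'
    have hends : ∀ c ∈ M, ∀ z, IncEnds e0 e1 c z → IncEnds e0 e1 (g x) z → False := by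
      intro c hc z h1 h2
      have : z = x ∨ z = y := by unfold IncEnds at h2 i1 i2; grind
      rcases this with rfl | rfl
      · exact hx'.2 c hc h1
      · exact hy'.2 c hc h1
    have := hmax (insert (g x) M) ⟨insert_subset hgS.1 hMS, by
      intro c hc c' hc' z h h'
      rcases mem_insert.1 hc with e | e <;> rcases mem_insert.1 hc' with e' | e'
      · rw [e, e']
      · exact (hends c' e' z h' (e ▸ h)).elim
      · exact (hends c e z h (e' ▸ h')).elim
      · exact hM c e c' e' z h h'⟩
    rw [card_insert_of_notMem hgS.2] at this
    omega
  have hcov : (nbhd E S).ncard ≤ #(R ∪ (M.image e0 ∪ M.image e1)) := by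
    rw [← Set.ncard_coe_finset]
    refine Set.ncard_le_ncard (fun x hx => ?_) (Set.toFinite _)
    simp only [coe_union, Set.mem_union, mem_coe, R, mem_filter, mem_univ, true_and, mem_image]
    by_cases h : ∀ c ∈ M, ¬ IncEnds e0 e1 c x
    · exact .inl ⟨hx, h⟩
    · push Not at h
      obtain ⟨c, hc, h | h⟩ := h
      · exact .inr (.inl ⟨c, hc, h⟩)
      · exact .inr (.inr ⟨c, hc, h⟩)
  -- Altogether $|N(S)|\le(|S|-|M|)+2|M|\le(m-n)+|M|$, and $2(m-n)=n$.
  have h1 := card_union_le R (M.image e0 ∪ M.image e1)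
  have h2 := card_union_le (M.image e0) (M.image e1)
  have h3 : #(M.image e0) ≤ #M := card_image_le
  have h4 : #(M.image e1) ≤ #M := card_image_le
  have h5 := card_sdiff_of_subset hMS
  have h6 := card_le_card hMS
  have h7 := three_mul_card hA hB
  omega

/-- A feasible set that is as good as a maximum matching allows is optimal. -/
theorem isOptimal_of_maxEnds [Fintype A] [Fintype B] (hA : LeftRegular E 3)
    (hB : RightRegular E 2) (hE : ∀ a b, E a b ↔ IncEnds e0 e1 b a) {M : Finset B}
    (hM : MaxEnds e0 e1 univ M) {S : Set B} (hS : Feasible E S)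
    (hcard : Fintype.card A + 2 * #M ≤ 2 * (nbhd E S).ncard) : IsOptimal E S := by
  refine ⟨hS, fun T hT => ?_⟩
  obtain ⟨N, hN, h⟩ := hT.exists_matching hA hB hE
  have := hM N (subset_univ _) hN
  omega

lemma isMatching_auxGraph_iff (hB : RightRegular E 2) (hE : ∀ a b, E a b ↔ IncEnds e0 e1 b a)
    (hne : ∀ b, e0 b ≠ e1 b) (M : Finset B) :
    IsMatching (auxGraph E hB) (M : Set B) ↔ IsMatEnds e0 e1 M := by
  have hinc : ∀ b x, (auxGraph E hB).Inc b x ↔ IncEnds e0 e1 b x := by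
    intro b x
    rw [← hE]
    constructor
    · rintro ⟨y, -, h, -⟩; exact h
    · intro h
      rcases (hE _ _).1 h with rfl | rfl
      · exact ⟨e1 b, hne b, h, (hE _ _).2 (.inr rfl)⟩
      · exact ⟨e0 b, (hne b).symm, h, (hE _ _).2 (.inl rfl)⟩
  constructor
  · rintro ⟨-, -, h⟩ b hb b' hb' x hx hx'
    by_contra hbb
    exact h b hb b' hb' hbb x ⟨(hinc _ _).2 hx, (hinc _ _).2 hx'⟩
  · intro h
    refine ⟨fun _ _ => Set.mem_univ _, fun b _ x hx => hx.1 rfl, fun b hb b' hb' hbb x hx => ?_⟩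
    exact hbb (h b hb b' hb' x ((hinc _ _).1 hx.1) ((hinc _ _).1 hx.2))

/-- Both bounds are applied to one maximum matching. They are kept in doubled form, and only the
last step divides by 2. -/
theorem exists_isGreatest_feasibleValues [Fintype A] [Fintype B] (hA : LeftRegular E 3)
    (hB : RightRegular E 2) :
    ∃ opt : ℕ, IsGreatest (feasibleValues E) opt ∧
      (opt : ℚ) = (Fintype.card A : ℚ) / 2 + (matchingNumber (auxGraph E hB) : ℚ) := by
  classical
  obtain ⟨e0, e1, hne, hE⟩ := hB.exists_ends
  obtain ⟨M, hM, hmax⟩ := exists_max_image ((univ : Finset B).powerset.filter (IsMatEnds e0 e1))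
    card ⟨∅, mem_filter.2 ⟨by simp, by simp [IsMatEnds]⟩⟩
  simp only [mem_filter, mem_powerset, subset_univ, true_and] at hM hmax
  have hν : matchingNumber (auxGraph E hB) = #M := by
    refine IsGreatest.csSup_eq ⟨⟨M, (isMatching_auxGraph_iff hB hE hne M).2 hM,
      Set.ncard_coe_finset M⟩, ?_⟩
    rintro k ⟨N, hN, rfl⟩
    rw [Set.ncard_eq_toFinset_card']
    exact hmax _ ((isMatching_auxGraph_iff hB hE hne _).1 (by simpa using hN))
  obtain ⟨S, hS, hcard⟩ := exists_feasible hA hB hE hne hM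
  have hopt : ∀ T, Feasible E T → 2 * (nbhd E T).ncard ≤ Fintype.card A + 2 * #M := by
    intro T hT
    obtain ⟨N, hN, h⟩ := hT.exists_matching hA hB hE
    have := hmax N hN
    omega
  refine ⟨(nbhd E S).ncard, ⟨⟨S, hS, rfl⟩, ?_⟩, ?_⟩
  · rintro k ⟨T, hT, rfl⟩
    have := hopt T hT
    omega
  · have := hopt S hS
    have : 2 * (nbhd E S).ncard = Fintype.card A + 2 * #M := by omega
    have : (2 * (nbhd E S).ncard : ℚ) = Fintype.card A + 2 * #M := by exact_mod_cast this
    rw [hν]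
    linarith

end Value

end TwoPPM

/-! ## A language of loop programs

Programs with registers and arrays all of whose loops run `reg 0` times. They compile to programs
of the random access machine that need polynomially many steps. -/

namespace LoopLang

/-- The contents of the registers and arrays. -/
structure Store where
  reg : ℕ → ℕ
  arr : ℕ → ℕ → ℕ

/-- Write a register. -/
def Store.setReg (s : Store) (r v : ℕ) : Store :=
  ⟨fun x => if x = r then v else s.reg x, s.arr⟩

/-- Write an entry of an array. -/
def Store.setArr (s : Store) (i j v : ℕ) : Store :=
  ⟨s.reg, fun x y => if x = i ∧ y = j then v else s.arr x y⟩

@[simp] lemma Store.setReg_reg (s : Store) (r v x : ℕ) :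
    (s.setReg r v).reg x = if x = r then v else s.reg x := (rfl)
@[simp] lemma Store.setReg_arr (s : Store) (r v : ℕ) : (s.setReg r v).arr = s.arr := (rfl)
@[simp] lemma Store.setArr_reg (s : Store) (i j v : ℕ) : (s.setArr i j v).reg = s.reg := (rfl)
@[simp] lemma Store.setArr_arr (s : Store) (i j v x y : ℕ) :
    (s.setArr i j v).arr x y = if x = i ∧ y = j then v else s.arr x y := (rfl)

/-- Expressions. -/
inductive Ex : Type
  | K : ℕ → Ex
  | R : ℕ → Ex
  | Ar : ℕ → Ex → Ex
  | plus : Ex → Ex → Ex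
  | minus : Ex → Ex → Ex

/-- The value of an expression. -/
def Ex.eval (s : Store) : Ex → ℕ
  | .K k => k
  | .R i => s.reg i
  | .Ar i e => s.arr i (e.eval s)
  | .plus e e' => e.eval s + e'.eval s
  | .minus e e' => e.eval s - e'.eval s

@[simp] lemma Ex.eval_K (s : Store) (k : ℕ) : (Ex.K k).eval s = k := (rfl)
@[simp] lemma Ex.eval_R (s : Store) (i : ℕ) : (Ex.R i).eval s = s.reg i := (rfl)
@[simp] lemma Ex.eval_Ar (s : Store) (i : ℕ) (e : Ex) :
    (Ex.Ar i e).eval s = s.arr i (e.eval s) := (rfl)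
@[simp] lemma Ex.eval_plus (s : Store) (e e' : Ex) :
    (Ex.plus e e').eval s = e.eval s + e'.eval s := (rfl)
@[simp] lemma Ex.eval_minus (s : Store) (e e' : Ex) :
    (Ex.minus e e').eval s = e.eval s - e'.eval s := (rfl)

/-- Commands. `loop r c` runs `c` with the values `reg 0 - 1, …, 1, 0` in register `r`; `getInp` and
`putInp` access the cells below `reg 1`, which form the array `16`. -/
inductive Cmd : Type
  | skip : Cmd
  | set : ℕ → Ex → Cmd
  | put : ℕ → Ex → Ex → Cmd
  | getInp : ℕ → Ex → Cmd
  | putInp : Ex → Ex → Cmd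
  | seq : Cmd → Cmd → Cmd
  | ite : Ex → Cmd → Cmd → Cmd
  | loop : ℕ → Cmd → Cmd

/-- Apply `F (k - 1)`, …, `F 0`. -/
def iter (F : ℕ → Store → Store) : ℕ → Store → Store
  | 0, s => s
  | k + 1, s => iter F k (F k s)

/-- The effect of a command. -/
def Cmd.run : Cmd → Store → Store
  | .skip, s => s
  | .set r e, s => s.setReg r (e.eval s)
  | .put i e e', s => s.setArr i (e.eval s) (e'.eval s)
  | .getInp r e, s => s.setReg r (if e.eval s < s.reg 1 then s.arr 16 (e.eval s) else 0)
  | .putInp e e', s => if e.eval s < s.reg 1 then s.setArr 16 (e.eval s) (e'.eval s) else s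
  | .seq c d, s => d.run (c.run s)
  | .ite e c d, s => if e.eval s = 0 then d.run s else c.run s
  | .loop r c, s => iter (fun k t => c.run (t.setReg r k)) (s.reg 0) (s.setReg r (s.reg 0))

@[simp] lemma run_skip (s : Store) : Cmd.skip.run s = s := (rfl)
@[simp] lemma run_set (r : ℕ) (e : Ex) (s : Store) :
    (Cmd.set r e).run s = s.setReg r (e.eval s) := (rfl)
@[simp] lemma run_put (i : ℕ) (e e' : Ex) (s : Store) :
    (Cmd.put i e e').run s = s.setArr i (e.eval s) (e'.eval s) := (rfl)
lemma run_getInp (r : ℕ) (e : Ex) (s : Store) : (Cmd.getInp r e).run s =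
    s.setReg r (if e.eval s < s.reg 1 then s.arr 16 (e.eval s) else 0) := (rfl)
lemma run_putInp (e e' : Ex) (s : Store) : (Cmd.putInp e e').run s =
    if e.eval s < s.reg 1 then s.setArr 16 (e.eval s) (e'.eval s) else s := (rfl)
@[simp] lemma run_seq (c d : Cmd) (s : Store) : (Cmd.seq c d).run s = d.run (c.run s) := (rfl)
lemma run_ite (e : Ex) (c d : Cmd) (s : Store) :
    (Cmd.ite e c d).run s = if e.eval s = 0 then d.run s else c.run s := (rfl)

@[simp] lemma run_ite_zero {e : Ex} {c d : Cmd} {s : Store} (h : e.eval s = 0) :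
    (Cmd.ite e c d).run s = d.run s := by rw [run_ite, if_pos h]
@[simp] lemma run_ite_ne {e : Ex} {c d : Cmd} {s : Store} (h : e.eval s ≠ 0) :
    (Cmd.ite e c d).run s = c.run s := by rw [run_ite, if_neg h]

/-- The registers that a command may write. -/
def Cmd.regs : Cmd → List ℕ
  | .skip => []
  | .set r _ => [r]
  | .put _ _ _ => []
  | .getInp r _ => [r]
  | .putInp _ _ => []
  | .seq c d => c.regs ++ d.regs
  | .ite _ c d => c.regs ++ d.regs
  | .loop r c => r :: c.regs

/-- The arrays that a command may write. -/
def Cmd.arrs : Cmd → List ℕ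
  | .skip => []
  | .set _ _ => []
  | .put i _ _ => [i]
  | .getInp _ _ => []
  | .putInp _ _ => [16]
  | .seq c d => c.arrs ++ d.arrs
  | .ite _ c d => c.arrs ++ d.arrs
  | .loop _ c => c.arrs

/-! ### Frames and loop invariants -/

/-- The stores agree outside the given registers and arrays. -/
structure Frame (R A : List ℕ) (s t : Store) : Prop where
  reg : ∀ r, r ∉ R → t.reg r = s.reg r
  arr : ∀ i, i ∉ A → t.arr i = s.arr i

lemma Frame.refl (R A : List ℕ) (s : Store) : Frame R A s s := ⟨fun _ _ => rfl, fun _ _ => rfl⟩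

lemma Frame.trans {R A : List ℕ} {s t u : Store} (h : Frame R A s t) (h' : Frame R A t u) :
    Frame R A s u :=
  ⟨fun r hr => (h'.reg r hr).trans (h.reg r hr), fun i hi => (h'.arr i hi).trans (h.arr i hi)⟩

lemma Frame.mono {R A R' A' : List ℕ} {s t : Store} (h : Frame R A s t) (hR : R ⊆ R')
    (hA : A ⊆ A') : Frame R' A' s t :=
  ⟨fun r hr => h.reg r fun h' => hr (hR h'), fun i hi => h.arr i fun h' => hi (hA h')⟩

lemma Frame.setReg (s : Store) {r v : ℕ} {R A : List ℕ} (hr : r ∈ R) :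
    Frame R A s (s.setReg r v) :=
  ⟨fun x hx => by simp [show x ≠ r from fun e => hx (e ▸ hr)], fun _ _ => rfl⟩

lemma Frame.setArr (s : Store) {i j v : ℕ} {R A : List ℕ} (hi : i ∈ A) :
    Frame R A s (s.setArr i j v) :=
  ⟨fun _ _ => rfl, fun x hx => by funext y; simp [show x ≠ i from fun e => hx (e ▸ hi)]⟩

/-- The index counts the passes still to come: `P k` holds when `F (k - 1)` is about to run. Later
invariants therefore speak of the indices `≥ k` as processed. -/
lemma iter_induction {F : ℕ → Store → Store} {P : ℕ → Store → Prop} :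
    ∀ (k : ℕ) (s : Store), P k s → (∀ j < k, ∀ t, P (j + 1) t → P j (F j t)) → P 0 (iter F k s)
  | 0, _, h, _ => h
  | k + 1, s, h, hs =>
    iter_induction k (F k s) (hs k k.lt_succ_self s h) fun j hj => hs j (by omega)

/-- What a command may write is computed syntactically, so that preservation of the other registers
and arrays reduces to `decide`. -/
lemma frame_run : ∀ (c : Cmd) (s : Store), Frame c.regs c.arrs s (c.run s)
  | .skip, s => .refl _ _ s
  | .set r e, s => .setReg s (by simp [Cmd.regs])
  | .put i e e', s => .setArr s (by simp [Cmd.arrs])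
  | .getInp r e, s => .setReg s (by simp [Cmd.regs])
  | .putInp e e', s => by
    rw [run_putInp]
    split_ifs
    · exact .setArr s (by simp [Cmd.arrs])
    · exact .refl _ _ s
  | .seq c d, s => by
    refine Frame.trans ((frame_run c s).mono ?_ ?_) ((frame_run d _).mono ?_ ?_) <;>
      simp [Cmd.regs, Cmd.arrs]
  | .ite e c d, s => by
    rw [run_ite]
    split_ifs
    · refine (frame_run d s).mono ?_ ?_ <;> simp [Cmd.regs, Cmd.arrs]
    · refine (frame_run c s).mono ?_ ?_ <;> simp [Cmd.regs, Cmd.arrs]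
  | .loop r c, s => by
    refine iter_induction (P := fun _ t => Frame (Cmd.loop r c).regs (Cmd.loop r c).arrs s t) _ _
      (.setReg s (by simp [Cmd.regs])) fun j _ t h => h.trans ?_
    refine Frame.trans (.setReg t (by simp [Cmd.regs])) ((frame_run c _).mono ?_ ?_) <;>
      simp [Cmd.regs, Cmd.arrs]

/-- The invariant rule for loops. -/
lemma loop_induction (P : ℕ → Store → Prop) {r : ℕ} {c : Cmd} {s : Store}
    (h0 : P (s.reg 0) (s.setReg r (s.reg 0)))
    (hs : ∀ k < s.reg 0, ∀ t, Frame (r :: c.regs) c.arrs s t → P (k + 1) t →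
      P k (c.run (t.setReg r k))) : P 0 ((Cmd.loop r c).run s) := by
  refine (iter_induction (P := fun k t => Frame (r :: c.regs) c.arrs s t ∧ P k t) _ _
    ⟨.setReg s (by simp), h0⟩ ?_).2
  rintro k hk t ⟨hf, hP⟩
  refine ⟨hf.trans ?_, hs k hk t hf hP⟩
  exact Frame.trans (.setReg t (by simp)) ((frame_run c _).mono (by simp) (by simp))

/-! ### Compilation -/

/-- Only the arrays `0, …, 15` are read. -/
def Ex.ok : Ex → Bool
  | .K _ => true
  | .R _ => true
  | .Ar i e => decide (i < 16) && e.ok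
  | .plus e e' => e.ok && e'.ok
  | .minus e e' => e.ok && e'.ok

/-- Loops do not write their own loop registers, and the registers `0` and `1` are read-only. -/
def Cmd.ok : Cmd → Bool
  | .skip => true
  | .set r e => decide (1 < r) && e.ok
  | .put i e e' => decide (i < 16) && e.ok && e'.ok
  | .getInp r e => decide (1 < r) && e.ok
  | .putInp e e' => e.ok && e'.ok
  | .seq c d => c.ok && d.ok
  | .ite e c d => e.ok && c.ok && d.ok
  | .loop r c => decide (1 < r) && decide (r ∉ c.regs) && c.ok

open RAM

/-- Two times the value of an expression. -/
def dbl (e : Expr) : Expr := .add e e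

/-- The address of an array entry: the arrays are interleaved. -/
def addr (i : ℕ) (e : Expr) : Expr := .add (.reg 1) (.add (dbl (dbl (dbl (dbl e)))) (.const i))

def Ex.toExpr : Ex → Expr
  | .K k => .const k
  | .R i => .reg i
  | .Ar i e => .load (addr i e.toExpr)
  | .plus e e' => .add e.toExpr e'.toExpr
  | .minus e e' => .sub e.toExpr e'.toExpr

/-- The guard `sub (reg 1) e` is nonzero exactly if the address lies below `reg 1`, so access to the
input cells never reaches the interleaved arrays above. The loop counter is decremented before the
body, which therefore sees the values from `reg 0 - 1` down to `0`. -/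
def Cmd.toProg : Cmd → Prog
  | .skip => .skip
  | .set r e => .assign r e.toExpr
  | .put i e e' => .store (addr i e.toExpr) e'.toExpr
  | .getInp r e => .ite (.sub (.reg 1) e.toExpr) (.assign r (.load e.toExpr)) (.assign r (.const 0))
  | .putInp e e' => .ite (.sub (.reg 1) e.toExpr) (.store e.toExpr e'.toExpr) .skip
  | .seq c d => .seq c.toProg d.toProg
  | .ite e c d => .ite e.toExpr c.toProg d.toProg
  | .loop r c => .seq (.assign r (.reg 0))
      (.while (.reg r) (.seq (.assign r (.sub (.reg r) (.const 1))) c.toProg))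

open Polynomial in
/-- A bound for the number of steps in terms of `reg 0`. -/
noncomputable def Cmd.time : Cmd → ℕ[X]
  | .skip => 1
  | .set _ e => C (e.toExpr.cost + 1)
  | .put i e e' => C ((addr i e.toExpr).cost + e'.toExpr.cost + 1)
  | .getInp _ e => C (2 * e.toExpr.cost + 10)
  | .putInp e e' => C (2 * e.toExpr.cost + e'.toExpr.cost + 10)
  | .seq c d => c.time + d.time
  | .ite e c d => C (e.toExpr.cost + 1) + c.time + d.time
  -- Each pass spends 2 steps on the test and 4 on the decrement; the initial assignment and the
  -- final test cost 2 each.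
  | .loop _ c => C 4 + X * (C 6 + c.time)

/-- A state of the machine that represents a store. -/
structure Rep (a : Store) (s : State) : Prop where
  reg : s.reg = a.reg
  inp : ∀ x < a.reg 1, s.mem x = a.arr 16 x
  arr : ∀ i < 16, ∀ j, s.mem (a.reg 1 + (16 * j + i)) = a.arr i j

lemma addr_eval (i : ℕ) (e : Expr) (s : State) :
    (addr i e).eval s = s.reg 1 + (16 * e.eval s + i) := by
  simp only [addr, dbl, Expr.eval]; ring

lemma Rep.eval {a : Store} {s : State} (h : Rep a s) :
    ∀ e : Ex, e.ok = true → e.toExpr.eval s = e.eval a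
  | .K _, _ => rfl
  | .R i, _ => by simp [Ex.toExpr, Expr.eval, h.reg]
  | .Ar i e, he => by
    simp only [Ex.ok, Bool.and_eq_true, decide_eq_true_eq] at he
    simp only [Ex.toExpr, Expr.eval, addr_eval, h.eval e he.2, h.reg]
    exact h.arr i he.1 _
  | .plus e e', he => by
    simp only [Ex.ok, Bool.and_eq_true] at he
    simp [Ex.toExpr, Expr.eval, h.eval e he.1, h.eval e' he.2]
  | .minus e e', he => by
    simp only [Ex.ok, Bool.and_eq_true] at he
    simp [Ex.toExpr, Expr.eval, h.eval e he.1, h.eval e' he.2]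

lemma Rep.setReg {a : Store} {s : State} (h : Rep a s) {r : ℕ} (hr : 1 < r) (v : ℕ) :
    Rep (a.setReg r v) ⟨Function.update s.reg r v, s.mem⟩ where
  reg := by funext x; simp [Function.update_apply, h.reg]
  inp x hx := by
    have : (a.setReg r v).reg 1 = a.reg 1 := by simp [show (1 : ℕ) ≠ r by omega]
    rw [this] at hx
    exact h.inp x hx
  arr i hi j := by
    have : (a.setReg r v).reg 1 = a.reg 1 := by simp [show (1 : ℕ) ≠ r by omega]
    rw [this]
    exact h.arr i hi j

lemma Rep.setArr {a : Store} {s : State} (h : Rep a s) {i : ℕ} (hi : i < 16) (j v : ℕ) :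
    Rep (a.setArr i j v) ⟨s.reg, Function.update s.mem (a.reg 1 + (16 * j + i)) v⟩ where
  reg := h.reg
  inp x hx := by
    have hx : x < a.reg 1 := hx
    have h1 : x ≠ a.reg 1 + (16 * j + i) := by omega
    have h2 : ¬ (16 = i ∧ x = j) := by omega
    simp [h1, h2, h.inp x hx]
  arr i' hi' j' := by
    simp only [Store.setArr_reg, Function.update_apply, Store.setArr_arr]
    by_cases hc : i' = i ∧ j' = j
    · simp [hc]
    -- As both array numbers are below 16, the address `16 * j + i` determines `i` and `j`.
    · rw [if_neg hc, if_neg (by omega), h.arr i' hi' j']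

lemma Rep.setInp {a : Store} {s : State} (h : Rep a s) {x : ℕ} (hx : x < a.reg 1) (v : ℕ) :
    Rep (a.setArr 16 x v) ⟨s.reg, Function.update s.mem x v⟩ where
  reg := h.reg
  inp y hy := by
    simp only [Function.update_apply, Store.setArr_arr, true_and]
    rw [h.inp y hy]
  arr i hi j := by
    have h1 : a.reg 1 + (16 * j + i) ≠ x := by omega
    have h2 : ¬ (i = 16 ∧ j = x) := by omega
    simp [h1, h2, h.arr i hi j]

/-- This keeps `reg 0`, the common length of all loops, and `reg 1`, the start of the arrays,
constant during a run. -/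
lemma Cmd.one_lt_of_mem_regs : ∀ (c : Cmd), c.ok = true → ∀ r ∈ c.regs, 1 < r
  | .skip, _, r, hr => by simp [Cmd.regs] at hr
  | .set _ _, h, r, hr => by
    simp only [Cmd.ok, Bool.and_eq_true, decide_eq_true_eq, Cmd.regs, List.mem_singleton] at h hr
    omega
  | .put _ _ _, _, r, hr => by simp [Cmd.regs] at hr
  | .getInp _ _, h, r, hr => by
    simp only [Cmd.ok, Bool.and_eq_true, decide_eq_true_eq, Cmd.regs, List.mem_singleton] at h hr
    omega
  | .putInp _ _, _, r, hr => by simp [Cmd.regs] at hr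
  | .seq c d, h, r, hr => by
    simp only [Cmd.ok, Bool.and_eq_true, Cmd.regs, List.mem_append] at h hr
    exact hr.elim (one_lt_of_mem_regs c h.1 r) (one_lt_of_mem_regs d h.2 r)
  | .ite _ c d, h, r, hr => by
    simp only [Cmd.ok, Bool.and_eq_true, Cmd.regs, List.mem_append] at h hr
    exact hr.elim (one_lt_of_mem_regs c h.1.2 r) (one_lt_of_mem_regs d h.2 r)
  | .loop _ c, h, r, hr => by
    simp only [Cmd.ok, Bool.and_eq_true, decide_eq_true_eq, Cmd.regs, List.mem_cons] at h hr
    rcases hr with rfl | hr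
    · exact h.1.1
    · exact one_lt_of_mem_regs c h.2 r hr

/-- Compiled programs compute what they should, in polynomially many steps. -/
theorem Cmd.toProg_runs : ∀ (c : Cmd), c.ok = true → ∀ (a : Store) (s : State), Rep a s →
    ∃ t s', Runs c.toProg s t s' ∧ Rep (c.run a) s' ∧ t ≤ c.time.eval (a.reg 0)
  | .skip, _, a, s, h => ⟨1, s, .skip s, h, by simp [Cmd.time]⟩
  | .set r e, hok, a, s, h => by
    simp only [Cmd.ok, Bool.and_eq_true, decide_eq_true_eq] at hok
    refine ⟨_, _, .assign r e.toExpr s, ?_, by simp [Cmd.time]⟩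
    rw [h.eval e hok.2]
    exact h.setReg hok.1 _
  | .put i e e', hok, a, s, h => by
    simp only [Cmd.ok, Bool.and_eq_true, decide_eq_true_eq] at hok
    refine ⟨_, _, .store (addr i e.toExpr) e'.toExpr s, ?_, by simp [Cmd.time]⟩
    rw [addr_eval, h.eval e hok.1.2, h.eval e' hok.2, h.reg]
    have := h.setArr hok.1.1 (e.eval a) (e'.eval a)
    rwa [h.reg] at this
  | .getInp r e, hok, a, s, h => by
    simp only [Cmd.ok, Bool.and_eq_true, decide_eq_true_eq] at hok
    have hev : (Expr.sub (.reg 1) e.toExpr).eval s = a.reg 1 - e.eval a := by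
      simp [Expr.eval, h.eval e hok.2, h.reg]
    rw [run_getInp]
    by_cases hlt : e.eval a < a.reg 1
    · refine ⟨_, _, .ite_true (by rw [hev]; omega) (.assign r (.load e.toExpr) s), ?_, ?_⟩
      · rw [if_pos hlt]
        have := h.setReg hok.1 (a.arr 16 (e.eval a))
        simpa [Expr.eval, h.eval e hok.2, h.inp _ hlt] using this
      · simp [Cmd.time, Expr.cost]; omega
    · refine ⟨_, _, .ite_false (by rw [hev]; omega) (.assign r (.const 0) s), ?_, ?_⟩
      · rw [if_neg hlt]
        exact h.setReg hok.1 0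
      · simp [Cmd.time, Expr.cost]; omega
  | .putInp e e', hok, a, s, h => by
    simp only [Cmd.ok, Bool.and_eq_true] at hok
    have hev : (Expr.sub (.reg 1) e.toExpr).eval s = a.reg 1 - e.eval a := by
      simp [Expr.eval, h.eval e hok.1, h.reg]
    rw [run_putInp]
    by_cases hlt : e.eval a < a.reg 1
    · refine ⟨_, _, .ite_true (by rw [hev]; omega) (.store e.toExpr e'.toExpr s), ?_, ?_⟩
      · rw [if_pos hlt, h.eval e hok.1, h.eval e' hok.2]
        exact h.setInp hlt _
      · simp [Cmd.time, Expr.cost]; omega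
    · refine ⟨_, _, .ite_false (by rw [hev]; omega) (.skip s), ?_, ?_⟩
      · rw [if_neg hlt]
        exact h
      · simp [Cmd.time, Expr.cost]; omega
  | .seq c d, hok, a, s, h => by
    simp only [Cmd.ok, Bool.and_eq_true] at hok
    obtain ⟨t, s', h1, h2, h3⟩ := toProg_runs c hok.1 a s h
    obtain ⟨t', s'', h1', h2', h3'⟩ := toProg_runs d hok.2 _ s' h2
    refine ⟨_, _, .seq h1 h1', h2', ?_⟩
    have : (c.run a).reg 0 = a.reg 0 := (frame_run c a).reg 0 fun h0 => by
      have := one_lt_of_mem_regs c hok.1 0 h0; omega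
    rw [this] at h3'
    simp only [Cmd.time, Polynomial.eval_add]
    omega
  | .ite e c d, hok, a, s, h => by
    simp only [Cmd.ok, Bool.and_eq_true] at hok
    rw [run_ite]
    by_cases he : e.eval a = 0
    swap
    · obtain ⟨t, s', h1, h2, h3⟩ := toProg_runs c hok.1.2 a s h
      refine ⟨_, _, .ite_true (by rwa [h.eval e hok.1.1]) h1, by rwa [if_neg he], ?_⟩
      simp only [Cmd.time, Polynomial.eval_add, Polynomial.eval_C]
      omega
    · obtain ⟨t, s', h1, h2, h3⟩ := toProg_runs d hok.2 a s h
      refine ⟨_, _, .ite_false (by rw [h.eval e hok.1.1]; exact he) h1,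
        by rwa [if_pos he], ?_⟩
      simp only [Cmd.time, Polynomial.eval_add, Polynomial.eval_C]
      omega
  | .loop r c, hok, a, s, h => by
    simp only [Cmd.ok, Bool.and_eq_true, decide_eq_true_eq] at hok
    obtain ⟨⟨hr, hrc⟩, hc⟩ := hok
    -- The induction is on the content of the loop register, which the body leaves alone by `hrc`;
    -- the time bound refers throughout to the unchanged value of `reg 0`.
    have key : ∀ (k : ℕ) (b : Store) (s : State), Rep b s → b.reg r = k → b.reg 0 = a.reg 0 →
        ∃ t s', Runs (.while (.reg r) (.seq (.assign r (.sub (.reg r) (.const 1))) c.toProg)) s t s' ∧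
          Rep (iter (fun k t => c.run (t.setReg r k)) k b) s' ∧
          t ≤ k * (6 + c.time.eval (a.reg 0)) + 2 := by
      intro k
      induction k with
      | zero =>
        intro b s hb hk _
        exact ⟨_, _, .while_false (by simp [Expr.eval, hb.reg, hk]), hb, by simp [Expr.cost]⟩
      | succ k ih =>
        intro b s hb hk h0
        have hset := hb.setReg hr k
        obtain ⟨t1, s1, h1, h2, h3⟩ := toProg_runs c hc _ _ hset
        have e0 : (b.setReg r k).reg 0 = a.reg 0 := by simp [show (0 : ℕ) ≠ r by omega, h0]
        rw [e0] at h3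
        obtain ⟨t2, s2, g1, g2, g3⟩ := ih _ s1 h2
          (by rw [(frame_run c _).reg r hrc]; simp)
          (by rw [(frame_run c _).reg 0 fun h0 => by
                have := one_lt_of_mem_regs c hc 0 h0; omega]
              exact e0)
        have ev : (Expr.sub (.reg r) (.const 1)).eval s = k := by simp [Expr.eval, hb.reg, hk]
        have hbody := Runs.seq (.assign r (.sub (.reg r) (.const 1)) s) (ev.symm ▸ h1)
        refine ⟨_, s2, .while_true (by simp [Expr.eval, hb.reg, hk]) hbody g1, g2, ?_⟩
        simp only [Expr.cost]
        rw [Nat.succ_mul]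
        omega
    obtain ⟨t, s', h1, h2, h3⟩ := key (a.reg 0) (a.setReg r (a.reg 0)) _ (h.setReg hr _) (by simp)
      (by simp)
    refine ⟨_, s', .seq (.assign r (.reg 0) s) (t' := t) ?_, h2, ?_⟩
    · have : (Expr.reg 0).eval s = a.reg 0 := by simp [Expr.eval, h.reg]
      rw [this]
      exact h1
    · simp only [Cmd.time, Polynomial.eval_add, Polynomial.eval_mul, Polynomial.eval_X,
        Polynomial.eval_C, Expr.cost]
      omega

lemma eval_mono (p : Polynomial ℕ) {x y : ℕ} (h : x ≤ y) : p.eval x ≤ p.eval y := by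
  rw [Polynomial.eval_eq_sum_range, Polynomial.eval_eq_sum_range]
  gcongr

end LoopLang

/-! ## Deciding whether a matching is maximum -/

namespace TwoPPM

open LoopLang LoopLang.Cmd LoopLang.Ex Finset

/-- Compare two numbers. -/
def ifEq (a b : Ex) (c d : Cmd) : Cmd := ite (plus (minus a b) (minus b a)) d c

@[simp] lemma run_ifEq_eq {a b : Ex} {c d : Cmd} {s : Store} (h : a.eval s = b.eval s) :
    (ifEq a b c d).run s = c.run s := by
  rw [ifEq, run_ite_zero]
  simp [h]

@[simp] lemma run_ifEq_ne {a b : Ex} {c d : Cmd} {s : Store} (h : a.eval s ≠ b.eval s) :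
    (ifEq a b c d).run s = d.run s := by
  rw [ifEq, run_ite_ne]
  simp only [Ex.eval_plus, Ex.eval_minus]
  omega

/-- The registers `0`, `2`, `3` hold a bound for the loops and the sizes of the graph, the arrays
`0` and `1` the ends of the edges. -/
structure Setup {n m : ℕ} (e0 e1 : Fin m → Fin n) (s : Store) : Prop where
  r0 : s.reg 0 = n + m + 1
  r2 : s.reg 2 = n
  r3 : s.reg 3 = m
  a0 : ∀ b : Fin m, s.arr 0 b = e0 b
  a1 : ∀ b : Fin m, s.arr 1 b = e1 b

lemma Setup.frame {n m : ℕ} {e0 e1 : Fin m → Fin n} {s t : Store} (h : Setup e0 e1 s)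
    {R A : List ℕ} (hf : Frame R A s t) (hR : ∀ r ∈ R, 3 < r) (hA : ∀ i ∈ A, 1 < i) :
    Setup e0 e1 t where
  r0 := (hf.reg 0 fun h => by have := hR 0 h; omega).trans h.r0
  r2 := (hf.reg 2 fun h => by have := hR 2 h; omega).trans h.r2
  r3 := (hf.reg 3 fun h => by have := hR 3 h; omega).trans h.r3
  a0 := by rw [hf.arr 0 fun h => by have := hA 0 h; omega]; exact h.a0
  a1 := by rw [hf.arr 1 fun h => by have := hA 1 h; omega]; exact h.a1

/-- The array `f` is the indicator function of the set `M`. -/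
def Codes {m : ℕ} (f : ℕ → ℕ) (M : Finset (Fin m)) : Prop :=
  ∀ b, f b ≠ 0 ↔ ∃ h : b < m, (⟨b, h⟩ : Fin m) ∈ M

lemma Codes.iff {m : ℕ} {f : ℕ → ℕ} {M : Finset (Fin m)} (h : Codes f M) (b : Fin m) :
    f b ≠ 0 ↔ b ∈ M := by
  rw [h b]
  exact ⟨fun ⟨_, h⟩ => h, fun h => ⟨b.2, h⟩⟩

/-- The array `f` holds the partners, increased by one, and `0` for exposed vertices. -/
def MateCode {n : ℕ} (f : ℕ → ℕ) (μ : Fin n → Fin n) : Prop :=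
  ∀ x : Fin n, f x = if μ x = x then 0 else (μ x : ℕ) + 1

/-- Compute the partners (array `4`) in the matching of the array `2`. -/
def mateCmd : Cmd :=
  seq (loop 4 (put 4 (R 4) (K 0)))
    (loop 4 (ite (Ar 2 (R 4))
      (seq (put 4 (Ar 0 (R 4)) (plus (Ar 1 (R 4)) (K 1)))
        (put 4 (Ar 1 (R 4)) (plus (Ar 0 (R 4)) (K 1)))) skip))

variable {n m : ℕ} {e0 e1 : Fin m → Fin n} {s : Store} {M act : Finset (Fin m)}
  {μ : Fin n → Fin n}

lemma mateCmd_spec (hs : Setup e0 e1 s) (hne : ∀ b, e0 b ≠ e1 b) (hM : Codes (s.arr 2) M)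
    (hμ : IsMateOf e0 e1 M μ) : MateCode ((mateCmd.run s).arr 4) μ := by
  classical
  set s1 := (loop 4 (put 4 (R 4) (K 0))).run s with hs1
  have hf1 : Frame [4] [4] s s1 := frame_run (loop 4 (put 4 (R 4) (K 0))) s
  have h1 : ∀ x, 0 ≤ x → x < n + m + 1 → s1.arr 4 x = 0 := by
    refine loop_induction (fun k t => ∀ x, k ≤ x → x < n + m + 1 → t.arr 4 x = 0) ?_ ?_
    · intro x hx hx'
      rw [hs.r0] at hx
      omega
    · intro k _ t _ ht x hx hx'
      have := ht x
      simp
      omega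
  have hs1' := hs.frame hf1 (by decide) (by decide)
  have hM1 : Codes (s1.arr 2) M := by rw [hf1.arr 2 (by simp)]; exact hM
  have h2 : ∀ x : Fin n, (mateCmd.run s).arr 4 x =
      if (∃ b ∈ M, 0 ≤ b.val ∧ IncEnds e0 e1 b x) then (μ x : ℕ) + 1 else 0 := by
    -- After the edges with numbers at least `k`, exactly the vertices covered by matching edges
    -- among them have received their partners.
    refine loop_induction (s := s1) (fun k t => ∀ x : Fin n, t.arr 4 x =
      if (∃ b ∈ M, k ≤ b.val ∧ IncEnds e0 e1 b x) then (μ x : ℕ) + 1 else 0) ?_ ?_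
    · intro x
      rw [if_neg, Store.setReg_arr, h1 x (by omega) (by omega)]
      rintro ⟨b, -, hb, -⟩
      rw [hs1'.r0] at hb
      omega
    · intro k _ t hft ht x
      have hst := hs1'.frame hft (by decide) (by decide)
      have hMt : Codes (t.arr 2) M := by rw [hft.arr 2 (by decide)]; exact hM1
      by_cases hk : t.arr 2 k = 0
      swap
      · obtain ⟨hkm, hkM⟩ := (hMt k).1 hk
        have ha0 : t.arr 0 k = e0 ⟨k, hkm⟩ := hst.a0 ⟨k, hkm⟩
        have ha1 : t.arr 1 k = e1 ⟨k, hkm⟩ := hst.a1 ⟨k, hkm⟩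
        rw [run_ite_ne (by simpa using hk)]
        simp only [run_seq, run_put, Ex.eval_Ar, Ex.eval_R, Ex.eval_plus, Ex.eval_K, if_true,
          Store.setReg_arr, Store.setReg_reg, Store.setArr_arr, Store.setArr_reg, ha0, ha1, true_and,
          OfNat.zero_ne_ofNat, OfNat.one_ne_ofNat, false_and, if_false, ht x]
        by_cases hx1 : x = e1 ⟨k, hkm⟩
        · rw [if_pos (by simp [hx1]), if_pos ⟨_, hkM, le_rfl, .inr hx1.symm⟩, hx1, hμ.snd _ hkM]
        · rw [if_neg (by simpa [Fin.ext_iff] using hx1)]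
          by_cases hx0 : x = e0 ⟨k, hkm⟩
          · rw [if_pos (by simp [hx0]), if_pos ⟨_, hkM, le_rfl, .inl hx0.symm⟩, hx0, hμ.fst _ hkM]
          · rw [if_neg (by simpa [Fin.ext_iff] using hx0)]
            congr 1
            refine propext (exists_congr fun b => and_congr_right fun hb => ?_)
            constructor
            · rintro ⟨h1, h2⟩; exact ⟨by omega, h2⟩
            · rintro ⟨h1, h2⟩
              refine ⟨?_, h2⟩
              rcases h1.lt_or_eq with h | rfl
              · exact h
              · rcases h2 with h | h
                · exact absurd h.symm hx0
                · exact absurd h.symm hx1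
      · rw [run_ite_zero (by simpa using hk), run_skip, Store.setReg_arr, ht x]
        congr 1
        refine propext (exists_congr fun b => and_congr_right fun hb => ?_)
        constructor
        · rintro ⟨h1, h2⟩; exact ⟨by omega, h2⟩
        · rintro ⟨h1, h2⟩
          refine ⟨?_, h2⟩
          rcases h1.lt_or_eq with h | rfl
          · exact h
          · exact absurd hk ((hMt.iff b).2 hb)
  intro x
  rw [h2 x]
  by_cases hx : ∃ b ∈ M, 0 ≤ b.val ∧ IncEnds e0 e1 b x
  · rw [if_pos hx, if_neg]
    obtain ⟨b, hb, -, rfl | rfl⟩ := hx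
    · rw [hμ.fst b hb]; exact (hne b).symm
    · rw [hμ.snd b hb]; exact hne b
  · rw [if_neg hx, if_pos]
    push Not at hx
    exact hμ.fix x fun b hb => hx b hb (Nat.zero_le _)

/-- Every exposed vertex becomes a blossom. -/
def initCmd : Cmd :=
  seq (set 5 (K 0)) (seq (set 6 (K 0)) (loop 4 (seq (put 5 (R 4) (K 0))
    (ite (minus (R 2) (R 4)) (ite (Ar 4 (R 4)) skip
      (seq (set 5 (plus (R 5) (K 1))) (seq (put 5 (R 4) (R 5)) (put 6 (R 5) (R 4))))) skip))))

/-- That different exposed vertices get different labels is contained in the last clause, since the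
base array recovers the vertex from its label. -/
lemma initCmd_spec (hs : Setup e0 e1 s) (hμ : MateCode (s.arr 4) μ) :
    (initCmd.run s).reg 6 = 0 ∧ ∀ x : Fin n, ((initCmd.run s).arr 5 x ≠ 0 ↔ μ x = x) ∧
      (initCmd.run s).arr 5 x ≤ (initCmd.run s).reg 5 ∧
      ((initCmd.run s).arr 5 x ≠ 0 → (initCmd.run s).arr 6 ((initCmd.run s).arr 5 x) = x) := by
  set s1 := (s.setReg 5 0).setReg 6 0 with hs1
  have hf1 : Frame [5, 6] [] s s1 := Frame.trans (.setReg s (by simp)) (.setReg _ (by simp))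
  have hs1' := hs.frame hf1 (by decide) (by decide)
  have hμ1 : MateCode (s1.arr 4) μ := hμ
  have := loop_induction (s := s1) (r := 4) (c := (seq (put 5 (R 4) (K 0))
    (ite (minus (R 2) (R 4)) (ite (Ar 4 (R 4)) skip
      (seq (set 5 (plus (R 5) (K 1))) (seq (put 5 (R 4) (R 5)) (put 6 (R 5) (R 4))))) skip)))
    (fun k t => t.reg 6 = 0 ∧ ∀ x : Fin n, k ≤ x.val → (t.arr 5 x ≠ 0 ↔ μ x = x) ∧
      t.arr 5 x ≤ t.reg 5 ∧ (t.arr 5 x ≠ 0 → t.arr 6 (t.arr 5 x) = x)) ?_ ?_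
  · exact ⟨this.1, fun x => this.2 x (Nat.zero_le _)⟩
  · refine ⟨by simp [hs1], fun x hx => ?_⟩
    rw [hs1'.r0] at hx
    omega
  · rintro k - t hft ⟨ht6, ht⟩
    have hst := hs1'.frame hft (by decide) (by decide)
    have hμt : MateCode (t.arr 4) μ := by rw [hft.arr 4 (by decide)]; exact hμ1
    rcases lt_or_ge k n with hk | hk
    · have hmk : t.arr 4 k = _ := hμt ⟨k, hk⟩
      by_cases hfix : μ ⟨k, hk⟩ = ⟨k, hk⟩
      · rw [if_pos hfix] at hmk
        simp [hst.r2, hmk, hk, ht6, Nat.sub_eq_zero_iff_le]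
        intro x hx
        rcases eq_or_ne x.val k with hxk | hxk
        · have : x = ⟨k, hk⟩ := Fin.ext hxk
          subst this
          simp [hfix]
        · obtain ⟨a, b, c⟩ := ht x (by omega)
          simp [hxk]
          refine ⟨by simpa using a, by omega, fun h => ?_⟩
          -- The new label is larger than all previous ones, so the entry written to the base array
          -- overwrites no base in use.
          rw [if_neg (by omega)]
          exact c h
      · rw [if_neg hfix] at hmk
        simp [hst.r2, hmk, hk, ht6, Nat.sub_eq_zero_iff_le]
        intro x hx
        rcases eq_or_ne x.val k with hxk | hxk
        · have : x = ⟨k, hk⟩ := Fin.ext hxk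
          subst this
          simp [hfix]
        · obtain ⟨a, b, c⟩ := ht x (by omega)
          simp [hxk]
          exact ⟨by simpa using a, by omega, c⟩
    · simp [hst.r2, hk, ht6]
      intro x hx
      omega

end TwoPPM

/-! ### A single growing or merging step of the search -/

namespace TwoPPM

open LoopLang LoopLang.Cmd LoopLang.Ex Finset

variable {n m : ℕ} {e0 e1 : Fin m → Fin n} {s t : Store} {M act : Finset (Fin m)}
  {μ : Fin n → Fin n} {G : SimpleGraph (Fin n)}

/-- The invariant of the search: the array `5` holds the blossoms, the array `6` their bases,
register `5` the number of blossoms so far, and register `6` is set only if the matching is not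
maximum. -/
structure SearchInv (G : SimpleGraph (Fin n)) (μ : Fin n → Fin n) (s : Store) : Prop where
  blossom : ∃ bs : ℕ → Fin n, BlossomInv μ (fun x : Fin n => s.arr 5 x) bs (s.reg 5) ∧
    ∀ x : Fin n, s.arr 5 x ≠ 0 → s.arr 6 (s.arr 5 x) = bs (s.arr 5 x)
  sound : ∀ O π, TightBarrier G μ O π → s.reg 6 = 0 ∧ BarrierInv O π (fun x : Fin n => s.arr 5 x)

/-- The vertices that belong to blossoms. -/
def reached (n : ℕ) (s : Store) : Finset (Fin n) := univ.filter fun x => s.arr 5 x ≠ 0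

/-- The directed edge from `u` to `v` admits neither growing nor merging. -/
def StepOk (μ : Fin n → Fin n) (s : Store) (u v : Fin n) : Prop :=
  s.arr 5 u ≠ 0 → (s.arr 5 v = 0 → s.arr 5 (μ v) ≠ 0) ∧ (s.arr 5 v ≠ 0 → s.arr 5 u ≤ s.arr 5 v)

lemma SearchInv.congr (h : SearchInv G μ s) (h5 : t.arr 5 = s.arr 5) (h6 : t.arr 6 = s.arr 6)
    (hr5 : t.reg 5 = s.reg 5) (hr6 : t.reg 6 = s.reg 6) : SearchInv G μ t where
  blossom := by rw [h5, h6, hr5]; exact h.blossom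
  sound := by rw [h5, hr6]; exact h.sound

lemma reached_congr (h5 : t.arr 5 = s.arr 5) : reached n t = reached n s := by
  unfold reached; rw [h5]

/-- Merge the blossom of register `14` into that of register `15`. -/
def relabelCmd : Cmd := loop 9 (ifEq (Ar 5 (R 9)) (R 14) (put 5 (R 9) (R 15)) skip)

lemma relabelCmd_spec (s : Store) : ∀ x, 0 ≤ x → x < s.reg 0 → (relabelCmd.run s).arr 5 x =
    if s.arr 5 x = s.reg 14 then s.reg 15 else s.arr 5 x := by
  have := loop_induction (s := s) (r := 9)
    (c := ifEq (Ar 5 (R 9)) (R 14) (put 5 (R 9) (R 15)) skip)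
    (fun k t => ∀ x, x < s.reg 0 → t.arr 5 x =
      if k ≤ x ∧ s.arr 5 x = s.reg 14 then s.reg 15 else s.arr 5 x) ?_ ?_
  · intro x _ hx
    simpa [relabelCmd] using this x hx
  · intro x hx
    rw [if_neg (by omega), Store.setReg_arr]
  · intro k hk t hft ht x hx
    have h14 : t.reg 14 = s.reg 14 := hft.reg 14 (by decide)
    have h15 : t.reg 15 = s.reg 15 := hft.reg 15 (by decide)
    have htk : t.arr 5 k = s.arr 5 k := by rw [ht k hk, if_neg (by omega)]
    by_cases h : s.arr 5 k = s.reg 14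
    · rw [run_ifEq_eq (by simpa [h14, htk] using h)]
      simp only [run_put, eval_R, Store.setArr_arr, Store.setReg_reg, Store.setReg_arr, true_and,
        if_true, Nat.reduceEqDiff, if_false, h15, ht x hx]
      rcases eq_or_ne x k with rfl | hxk
      · simp [h]
      · rw [if_neg hxk]
        congr 1
        refine propext (and_congr_left fun _ => ?_)
        omega
    · rw [run_ifEq_ne (by simpa [h14, htk] using h)]
      simp only [run_skip, Store.setReg_arr, ht x hx]
      congr 1
      refine propext ⟨fun h' => ⟨by omega, h'.2⟩, fun h' => ⟨?_, h'.2⟩⟩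
      rcases h'.1.lt_or_eq with h'' | rfl
      · exact h''
      · exact absurd h'.2 h

/-- Grow or merge along the edge from the vertex in register `10` to that in register `11`. -/
def growCmd : Cmd :=
  ite (Ar 5 (R 10))
    (ite (Ar 5 (R 11))
      (ite (minus (Ar 5 (R 10)) (Ar 5 (R 11)))
        (seq (set 14 (Ar 5 (R 10))) (seq (set 15 (Ar 5 (R 11))) (seq (set 12 (Ar 6 (R 14)))
          (ite (Ar 4 (R 12))
            (seq (set 13 (minus (Ar 4 (R 12)) (K 1))) (seq relabelCmd (put 5 (R 13) (R 15))))
            (set 6 (K 1))))))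
        skip)
      (ite (Ar 4 (R 11))
        (seq (set 13 (minus (Ar 4 (R 11)) (K 1)))
          (ite (Ar 5 (R 13)) skip
            (seq (set 5 (plus (R 5) (K 1))) (seq (put 5 (R 13) (R 5)) (put 6 (R 5) (R 13))))))
        skip))
    skip

/-- The possible outcomes of a step: nothing is to be done; an augmentation is found; progress. -/
def StepResult (μ : Fin n → Fin n) (u v : Fin n) (s t : Store) : Prop :=
  (t.arr 5 = s.arr 5 ∧ t.reg 6 = s.reg 6 ∧ StepOk μ s u v) ∨ (t.arr 5 = s.arr 5 ∧ t.reg 6 ≠ 0) ∨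
    (¬ StepOk μ s u v ∧ t.reg 6 = s.reg 6 ∧ #(reached n s) < #(reached n t))

/-- Something happens only if `u` is labelled. If `v` and its partner are not, the partner becomes a
new blossom. If `v` has a smaller label than `u`, the blossom of `u` is merged into that of `v`,
unless its base is exposed; then an augmentation is reported. -/
lemma growCmd_spec {u v : Fin n} (hn : n ≤ s.reg 0) (hG : IsMate G μ)
    (hμ : MateCode (s.arr 4) μ) (hu : s.reg 10 = u) (hv : s.reg 11 = v) (huv : G.Adj u v)
    (h : SearchInv G μ s) :
    SearchInv G μ (growCmd.run s) ∧ StepResult μ u v s (growCmd.run s) := by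
  obtain ⟨⟨bs, hb, hbs⟩, hsound⟩ := h
  by_cases hu0 : s.arr 5 u = 0
  · have hr : growCmd.run s = s := by simp [growCmd, hu, hu0]
    rw [hr]
    exact ⟨⟨⟨bs, hb, hbs⟩, hsound⟩, .inl ⟨rfl, rfl, fun h => absurd hu0 h⟩⟩
  by_cases hv0 : s.arr 5 v = 0
  · have hmv : μ v ≠ v := fun e => hb.exp v e hv0
    have h4 : s.arr 4 v = (μ v : ℕ) + 1 := by rw [hμ v, if_neg hmv]
    by_cases hw0 : s.arr 5 (μ v) = 0
    · have hr : growCmd.run s = (((s.setReg 13 (μ v)).setReg 5 (s.reg 5 + 1)).setArr 5 (μ v)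
          (s.reg 5 + 1)).setArr 6 (s.reg 5 + 1) (μ v) := by
        simp [growCmd, hu, hu0, hv, hv0, h4, hw0]
      have hcl : ∀ x : Fin n, (growCmd.run s).arr 5 x =
          if x = μ v then s.reg 5 + 1 else s.arr 5 x := by
        intro x; rw [hr]; simp [Fin.ext_iff]
      have h5 : (growCmd.run s).reg 5 = s.reg 5 + 1 := by rw [hr]; simp
      have h6 : (growCmd.run s).reg 6 = s.reg 6 := by rw [hr]; simp
      have ha6 : ∀ c, (growCmd.run s).arr 6 c =
          if c = s.reg 5 + 1 then (μ v : ℕ) else s.arr 6 c := by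
        intro c; rw [hr]; simp
      generalize growCmd.run s = t at *
      have hcl' : ∀ x : Fin n, (x = μ v → t.arr 5 x = s.reg 5 + 1) ∧
          (x ≠ μ v → t.arr 5 x = s.arr 5 x) := fun x => by rw [hcl]; simp +contextual
      refine ⟨⟨⟨fun c => if c = s.reg 5 + 1 then μ v else bs c, ?_, ?_⟩, ?_⟩, .inr (.inr ?_)⟩
      · rw [h5]
        exact hb.grow hG.invol hv0 hw0 hcl' fun c => ⟨fun e => by simp [e], fun e => by simp [e]⟩
      · intro x hx
        rw [ha6]
        split_ifs with hc
        · simp [hc]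
        · have : x ≠ μ v := fun e => hc (by rw [hcl, if_pos e])
          rw [hcl, if_neg this] at hx hc ⊢
          simpa [hc] using hbs x hx
      · intro O π hB
        exact ⟨h6.trans (hsound O π hB).1, (hsound O π hB).2.grow hb hB huv hu0 hv0 hw0 hcl'⟩
      · refine ⟨fun hok => (hok hu0).1 hv0 hw0, h6, card_lt_card ?_⟩
        refine (ssubset_iff_of_subset fun x hx => ?_).2 ⟨μ v, ?_, ?_⟩
        · simp only [reached, mem_filter, mem_univ, true_and, hcl] at hx ⊢
          split_ifs
          · omega
          · exact hx
        · simp [reached, hcl]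
        · simp [reached, hw0]
    · have hr : growCmd.run s = s.setReg 13 (μ v) := by
        simp [growCmd, hu, hu0, hv, hv0, h4, hw0]
      rw [hr]
      refine ⟨SearchInv.congr ⟨⟨bs, hb, hbs⟩, hsound⟩ rfl rfl (by simp) (by simp),
        .inl ⟨rfl, by simp, fun _ => ⟨fun _ => hw0, fun h => absurd hv0 h⟩⟩⟩
  · by_cases hlt : s.arr 5 v < s.arr 5 u
    · have hsub : s.arr 5 u - s.arr 5 v ≠ 0 := by omega
      have hw : s.arr 6 (s.arr 5 u) = bs (s.arr 5 u) := hbs u hu0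
      by_cases hfix : μ (bs (s.arr 5 u)) = bs (s.arr 5 u)
      · have h4 : s.arr 4 (bs (s.arr 5 u)) = 0 := by rw [hμ _, if_pos hfix]
        have hr : growCmd.run s = (((s.setReg 14 (s.arr 5 u)).setReg 15 (s.arr 5 v)).setReg 12
            (bs (s.arr 5 u))).setReg 6 1 := by
          simp [growCmd, hu, hu0, hv, hv0, hlt, Nat.sub_eq_zero_iff_le, hw, h4]
        rw [hr]
        refine ⟨⟨⟨bs, by simpa using hb, by simpa using hbs⟩, fun O π hB => ?_⟩,
          .inr (.inl ⟨rfl, by simp⟩)⟩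
        -- The report is correct: a tight barrier would make the exposed base the unmatched vertex
        -- of its component, which the base of the later blossom is not.
        have h1 := (hsound O π hB).2.base_ne hb hB huv hv0 hlt
        exact absurd (hB.root _ hfix).2 h1.2.2.2
      · have h4 : s.arr 4 (bs (s.arr 5 u)) = (μ (bs (s.arr 5 u)) : ℕ) + 1 := by
          rw [hμ _, if_neg hfix]
        set t := (((s.setReg 14 (s.arr 5 u)).setReg 15 (s.arr 5 v)).setReg 12
            (bs (s.arr 5 u))).setReg 13 (μ (bs (s.arr 5 u))) with ht
        have hf := frame_run relabelCmd t
        have hr : growCmd.run s = (relabelCmd.run t).setArr 5 (μ (bs (s.arr 5 u)))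
            (s.arr 5 v) := by
          have h13 : (relabelCmd.run t).reg 13 = (μ (bs (s.arr 5 u)) : ℕ) := by
            rw [hf.reg 13 (by decide), ht]; simp
          have h15 : (relabelCmd.run t).reg 15 = s.arr 5 v := by
            rw [hf.reg 15 (by decide), ht]; simp
          simp only [growCmd]
          rw [run_ite_ne (by simpa [hu] using hu0), run_ite_ne (by simpa [hv] using hv0),
            run_ite_ne (by simpa [hu, hv] using hsub)]
          simp only [run_seq, run_set, eval_R, eval_Ar, hu, hv, Store.setReg_reg,
            Store.setReg_arr, if_true, Nat.reduceEqDiff, if_false, hw]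
          rw [run_ite_ne (by simp [h4])]
          simp only [run_seq, run_set, eval_R, eval_Ar, eval_minus, eval_K, run_put,
            Store.setReg_reg, Store.setReg_arr, if_true, h4, Nat.add_sub_cancel]
          rw [← ht, h13, h15]
        have h5 : (growCmd.run s).reg 5 = s.reg 5 := by
          rw [hr, Store.setArr_reg, hf.reg 5 (by decide), ht]; simp
        have h6 : (growCmd.run s).reg 6 = s.reg 6 := by
          rw [hr, Store.setArr_reg, hf.reg 6 (by decide), ht]; simp
        have ha6 : (growCmd.run s).arr 6 = s.arr 6 := by
          have := hf.arr 6 (by decide)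
          funext c
          rw [hr, Store.setArr_arr, this, ht]
          simp
        have hcl : ∀ x : Fin n, (growCmd.run s).arr 5 x =
            if x = μ (bs (s.arr 5 u)) then s.arr 5 v else
              if s.arr 5 x = s.arr 5 u then s.arr 5 v else s.arr 5 x := by
          intro x
          have h0 : t.reg 0 = s.reg 0 := by rw [ht]; simp
          have := relabelCmd_spec t x (Nat.zero_le _) (by rw [h0]; omega)
          rw [hr, Store.setArr_arr, this, ht]
          simp [Fin.ext_iff]
        generalize growCmd.run s = t' at *
        have hcl' : ∀ x : Fin n,
            ((s.arr 5 x = s.arr 5 u ∨ x = μ (bs (s.arr 5 u))) → t'.arr 5 x = s.arr 5 v) ∧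
            (s.arr 5 x ≠ s.arr 5 u → x ≠ μ (bs (s.arr 5 u)) → t'.arr 5 x = s.arr 5 x) := by
          intro x
          rw [hcl]
          refine ⟨?_, fun h1 h2 => by simp [h1, h2]⟩
          rintro (h | h) <;> simp [h]
        have hy : s.arr 5 (μ (bs (s.arr 5 u))) = 0 := by
          have h1 := hb.cl_bs u hu0
          exact hb.base _ (by rw [h1]; exact hu0) (by rw [h1]) hfix
        refine ⟨⟨⟨bs, ?_, ?_⟩, ?_⟩, .inr (.inr ?_)⟩
        · rw [h5]
          exact hb.merge hG.invol hv0 hlt hfix hcl'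
        · intro x hx
          rw [ha6]
          by_cases hxm : s.arr 5 x = s.arr 5 u ∨ x = μ (bs (s.arr 5 u))
          · rw [(hcl' x).1 hxm]; exact hbs v hv0
          · push Not at hxm
            rw [(hcl' x).2 hxm.1 hxm.2] at hx ⊢
            exact hbs x hx
        · intro O π hB
          exact ⟨h6.trans (hsound O π hB).1, (hsound O π hB).2.merge hb hB huv hv0 hlt hfix hcl'⟩
        · refine ⟨fun hok => by have := (hok hu0).2 hv0; omega, h6, card_lt_card ?_⟩
          refine (ssubset_iff_of_subset fun x hx => ?_).2 ⟨μ (bs (s.arr 5 u)), ?_, ?_⟩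
          · simp only [reached, mem_filter, mem_univ, true_and, hcl] at hx ⊢
            split_ifs
            exacts [hv0, hv0, hx]
          · simp [reached, hcl, hv0]
          · simp [reached, hy]
    · have hr : growCmd.run s = s := by
        have : s.arr 5 u - s.arr 5 v = 0 := by omega
        simp [growCmd, hu, hu0, hv, hv0, this]
      rw [hr]
      exact ⟨⟨⟨bs, hb, hbs⟩, hsound⟩,
        .inl ⟨rfl, rfl, fun _ => ⟨fun h => absurd h hv0, fun _ => by omega⟩⟩⟩

end TwoPPM

/-! ### Rounds of the search and the test of maximality -/

namespace TwoPPM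

open LoopLang LoopLang.Cmd LoopLang.Ex Finset

variable {n m : ℕ} {e0 e1 : Fin m → Fin n} {s t t' : Store} {M act : Finset (Fin m)}
  {μ : Fin n → Fin n} {G : SimpleGraph (Fin n)}

/-- The outcome of steps along the pairs in `D`: a larger matching exists, nothing was to be done,
or progress. -/
def Outcome (G : SimpleGraph (Fin n)) (μ : Fin n → Fin n) (D : Fin n → Fin n → Prop)
    (s t : Store) : Prop :=
  t.reg 6 ≠ 0 ∨ (s.reg 6 = 0 ∧ t.arr 5 = s.arr 5 ∧ ∀ u v, D u v → StepOk μ s u v) ∨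
    (s.reg 6 = 0 ∧ #(reached n s) < #(reached n t) ∧ ∃ u v, G.Adj u v ∧ ¬ StepOk μ s u v)

/-- Until something happens, the labels are those of `s`. So the first edge with progress violates
`StepOk` in `s` as well; this witness later rules out progress after a round in which nothing was to
be done. -/
lemma Outcome.step {D D' : Fin n → Fin n → Prop} {u v : Fin n} (h : Outcome G μ D s t)
    (ht : StepResult μ u v t t') (huv : G.Adj u v)
    (hD : ∀ x y, D' x y → D x y ∨ (x = u ∧ y = v)) : Outcome G μ D' s t' := by
  rcases h with h | ⟨h0, h5, hok⟩ | ⟨h0, hlt, hex⟩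
  · rcases ht with h' | h' | h'
    · exact .inl (by rw [h'.2.1]; exact h)
    · exact .inl h'.2
    · exact .inl (by rw [h'.2.1]; exact h)
  · have hiff : ∀ x y, StepOk μ t x y ↔ StepOk μ s x y := fun x y => by simp [StepOk, h5]
    rcases ht with h' | h' | h'
    · refine .inr (.inl ⟨h0, h'.1.trans h5, fun x y hxy => ?_⟩)
      rcases hD x y hxy with h | ⟨rfl, rfl⟩
      · exact hok x y h
      · exact (hiff _ _).1 h'.2.2
    · exact .inl h'.2
    · refine .inr (.inr ⟨h0, ?_, u, v, huv, fun h => h'.1 ((hiff _ _).2 h)⟩)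
      rw [← reached_congr h5]
      exact h'.2.2
  · rcases ht with h' | h' | h'
    · exact .inr (.inr ⟨h0, by rw [reached_congr h'.1]; exact hlt, hex⟩)
    · exact .inl h'.2
    · exact .inr (.inr ⟨h0, hlt.trans h'.2.2, hex⟩)

/-- A step along the edge of register `8`, from its end in the array `i` to that in `j`. -/
def stepCmd (i j : ℕ) : Cmd := seq (set 10 (Ar i (R 8))) (seq (set 11 (Ar j (R 8))) growCmd)

lemma stepCmd_spec {u v : Fin n} {i j : ℕ} (hn : n ≤ s.reg 0) (hG : IsMate G μ)
    (hμ : MateCode (s.arr 4) μ) (hu : s.arr i (s.reg 8) = u) (hv : s.arr j (s.reg 8) = v)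
    (huv : G.Adj u v) (h : SearchInv G μ s) :
    SearchInv G μ ((stepCmd i j).run s) ∧ StepResult μ u v s ((stepCmd i j).run s) := by
  have hr : (stepCmd i j).run s = growCmd.run ((s.setReg 10 u).setReg 11 v) := by
    simp [stepCmd, hu, hv]
  rw [hr]
  obtain ⟨h1, h2⟩ := growCmd_spec (s := (s.setReg 10 u).setReg 11 v) (G := G) (u := u) (v := v)
    (by simpa using hn) hG hμ (by simp) (by simp) huv (h.congr rfl rfl (by simp) (by simp))
  refine ⟨h1, ?_⟩
  simpa [StepResult, StepOk, reached] using h2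

/-- Try both directions of the edge of register `8`. -/
def edgeCmd : Cmd := ite (Ar 3 (R 8)) (seq (stepCmd 0 1) (stepCmd 1 0)) skip

/-- The pairs of ends of the edges in `act` with numbers at least `k`. -/
def EndsFrom (e0 e1 : Fin m → Fin n) (act : Finset (Fin m)) (k : ℕ) (x y : Fin n) : Prop :=
  ∃ b ∈ act, k ≤ b.val ∧ ((e0 b = x ∧ e1 b = y) ∨ (e0 b = y ∧ e1 b = x))

lemma edgeCmd_spec {k : ℕ} (hs : Setup e0 e1 t) (hne : ∀ b, e0 b ≠ e1 b)
    (hact : Codes (t.arr 3) act) (hG : IsMate (endsGraph e0 e1 act) μ)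
    (hμ : MateCode (t.arr 4) μ) (hk : t.reg 8 = k) (h : SearchInv (endsGraph e0 e1 act) μ t)
    (ho : Outcome (endsGraph e0 e1 act) μ (EndsFrom e0 e1 act (k + 1)) s t) :
    SearchInv (endsGraph e0 e1 act) μ (edgeCmd.run t) ∧
      Outcome (endsGraph e0 e1 act) μ (EndsFrom e0 e1 act k) s (edgeCmd.run t) := by
  by_cases ha : t.arr 3 k = 0
  · have hr : edgeCmd.run t = t := by simp [edgeCmd, hk, ha]
    rw [hr]
    refine ⟨h, ?_⟩
    have hE : ∀ x y, EndsFrom e0 e1 act k x y → EndsFrom e0 e1 act (k + 1) x y := by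
      rintro x y ⟨b, hb, hkb, hxy⟩
      refine ⟨b, hb, ?_, hxy⟩
      rcases hkb.lt_or_eq with h' | rfl
      · exact h'
      · exact absurd ha ((hact.iff b).2 hb)
    rcases ho with ho | ho | ho
    · exact .inl ho
    · exact .inr (.inl ⟨ho.1, ho.2.1, fun u v huv => ho.2.2 u v (hE u v huv)⟩)
    · exact .inr (.inr ho)
  · obtain ⟨hkm, hb⟩ := (hact k).1 ha
    have h0 : t.arr 0 k = e0 ⟨k, hkm⟩ := hs.a0 ⟨k, hkm⟩
    have h1 : t.arr 1 k = e1 ⟨k, hkm⟩ := hs.a1 ⟨k, hkm⟩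
    have hadj : (endsGraph e0 e1 act).Adj (e0 ⟨k, hkm⟩) (e1 ⟨k, hkm⟩) :=
      ⟨hne _, _, hb, .inl ⟨rfl, rfl⟩⟩
    have hr : edgeCmd.run t = (stepCmd 1 0).run ((stepCmd 0 1).run t) := by
      rw [edgeCmd, run_ite_ne (by simpa [hk] using ha), run_seq]
    have hf := frame_run (stepCmd 0 1) t
    have hs' := hs.frame hf (by decide) (by decide)
    have hn : n ≤ t.reg 0 := by rw [hs.r0]; omega
    have hn' : n ≤ ((stepCmd 0 1).run t).reg 0 := by rw [hs'.r0]; omega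
    obtain ⟨a1, a2⟩ := stepCmd_spec (i := 0) (j := 1) hn hG hμ (by rw [hk, h0]) (by rw [hk, h1])
      hadj h
    have hk' : ((stepCmd 0 1).run t).reg 8 = k := by rw [hf.reg 8 (by decide), hk]
    obtain ⟨b1, b2⟩ := stepCmd_spec (i := 1) (j := 0) hn' hG
      (by rw [hf.arr 4 (by decide)]; exact hμ) (u := e1 ⟨k, hkm⟩) (v := e0 ⟨k, hkm⟩)
      (by rw [hk']; exact hs'.a1 ⟨k, hkm⟩) (by rw [hk']; exact hs'.a0 ⟨k, hkm⟩) hadj.symm a1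
    rw [hr]
    refine ⟨b1, Outcome.step (D := fun x y => EndsFrom e0 e1 act (k + 1) x y ∨
      (x = e0 ⟨k, hkm⟩ ∧ y = e1 ⟨k, hkm⟩)) (ho.step a2 hadj fun x y h => h) b2 hadj.symm ?_⟩
    rintro x y ⟨b, hb, hkb, hxy⟩
    rcases hkb.lt_or_eq with h' | rfl
    · exact .inl (.inl ⟨b, hb, h', hxy⟩)
    · rcases hxy with ⟨rfl, rfl⟩ | ⟨rfl, rfl⟩
      · exact .inl (.inr ⟨rfl, rfl⟩)
      · exact .inr ⟨rfl, rfl⟩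

/-- Try all edges. -/
def roundCmd : Cmd := loop 8 edgeCmd

lemma roundCmd_spec (hs : Setup e0 e1 s) (hne : ∀ b, e0 b ≠ e1 b)
    (hact : Codes (s.arr 3) act) (hG : IsMate (endsGraph e0 e1 act) μ)
    (hμ : MateCode (s.arr 4) μ) (h : SearchInv (endsGraph e0 e1 act) μ s) :
    SearchInv (endsGraph e0 e1 act) μ (roundCmd.run s) ∧
      Outcome (endsGraph e0 e1 act) μ (endsGraph e0 e1 act).Adj s (roundCmd.run s) := by
  have := loop_induction (s := s) (r := 8) (c := edgeCmd)
    (fun k t => SearchInv (endsGraph e0 e1 act) μ t ∧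
      Outcome (endsGraph e0 e1 act) μ (EndsFrom e0 e1 act k) s t) ?_ ?_
  · refine ⟨this.1, this.2.imp_right (.imp_left fun h' => ⟨h'.1, h'.2.1, fun u v huv => h'.2.2 u v ?_⟩)⟩
    obtain ⟨-, b, hb, hbx⟩ := huv
    exact ⟨b, hb, Nat.zero_le _, hbx⟩
  · refine ⟨h.congr rfl rfl (by simp) (by simp), ?_⟩
    by_cases h6 : s.reg 6 = 0
    swap
    · exact .inl (by simpa using h6)
    refine .inr (.inl ⟨h6, rfl, ?_⟩)
    rintro u v ⟨b, -, hb, -⟩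
    rw [hs.r0] at hb
    omega
  · rintro k - t hft ⟨h1, h2⟩
    have hf : Frame (8 :: edgeCmd.regs) edgeCmd.arrs s (t.setReg 8 k) :=
      hft.trans (.setReg _ (by simp))
    refine edgeCmd_spec (hs.frame hf (by decide) (by decide)) hne
      (by rw [hf.arr 3 (by decide)]; exact hact) hG (by rw [hf.arr 4 (by decide)]; exact hμ)
      (by simp) (h1.congr rfl rfl (by simp) (by simp)) ?_
    simpa [Outcome, reached] using h2

/-- Decide whether the matching of the array `2` is maximum among the edges of the array `3`. -/
def decideCmd : Cmd := seq mateCmd (seq initCmd (loop 7 roundCmd))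

/-- If the flag stays `0`, some round makes no progress, as at most `n` vertices can be labelled;
the search is then stuck and certifies maximality. If the matching is maximum, a tight barrier
exists and the invariant keeps the flag at `0`. -/
theorem decideCmd_spec [NeZero n] (hs : Setup e0 e1 s) (hne : ∀ b, e0 b ≠ e1 b)
    (hMc : Codes (s.arr 2) M) (hact : Codes (s.arr 3) act) (hM : IsMatEnds e0 e1 M)
    (hsub : M ⊆ act) : (decideCmd.run s).reg 6 = 0 ↔ MaxEnds e0 e1 act M := by
  obtain ⟨μ, hμ⟩ := hM.exists_mate
  have hG := hμ.isMate hne hsub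
  set s1 := mateCmd.run s with hs1
  have hf1 : Frame mateCmd.regs mateCmd.arrs s s1 := frame_run _ _
  set s2 := initCmd.run s1 with hs2
  have hf2 : Frame initCmd.regs initCmd.arrs s1 s2 := frame_run _ _
  have hr : decideCmd.run s = (loop 7 roundCmd).run s2 := rfl
  have hμ1 : MateCode (s1.arr 4) μ := mateCmd_spec hs hne hMc hμ
  have hst1 := hs.frame hf1 (by decide) (by decide)
  have hst2 := hst1.frame hf2 (by decide) (by decide)
  have hμ2 : MateCode (s2.arr 4) μ := by rw [hf2.arr 4 (by decide)]; exact hμ1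
  have hact2 : Codes (s2.arr 3) act := by
    rw [hf2.arr 3 (by decide), hf1.arr 3 (by decide)]; exact hact
  obtain ⟨hflag, hinit⟩ := initCmd_spec hst1 hμ1
  rw [← hs2] at hflag hinit
  -- `Fin.ofNat` turns the base array into a total function; its values at unused labels are
  -- irrelevant. It needs a nonempty vertex set.
  have hbs : ∀ x : Fin n, s2.arr 5 x ≠ 0 → Fin.ofNat n (s2.arr 6 (s2.arr 5 x)) = x := by
    intro x hx
    rw [(hinit x).2.2 hx]
    ext
    simp
  have hI : SearchInv (endsGraph e0 e1 act) μ s2 := by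
    refine ⟨⟨fun c => Fin.ofNat n (s2.arr 6 c), ?_, fun x hx => ?_⟩, fun O π hB => ⟨hflag, ?_⟩⟩
    · exact BlossomInv.init (fun x => (hinit x).1) (fun x => (hinit x).2.1) hbs
    · dsimp only
      rw [hbs x hx, (hinit x).2.2 hx]
    · exact BarrierInv.init (bs := fun c => Fin.ofNat n (s2.arr 6 c)) hB (fun x => (hinit x).1) hbs
  -- With `k` rounds to go, either the flag is set, or the search is stuck, or each of the `n + m +
  -- 1 - k` rounds so far has labelled a further vertex. The last is impossible for `k = 0`.
  have hloop := loop_induction (s := s2) (r := 7) (c := roundCmd)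
    (fun k t => SearchInv (endsGraph e0 e1 act) μ t ∧ (t.reg 6 ≠ 0 ∨
      (∀ u v, (endsGraph e0 e1 act).Adj u v → StepOk μ t u v) ∨
      n + m + 1 - k ≤ #(reached n t))) ?_ ?_
  · rw [← hr] at hloop
    obtain ⟨h1, h2⟩ := hloop
    constructor
    · intro h6
      have hok : ∀ u v, (endsGraph e0 e1 act).Adj u v → StepOk μ (decideCmd.run s) u v := by
        rcases h2 with h2 | h2 | h2
        · exact absurd h6 h2
        · exact h2
        · have := card_le_univ (reached n (decideCmd.run s))
          rw [Fintype.card_fin] at this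
          omega
      obtain ⟨⟨bs, hb, -⟩, -⟩ := h1
      refine hb.maxEnds hne hsub hM hμ fun u v huv hu => ?_
      by_cases hv : (decideCmd.run s).arr 5 v = 0
      · exact .inr ⟨hv, (hok u v huv hu).1 hv⟩
      -- For two labelled ends, `StepOk` in the two directions gives the two inequalities between
      -- the labels.
      · exact .inl (le_antisymm ((hok v u huv.symm hv).2 hu) ((hok u v huv hu).2 hv))
    · intro hmax
      obtain ⟨O, π, hB⟩ := hmax.exists_tightBarrier hne hsub hM hμ
      exact (h1.sound O π hB).1
  · refine ⟨hI.congr rfl rfl (by simp) (by simp), .inr (.inr ?_)⟩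
    rw [hst2.r0]
    omega
  · rintro k - t hft ⟨h1, h2⟩
    have hf : Frame (7 :: roundCmd.regs) roundCmd.arrs s2 (t.setReg 7 k) :=
      hft.trans (.setReg _ (by simp))
    obtain ⟨a1, a2⟩ := roundCmd_spec (hst2.frame hf (by decide) (by decide)) hne
      (by rw [hf.arr 3 (by decide)]; exact hact2) hG (by rw [hf.arr 4 (by decide)]; exact hμ2)
      (h1.congr rfl rfl (by simp) (by simp))
    refine ⟨a1, a2.imp_right ?_⟩
    rintro (⟨-, h5, hok⟩ | ⟨h6, hlt, u, v, huv, hnot⟩)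
    · exact .inl fun u v huv => by simpa [StepOk, h5] using hok u v huv
    · right
      have : StepOk μ (t.setReg 7 k) u v ↔ StepOk μ t u v := by simp [StepOk]
      have hre : reached n (t.setReg 7 k) = reached n t := rfl
      rw [hre] at hlt
      rcases h2 with h2 | h2 | h2
      · exact absurd (by simpa using h6) h2
      · exact absurd (h2 u v huv) (by rwa [this] at hnot)
      · omega

end TwoPPM

/-! ## Computing a maximum matching -/

namespace TwoPPM

open LoopLang LoopLang.Cmd LoopLang.Ex Finset

/-- Run `c` with the values below that of register `q`, in decreasing order, in register `r`. -/
def loopLt (q r : ℕ) (c : Cmd) : Cmd := loop r (ite (minus (R q) (R r)) c skip)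

/-- The loop still runs `reg 0` times but idles while its index is at least `N`; so the invariant is
carried at `min k N`. It must not depend on the loop register, which also changes in idle passes. -/
lemma loopLt_induction (P : ℕ → Store → Prop) {q r N : ℕ} {c : Cmd} {s : Store}
    (hq : s.reg q = N) (hN : N ≤ s.reg 0) (hqr : q ∉ r :: c.regs)
    (hset : ∀ k t v, P k t → P k (t.setReg r v)) (h0 : P N s)
    (hs : ∀ k < N, ∀ t, Frame (r :: c.regs) c.arrs s t → t.reg r = k → P (k + 1) t →
      P k (c.run t)) : P 0 ((loopLt q r c).run s) := by
  have hqr' : q ≠ r := fun h => hqr (by simp [h])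
  have := loop_induction (s := s) (r := r) (c := ite (minus (R q) (R r)) c skip)
    (fun k t => P (min k N) t) (by rw [min_eq_right hN]; exact hset _ _ _ h0) ?_
  · rwa [Nat.zero_min] at this
  · intro k hk t hft ht
    have hft' : Frame (r :: c.regs) c.arrs s (t.setReg r k) :=
      (hft.mono (by simp [Cmd.regs]) (by simp [Cmd.arrs])).trans (.setReg t (by simp))
    have hqt : (t.setReg r k).reg q = N := by rw [hft'.reg q hqr, hq]
    have hrt : (t.setReg r k).reg r = k := by simp
    rcases lt_or_ge k N with h | h
    · rw [run_ite_ne (by simp only [eval_minus, eval_R, hqt, hrt]; omega)]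
      rw [min_eq_left h] at ht
      rw [min_eq_left h.le]
      exact hs k h _ hft' hrt (hset _ _ _ ht)
    · rw [run_ite_zero (by simp only [eval_minus, eval_R, hqt, hrt]; omega), run_skip]
      rw [min_eq_right (by omega)] at ht ⊢
      exact hset _ _ _ ht

variable {n m : ℕ} {e0 e1 : Fin m → Fin n} {s t t' : Store} {M act : Finset (Fin m)}

lemma Codes.erase {f g : ℕ → ℕ} (h : Codes f M) (b : Fin m)
    (hg : ∀ x, g x = if x = b then 0 else f x) : Codes g (M.erase b) := by
  intro x
  rw [hg]
  split_ifs with hx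
  · subst hx; simp
  · rw [h x]
    refine exists_congr fun hx' => ?_
    simp [mem_erase, Fin.ext_iff, hx]

lemma Codes.insert {f g : ℕ → ℕ} (h : Codes f M) (b : Fin m)
    (hg : ∀ x, g x = if x = b then 1 else f x) : Codes g (insert b M) := by
  intro x
  rw [hg]
  split_ifs with hx
  · subst hx; simp
  · rw [h x]
    refine exists_congr fun hx' => ?_
    simp [mem_insert, Fin.ext_iff, hx]

/-- Activate all edges. -/
def activateCmd : Cmd := loopLt 3 16 (put 3 (R 16) (K 1))

/-- The previous contents matter only for the cells from `m` on, which `Codes` requires to be `0`.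
-/
lemma activateCmd_spec (hs : Setup e0 e1 s) (hact : Codes (s.arr 3) act) :
    Codes ((activateCmd.run s).arr 3) (univ : Finset (Fin m)) := by
  have := loopLt_induction (s := s) (q := 3) (r := 16) (c := put 3 (R 16) (K 1))
    (fun k t => (∀ b, m ≤ b → t.arr 3 b = 0) ∧ ∀ b, k ≤ b → b < m → t.arr 3 b = 1) hs.r3
    (by rw [hs.r0]; omega) (by decide) (fun _ _ _ h => h) ⟨fun b hb => ?_, fun b hb hb' => ?_⟩ ?_
  · intro b
    constructor
    · intro h
      by_cases hb : b < m
      · exact ⟨hb, mem_univ _⟩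
      · exact absurd (this.1 b (by omega)) h
    · rintro ⟨hb, -⟩
      rw [activateCmd, this.2 b (Nat.zero_le _) hb]
      exact one_ne_zero
  · by_contra h
    obtain ⟨h, -⟩ := (hact b).1 h
    omega
  · omega
  · rintro k hk t - htk ⟨h1, h2⟩
    refine ⟨fun b hb => ?_, fun b hb hb' => ?_⟩
    · have := h1 b hb
      have hbk : b ≠ k := by omega
      simp [htk, hbk, this]
    · have := h2 b
      simp [htk]
      omega

/-! ### Critical edge sets and augmentation -/

/-- Deactivate edges outside the matching as long as it does not become maximum. -/
def shrinkCmd : Cmd := loopLt 3 16 (ite (Ar 2 (R 16)) skip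
  (seq (put 3 (R 16) (K 0)) (seq decideCmd (ite (R 6) skip (put 3 (R 16) (K 1))))))

lemma shrinkCmd_spec [NeZero n] (hs : Setup e0 e1 s) (hne : ∀ b, e0 b ≠ e1 b)
    (hMc : Codes (s.arr 2) M) (hact : Codes (s.arr 3) act) (hM : IsMatEnds e0 e1 M)
    (hsub : M ⊆ act) (hnot : ¬ MaxEnds e0 e1 act M) :
    ∃ act', Codes ((shrinkCmd.run s).arr 3) act' ∧ M ⊆ act' ∧ ¬ MaxEnds e0 e1 act' M ∧
      ∀ b ∈ act', b ∉ M → MaxEnds e0 e1 (act'.erase b) M := by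
  have := loopLt_induction (s := s) (q := 3) (r := 16) (c := ite (Ar 2 (R 16)) skip
      (seq (put 3 (R 16) (K 0)) (seq decideCmd (ite (R 6) skip (put 3 (R 16) (K 1))))))
    (fun k t => ∃ act', Codes (t.arr 3) act' ∧ M ⊆ act' ∧ ¬ MaxEnds e0 e1 act' M ∧
      ∀ b ∈ act', k ≤ b.val → b ∉ M → MaxEnds e0 e1 (act'.erase b) M) hs.r3
    (by rw [hs.r0]; omega) (by decide) (fun _ _ _ h => h)
    ⟨act, hact, hsub, hnot, fun b _ hb => by have := b.2; omega⟩ ?_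
  · obtain ⟨act', h1, h2, h3, h4⟩ := this
    exact ⟨act', h1, h2, h3, fun b hb => h4 b hb (Nat.zero_le _)⟩
  · rintro k hk t hft htk ⟨act', h1, h2, h3, h4⟩
    have hst := hs.frame hft (by decide) (by decide)
    have hMt : Codes (t.arr 2) M := by rw [hft.arr 2 (by decide)]; exact hMc
    by_cases hkM : t.arr 2 k = 0
    · have hkM' : (⟨k, hk⟩ : Fin m) ∉ M := fun h => (hMt.iff ⟨k, hk⟩).2 h hkM
      set t1 := t.setArr 3 k 0 with ht1
      have hst1 : Setup e0 e1 t1 := hst.frame (R := []) (A := [3]) (.setArr _ (by simp))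
        (by decide) (by decide)
      have hMt1 : Codes (t1.arr 2) M := by
        have : t1.arr 2 = t.arr 2 := by funext x; simp [ht1]
        rw [this]; exact hMt
      have hact1 : Codes (t1.arr 3) (act'.erase ⟨k, hk⟩) := h1.erase ⟨k, hk⟩ (by simp [ht1])
      have hsub1 : M ⊆ act'.erase ⟨k, hk⟩ := fun b hb =>
        mem_erase.2 ⟨fun h => hkM' (h ▸ hb), h2 hb⟩
      have hd := decideCmd_spec hst1 hne hMt1 hact1 hM hsub1
      have hfd := frame_run decideCmd t1
      have h3d : (decideCmd.run t1).arr 3 = t1.arr 3 := hfd.arr 3 (by decide)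
      have h16 : (decideCmd.run t1).reg 16 = k := by rw [hfd.reg 16 (by decide), ht1]; simp [htk]
      rw [run_ite_zero (by simpa [htk] using hkM)]
      simp only [run_seq, run_put, eval_R, eval_K, htk, ← ht1]
      by_cases h6 : (decideCmd.run t1).reg 6 = 0
      · rw [run_ite_zero (by simpa using h6)]
        refine ⟨act', ?_, h2, h3, fun b hb hkb hbM => ?_⟩
        -- Reactivating the edge is harmless: were it inactive before, deleting it would have
        -- changed nothing and the matching would still not be maximum.
        · have hmem : (⟨k, hk⟩ : Fin m) ∈ act' := by
            by_contra h
            rw [erase_eq_of_notMem h] at hd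
            exact h3 (hd.1 h6)
          have := hact1.insert ⟨k, hk⟩ (g := fun x => if x = k then 1 else t1.arr 3 x)
            (fun x => rfl)
          rw [insert_erase hmem] at this
          have e : ((put 3 (R 16) (K 1)).run (decideCmd.run t1)).arr 3 =
              fun x => if x = k then 1 else t1.arr 3 x := by
            funext x
            simp [h16, h3d]
          rw [e]
          exact this
        · rcases hkb.lt_or_eq with h | h
          · exact h4 b hb h hbM
          · obtain rfl : b = ⟨k, hk⟩ := Fin.ext h.symm
            exact hd.1 h6
      · rw [run_ite_ne (by simpa using h6), run_skip]
        refine ⟨act'.erase ⟨k, hk⟩, by rw [h3d]; exact hact1, hsub1, fun h => h6 (hd.2 h),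
          fun b hb hkb hbM => ?_⟩
        obtain ⟨hbk, hb⟩ := mem_erase.1 hb
        -- One pass suffices: maximality is inherited by smaller edge sets, so an edge that once
        -- could not be deleted remains critical after further deletions.
        refine (h4 b hb ?_ hbM).mono (erase_subset_erase _ (erase_subset _ _))
        rcases hkb.lt_or_eq with h | h
        · exact h
        · exact absurd (Fin.ext h.symm) hbk
    · have hkM' : (⟨k, hk⟩ : Fin m) ∈ M := (hMt.iff ⟨k, hk⟩).1 hkM
      rw [run_ite_ne (by simpa [htk] using hkM), run_skip]
      refine ⟨act', h1, h2, h3, fun b hb hkb hbM => h4 b hb ?_ hbM⟩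
      rcases hkb.lt_or_eq with h | h
      · exact h
      · obtain rfl : b = ⟨k, hk⟩ := Fin.ext h.symm
        exact absurd hkM' hbM

/-- Mark the ends of the active edges outside the matching. -/
def markCmd : Cmd := seq (loopLt 2 16 (put 7 (R 16) (K 0)))
  (loopLt 3 16 (ite (Ar 3 (R 16)) (ite (Ar 2 (R 16)) skip
    (seq (put 7 (Ar 0 (R 16)) (K 1)) (put 7 (Ar 1 (R 16)) (K 1)))) skip))

lemma markCmd_spec (hs : Setup e0 e1 s) (hMc : Codes (s.arr 2) M) (hact : Codes (s.arr 3) act)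
    (x : Fin n) : (markCmd.run s).arr 7 x ≠ 0 ↔ ∃ c ∈ act, c ∉ M ∧ IncEnds e0 e1 c x := by
  set s1 := (loopLt 2 16 (put 7 (R 16) (K 0))).run s with hs1
  have hf1 : Frame [16] [7] s s1 := frame_run (loopLt 2 16 (put 7 (R 16) (K 0))) s
  have h1 : ∀ x : Fin n, 0 ≤ x.val → s1.arr 7 x = 0 := by
    refine loopLt_induction (fun k t => ∀ x : Fin n, k ≤ x.val → t.arr 7 x = 0) hs.r2
      (by rw [hs.r0]; omega) (by decide) (fun _ _ _ h => h) (fun x hx => by omega) ?_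
    rintro k hk t - htk ht x hx
    have := ht x
    simp [htk]
    omega
  have hst1 := hs.frame hf1 (by decide) (by decide)
  have h2 : ∀ x : Fin n, (markCmd.run s).arr 7 x ≠ 0 ↔
      ∃ c ∈ act, 0 ≤ c.val ∧ c ∉ M ∧ IncEnds e0 e1 c x := by
    refine loopLt_induction (s := s1) (fun k t => ∀ x : Fin n, t.arr 7 x ≠ 0 ↔
      ∃ c ∈ act, k ≤ c.val ∧ c ∉ M ∧ IncEnds e0 e1 c x) hst1.r3
      (by rw [hst1.r0]; omega) (by decide) (fun _ _ _ h => h) (fun x => ?_) ?_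
    · rw [h1 x (Nat.zero_le _)]
      simp only [ne_eq, not_true, false_iff]
      rintro ⟨c, -, h, -⟩
      omega
    · intro k hk t hft htk ht x
      have hst := hst1.frame hft (by decide) (by decide)
      have hMt : Codes (t.arr 2) M := by rw [hft.arr 2 (by decide), hf1.arr 2 (by decide)]; exact hMc
      have hat : Codes (t.arr 3) act := by
        rw [hft.arr 3 (by decide), hf1.arr 3 (by decide)]; exact hact
      have ha := hat.iff ⟨k, hk⟩
      have hm := hMt.iff ⟨k, hk⟩
      have hskip : ((⟨k, hk⟩ : Fin m) ∈ act → (⟨k, hk⟩ : Fin m) ∈ M) → (t.arr 7 x ≠ 0 ↔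
          ∃ c ∈ act, k ≤ c.val ∧ c ∉ M ∧ IncEnds e0 e1 c x) := by
        intro h
        rw [ht x]
        constructor
        · rintro ⟨c, a, b, d⟩; exact ⟨c, a, by omega, d⟩
        · rintro ⟨c, a, b, d⟩
          refine ⟨c, a, ?_, d⟩
          rcases b.lt_or_eq with h' | h'
          · exact h'
          · obtain rfl : c = ⟨k, hk⟩ := Fin.ext h'.symm
            exact absurd (h a) d.1
      by_cases h3 : t.arr 3 k = 0
      · rw [run_ite_zero (by simpa [htk] using h3), run_skip]
        exact hskip fun h => absurd h3 (ha.2 h)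
      by_cases h4 : t.arr 2 k = 0
      swap
      · rw [run_ite_ne (by simpa [htk] using h3), run_ite_ne (by simpa [htk] using h4), run_skip]
        exact hskip fun _ => hm.1 h4
      rw [run_ite_ne (by simpa [htk] using h3), run_ite_zero (by simpa [htk] using h4)]
      have ha0 : t.arr 0 k = e0 ⟨k, hk⟩ := hst.a0 ⟨k, hk⟩
      have ha1 : t.arr 1 k = e1 ⟨k, hk⟩ := hst.a1 ⟨k, hk⟩
      have e : ((seq (put 7 (Ar 0 (R 16)) (K 1)) (put 7 (Ar 1 (R 16)) (K 1))).run t).arr 7 x =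
          if x = e1 ⟨k, hk⟩ then 1 else if x = e0 ⟨k, hk⟩ then 1 else t.arr 7 x := by
        simp [htk, ha0, ha1, Fin.ext_iff]
      rw [e]
      constructor
      · intro h
        by_cases h5 : x = e1 ⟨k, hk⟩
        · exact ⟨_, ha.1 h3, le_rfl, fun h => hm.2 h h4, .inr h5.symm⟩
        by_cases h6 : x = e0 ⟨k, hk⟩
        · exact ⟨_, ha.1 h3, le_rfl, fun h => hm.2 h h4, .inl h6.symm⟩
        rw [if_neg h5, if_neg h6, ht x] at h
        obtain ⟨c, a, b, d⟩ := h
        exact ⟨c, a, by omega, d⟩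
      · rintro ⟨c, a, b, d⟩
        rcases b.lt_or_eq with h' | h'
        · split_ifs
          · simp
          · simp
          · exact (ht x).2 ⟨c, a, h', d⟩
        · obtain rfl : c = ⟨k, hk⟩ := Fin.ext h'.symm
          rcases d.2 with h | h <;> simp [h]
  rw [h2 x]
  simp

/-- Replace the matching by the larger one. -/
def updateCmd : Cmd := loopLt 3 16 (ite (Ar 3 (R 16)) (ite (Ar 2 (R 16))
  (ite (plus (Ar 7 (Ar 0 (R 16))) (Ar 7 (Ar 1 (R 16)))) (put 2 (R 16) (K 0)) skip)
  (put 2 (R 16) (K 1))) skip)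

lemma updateCmd_spec (hs : Setup e0 e1 s) (hMc : Codes (s.arr 2) M) (hact : Codes (s.arr 3) act)
    (hsub : M ⊆ act) :
    ∃ M', Codes ((updateCmd.run s).arr 2) M' ∧ ∀ b, b ∈ M' ↔ b ∈ act ∧
      (b ∉ M ∨ ∀ x, IncEnds e0 e1 b x → s.arr 7 x = 0) := by
  have := loopLt_induction (s := s) (q := 3) (r := 16) (c := ite (Ar 3 (R 16)) (ite (Ar 2 (R 16))
      (ite (plus (Ar 7 (Ar 0 (R 16))) (Ar 7 (Ar 1 (R 16)))) (put 2 (R 16) (K 0)) skip)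
      (put 2 (R 16) (K 1))) skip)
    (fun k t => ∃ M', Codes (t.arr 2) M' ∧ (∀ b : Fin m, b.val < k → (b ∈ M' ↔ b ∈ M)) ∧
      ∀ b : Fin m, k ≤ b.val → (b ∈ M' ↔ b ∈ act ∧
        (b ∉ M ∨ ∀ x, IncEnds e0 e1 b x → s.arr 7 x = 0))) hs.r3
    (by rw [hs.r0]; omega) (by decide) (fun _ _ _ h => h)
    ⟨M, hMc, fun _ _ => Iff.rfl, fun b hb => by omega⟩ ?_
  · obtain ⟨M', h1, -, h2⟩ := this
    exact ⟨M', h1, fun b => h2 b (Nat.zero_le _)⟩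
  · rintro k hk t hft htk ⟨M', h1, h2, h3⟩
    have hst := hs.frame hft (by decide) (by decide)
    have hat : Codes (t.arr 3) act := by rw [hft.arr 3 (by decide)]; exact hact
    have h7 : t.arr 7 = s.arr 7 := hft.arr 7 (by decide)
    have ha := hat.iff ⟨k, hk⟩
    have hm := (h1.iff ⟨k, hk⟩).trans (h2 ⟨k, hk⟩ (Nat.lt_succ_self k))
    have ha0 : t.arr 0 k = e0 ⟨k, hk⟩ := hst.a0 ⟨k, hk⟩
    have ha1 : t.arr 1 k = e1 ⟨k, hk⟩ := hst.a1 ⟨k, hk⟩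
    -- The update can be made in place: edges with smaller numbers still have their old status, and
    -- the decision on an edge uses only its own status and the marks, which do not change.
    have hfin : ∀ (f : ℕ → ℕ) (M'' : Finset (Fin m)), Codes f M'' →
        (∀ b, b ≠ ⟨k, hk⟩ → (b ∈ M'' ↔ b ∈ M')) → (⟨k, hk⟩ ∈ M'' ↔ ⟨k, hk⟩ ∈ act ∧
          (⟨k, hk⟩ ∉ M ∨ ∀ x, IncEnds e0 e1 ⟨k, hk⟩ x → s.arr 7 x = 0)) →
        ∃ M', Codes f M' ∧ (∀ b : Fin m, b.val < k → (b ∈ M' ↔ b ∈ M)) ∧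
          ∀ b : Fin m, k ≤ b.val → (b ∈ M' ↔ b ∈ act ∧
            (b ∉ M ∨ ∀ x, IncEnds e0 e1 b x → s.arr 7 x = 0)) := by
      intro f M'' hf hb hkk
      refine ⟨M'', hf, fun b hbk => ?_, fun b hbk => ?_⟩
      · rw [hb b (fun h => by simp [h] at hbk)]
        exact h2 b (by omega)
      · rcases hbk.lt_or_eq with h | h
        · rw [hb b (fun h' => by simp [h'] at h)]
          exact h3 b h
        · obtain rfl : b = ⟨k, hk⟩ := Fin.ext h.symm
          exact hkk
    by_cases h4 : t.arr 3 k = 0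
    · rw [run_ite_zero (by simpa [htk] using h4), run_skip]
      have hka : (⟨k, hk⟩ : Fin m) ∉ act := fun h => ha.2 h h4
      refine hfin _ M' h1 (fun _ _ => Iff.rfl) ⟨fun h => ?_, fun h => absurd h.1 hka⟩
      exact absurd (hsub ((h2 ⟨k, hk⟩ (Nat.lt_succ_self k)).1 h)) hka
    rw [run_ite_ne (by simpa [htk] using h4)]
    by_cases h5 : t.arr 2 k = 0
    · rw [run_ite_zero (by simpa [htk] using h5)]
      refine hfin _ _ (h1.insert ⟨k, hk⟩ (by simp [htk])) (fun b hb => by simp [hb]) ?_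
      simp only [mem_insert, true_or, true_iff]
      exact ⟨ha.1 h4, .inl fun h => hm.2 h h5⟩
    rw [run_ite_ne (by simpa [htk] using h5)]
    have hkM := hm.1 h5
    by_cases h6 : t.arr 7 (e0 ⟨k, hk⟩) + t.arr 7 (e1 ⟨k, hk⟩) = 0
    · rw [run_ite_zero (by simpa [htk, ha0, ha1] using h6), run_skip]
      refine hfin _ _ h1 (fun _ _ => Iff.rfl) ?_
      simp only [(h2 ⟨k, hk⟩ (Nat.lt_succ_self k)).2 hkM, true_iff]
      refine ⟨ha.1 h4, .inr ?_⟩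
      rw [h7] at h6
      rintro x (rfl | rfl) <;> omega
    · rw [run_ite_ne (by simpa [htk, ha0, ha1] using h6)]
      refine hfin _ _ (h1.erase ⟨k, hk⟩ (by simp [htk])) (fun b hb => by simp [hb]) ?_
      simp only [mem_erase, ne_eq, not_true, false_and, false_iff]
      rintro ⟨-, h | h⟩
      · exact h hkM
      · rw [h7, h _ (.inl rfl), h _ (.inr rfl)] at h6
        exact h6 rfl

/-- Enlarge the matching of the array `2` if possible. -/
def augmentCmd : Cmd := seq activateCmd (seq decideCmd
  (ite (R 6) (seq shrinkCmd (seq markCmd updateCmd)) skip))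

lemma augmentCmd_spec [NeZero n] (hs : Setup e0 e1 s) (hne : ∀ b, e0 b ≠ e1 b)
    (hMc : Codes (s.arr 2) M) (hact : Codes (s.arr 3) act) (hM : IsMatEnds e0 e1 M) :
    ∃ M' act' : Finset (Fin m), Codes ((augmentCmd.run s).arr 2) M' ∧ Codes ((augmentCmd.run s).arr 3) act' ∧
      IsMatEnds e0 e1 M' ∧ (#M < #M' ∨ (M' = M ∧ MaxEnds e0 e1 univ M)) := by
  set s1 := activateCmd.run s with hs1
  have hf1 : Frame activateCmd.regs activateCmd.arrs s s1 := frame_run _ _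
  have hst1 := hs.frame hf1 (by decide) (by decide)
  have hact1 : Codes (s1.arr 3) (univ : Finset (Fin m)) := activateCmd_spec hs hact
  have hM1 : Codes (s1.arr 2) M := by rw [hf1.arr 2 (by decide)]; exact hMc
  have hd := decideCmd_spec hst1 hne hM1 hact1 hM (subset_univ M)
  set s2 := decideCmd.run s1 with hs2
  have hf2 : Frame decideCmd.regs decideCmd.arrs s1 s2 := frame_run _ _
  have hst2 := hst1.frame hf2 (by decide) (by decide)
  have hact2 : Codes (s2.arr 3) (univ : Finset (Fin m)) := by
    rw [hf2.arr 3 (by decide)]; exact hact1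
  have hM2 : Codes (s2.arr 2) M := by rw [hf2.arr 2 (by decide)]; exact hM1
  have hr : augmentCmd.run s =
    (ite (R 6) (seq shrinkCmd (seq markCmd updateCmd)) skip).run s2 := rfl
  by_cases h6 : s2.reg 6 = 0
  · rw [hr, run_ite_zero (by simpa using h6), run_skip]
    exact ⟨M, univ, hM2, hact2, hM, .inr ⟨rfl, hd.1 h6⟩⟩
  rw [run_ite_ne (by simpa using h6)] at hr
  have hnot : ¬ MaxEnds e0 e1 univ M := fun h => h6 (hd.2 h)
  obtain ⟨act3, hact3, hsub3, hnot3, hcrit⟩ :=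
    shrinkCmd_spec hst2 hne hM2 hact2 hM (subset_univ M) hnot
  set s3 := shrinkCmd.run s2 with hs3
  have hf3 : Frame shrinkCmd.regs shrinkCmd.arrs s2 s3 := frame_run _ _
  have hst3 := hst2.frame hf3 (by decide) (by decide)
  have hM3 : Codes (s3.arr 2) M := by rw [hf3.arr 2 (by decide)]; exact hM2
  have hT := markCmd_spec hst3 hM3 hact3
  set s4 := markCmd.run s3 with hs4
  have hf4 : Frame markCmd.regs markCmd.arrs s3 s4 := frame_run _ _
  have hst4 := hst3.frame hf4 (by decide) (by decide)
  have hM4 : Codes (s4.arr 2) M := by rw [hf4.arr 2 (by decide)]; exact hM3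
  have hact4 : Codes (s4.arr 3) act3 := by rw [hf4.arr 3 (by decide)]; exact hact3
  obtain ⟨M', hM', hmem⟩ := updateCmd_spec hst4 hM4 hact4 hsub3
  have hr' : augmentCmd.run s = updateCmd.run s4 := hr
  have hf5 : Frame updateCmd.regs updateCmd.arrs s4 (updateCmd.run s4) := frame_run _ _
  have := exists_augmentation (M' := M') hM hnot3 (fun b hb hbM N hN hbN hNM =>
    hcrit b hb hbM N (fun c hc => mem_erase.2 ⟨fun h => hbN (h ▸ hc), hN hc⟩) hNM) ?_
  · refine ⟨M', act3, by rw [hr']; exact hM', ?_, this.1, .inl this.2⟩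
    rw [hr', hf5.arr 3 (by decide)]
    exact hact4
  · intro b
    rw [hmem b]
    refine and_congr_right fun _ => or_congr_right ⟨fun h c hc hcM x hbx hcx => ?_, fun h x hbx => ?_⟩
    · exact (hT x).2 ⟨c, hc, hcM, hcx⟩ (h x hbx)
    · by_contra h'
      obtain ⟨c, hc, hcM, hcx⟩ := (hT x).1 h'
      exact h c hc hcM x hbx hcx

/-- Compute a maximum matching, in the array `2`. -/
def matchingCmd : Cmd := loop 17 augmentCmd

/-- Each pass enlarges the matching or finds it maximum. A matching has at most `m` edges, so `n + m
+ 1` passes cannot all enlarge it. -/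
theorem matchingCmd_spec [NeZero n] (hs : Setup e0 e1 s) (hne : ∀ b, e0 b ≠ e1 b)
    (h2 : ∀ b, s.arr 2 b = 0) (h3 : ∀ b, s.arr 3 b = 0) :
    ∃ M, Codes ((matchingCmd.run s).arr 2) M ∧ IsMatEnds e0 e1 M ∧ MaxEnds e0 e1 univ M := by
  have := loop_induction (s := s) (r := 17) (c := augmentCmd)
    (fun k t => ∃ M act : Finset (Fin m), Codes (t.arr 2) M ∧ Codes (t.arr 3) act ∧ IsMatEnds e0 e1 M ∧
      (MaxEnds e0 e1 univ M ∨ n + m + 1 - k ≤ #M)) ?_ ?_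
  · obtain ⟨M, -, h1, -, h2, h3 | h3⟩ := this
    · exact ⟨M, h1, h2, h3⟩
    · have := card_le_univ M
      rw [Fintype.card_fin] at this
      omega
  · refine ⟨∅, ∅, fun b => by simp [h2], fun b => by simp [h3], by simp [IsMatEnds], .inr ?_⟩
    rw [hs.r0]
    simp
  · rintro k - t hft ⟨M, act, h1, h2, h3, h4⟩
    have hf : Frame (17 :: augmentCmd.regs) augmentCmd.arrs s (t.setReg 17 k) :=
      hft.trans (.setReg _ (by simp))
    obtain ⟨M', act', a, b, c, d⟩ := augmentCmd_spec (s := t.setReg 17 k)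
      (hs.frame hf (by decide) (by decide)) hne h1 h2 h3
    refine ⟨M', act', a, b, c, ?_⟩
    rcases d with d | ⟨rfl, d⟩
    · rcases h4 with h4 | h4
      · exact absurd (h4 M' (subset_univ _) c) (by omega)
      · exact .inr (by omega)
    · exact .inl d

end TwoPPM

/-! ## Orienting the remaining edges -/

namespace TwoPPM

open LoopLang LoopLang.Cmd LoopLang.Ex Finset

variable {n m : ℕ} {e0 e1 : Fin m → Fin n} {s t : Store} {M : Finset (Fin m)}
  {p q : Fin n → Fin m}

/-- Choose two edges outside the matching at every vertex. -/
def pairCmd : Cmd := loopLt 3 16 (ite (Ar 2 (R 16)) skip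
  (seq (seq (put 11 (Ar 0 (R 16)) (Ar 10 (Ar 0 (R 16)))) (put 10 (Ar 0 (R 16)) (R 16)))
    (seq (put 11 (Ar 1 (R 16)) (Ar 10 (Ar 1 (R 16)))) (put 10 (Ar 1 (R 16)) (R 16)))))

lemma pairCmd_spec (hs : Setup e0 e1 s) (hne : ∀ b, e0 b ≠ e1 b) (hMc : Codes (s.arr 2) M)
    (hpair : ∀ v, ∃ b b', b ≠ b' ∧ IncEnds e0 e1 b v ∧ IncEnds e0 e1 b' v ∧ b ∉ M ∧ b' ∉ M) :
    ∃ p q : Fin n → Fin m, (∀ v : Fin n, (pairCmd.run s).arr 10 v = p v) ∧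
      (∀ v : Fin n, (pairCmd.run s).arr 11 v = q v) ∧ (∀ v, p v ≠ q v) ∧
      (∀ v, IncEnds e0 e1 (p v) v) ∧ (∀ v, IncEnds e0 e1 (q v) v) ∧ (∀ v, p v ∉ M) ∧
      ∀ v, q v ∉ M := by
  have := loopLt_induction (s := s) (q := 3) (r := 16) (c := ite (Ar 2 (R 16)) skip
      (seq (seq (put 11 (Ar 0 (R 16)) (Ar 10 (Ar 0 (R 16)))) (put 10 (Ar 0 (R 16)) (R 16)))
        (seq (put 11 (Ar 1 (R 16)) (Ar 10 (Ar 1 (R 16)))) (put 10 (Ar 1 (R 16)) (R 16)))))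
    -- Arrays `10` and `11` hold the last and the last but one edge outside the matching that was
    -- met at `v`. The nested form asserts the first entry once one such edge has been met, and the
    -- second once there are two.
    (fun k t => ∀ v : Fin n, ∀ b : Fin m, k ≤ b.val → b ∉ M → IncEnds e0 e1 b v →
      ∃ p : Fin m, t.arr 10 v = p ∧ k ≤ p.val ∧ p ∉ M ∧ IncEnds e0 e1 p v ∧
        (∀ b' : Fin m, k ≤ b'.val → b' ∉ M → IncEnds e0 e1 b' v → b ≠ b' →
          ∃ q : Fin m, t.arr 11 v = q ∧ q ∉ M ∧ IncEnds e0 e1 q v ∧ p ≠ q)) hs.r3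
    (by rw [hs.r0]; omega) (by decide) (fun _ _ _ h => h) (fun v b hb => by omega) ?_
  · have h : ∀ v : Fin n, ∃ p q : Fin m, (pairCmd.run s).arr 10 v = p ∧
        (pairCmd.run s).arr 11 v = q ∧ p ≠ q ∧ IncEnds e0 e1 p v ∧ IncEnds e0 e1 q v ∧ p ∉ M ∧
        q ∉ M := by
      intro v
      obtain ⟨b, b', hbb, hb, hb', hbM, hbM'⟩ := hpair v
      obtain ⟨p, h1, -, h2, h3, h4⟩ := this v b (Nat.zero_le _) hbM hb
      obtain ⟨q, g1, g2, g3, g4⟩ := h4 b' (Nat.zero_le _) hbM' hb' hbb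
      exact ⟨p, q, h1, g1, g4, h3, g3, h2, g2⟩
    choose p q h using h
    exact ⟨p, q, fun v => (h v).1, fun v => (h v).2.1, fun v => (h v).2.2.1,
      fun v => (h v).2.2.2.1, fun v => (h v).2.2.2.2.1, fun v => (h v).2.2.2.2.2.1,
      fun v => (h v).2.2.2.2.2.2⟩
  · rintro k hk t hft htk ht v b hb hbM hbv
    have hst := hs.frame hft (by decide) (by decide)
    have hMt : Codes (t.arr 2) M := by rw [hft.arr 2 (by decide)]; exact hMc
    have hm := hMt.iff ⟨k, hk⟩
    have hne' : ∀ c : Fin m, c ≠ ⟨k, hk⟩ → k ≤ c.val → k + 1 ≤ c.val := fun c hc hkc => by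
      rcases hkc.lt_or_eq with h | h
      · exact h
      · exact absurd (Fin.ext h.symm) hc
    have hskip : ((⟨k, hk⟩ : Fin m) ∈ M ∨ ¬ IncEnds e0 e1 ⟨k, hk⟩ v) →
        ∃ p : Fin m, t.arr 10 v = p ∧ k ≤ p.val ∧ p ∉ M ∧ IncEnds e0 e1 p v ∧
        (∀ b' : Fin m, k ≤ b'.val → b' ∉ M → IncEnds e0 e1 b' v → b ≠ b' →
          ∃ q : Fin m, t.arr 11 v = q ∧ q ∉ M ∧ IncEnds e0 e1 q v ∧ p ≠ q) := by
      intro h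
      have hlt : ∀ c : Fin m, c ∉ M → IncEnds e0 e1 c v → c ≠ ⟨k, hk⟩ := by
        rintro c hc hcv rfl
        exact h.elim hc (fun h => h hcv)
      obtain ⟨p, h1, h2, h3, h4, h5⟩ := ht v b (hne' b (hlt b hbM hbv) hb) hbM hbv
      exact ⟨p, h1, by omega, h3, h4, fun b' hb' hbM' hbv' =>
        h5 b' (hne' b' (hlt b' hbM' hbv') hb') hbM' hbv'⟩
    by_cases h2 : t.arr 2 k = 0
    swap
    · rw [run_ite_ne (by simpa [htk] using h2), run_skip]
      exact hskip (.inl (hm.1 h2))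
    rw [run_ite_zero (by simpa [htk] using h2)]
    have ha0 : t.arr 0 k = e0 ⟨k, hk⟩ := hst.a0 ⟨k, hk⟩
    have ha1 : t.arr 1 k = e1 ⟨k, hk⟩ := hst.a1 ⟨k, hk⟩
    have hnek : (e0 ⟨k, hk⟩ : ℕ) ≠ e1 ⟨k, hk⟩ := fun h => hne _ (Fin.ext h)
    set t' := (seq (seq (put 11 (Ar 0 (R 16)) (Ar 10 (Ar 0 (R 16)))) (put 10 (Ar 0 (R 16)) (R 16)))
      (seq (put 11 (Ar 1 (R 16)) (Ar 10 (Ar 1 (R 16)))) (put 10 (Ar 1 (R 16)) (R 16)))).run t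
      with ht'
    have hM' : (⟨k, hk⟩ : Fin m) ∉ M := fun h => hm.2 h h2
    by_cases hkv : IncEnds e0 e1 ⟨k, hk⟩ v
    · have h10 : t'.arr 10 v = k := by
        rcases hkv with rfl | rfl <;> simp [ht', htk, ha0, ha1]
      have h11 : t'.arr 11 v = t.arr 10 v := by
        rcases hkv with rfl | rfl <;> simp [ht', htk, ha0, ha1, hnek, hnek.symm]
      refine ⟨⟨k, hk⟩, h10, le_rfl, hM', hkv, fun b' hb' hbM' hbv' hbb => ?_⟩
      have : ∃ c : Fin m, c ≠ ⟨k, hk⟩ ∧ k ≤ c.val ∧ c ∉ M ∧ IncEnds e0 e1 c v := by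
        by_cases h : b = ⟨k, hk⟩
        · exact ⟨b', fun h' => hbb (h.trans h'.symm), hb', hbM', hbv'⟩
        · exact ⟨b, h, hb, hbM, hbv⟩
      obtain ⟨c, c1, c2, c3, c4⟩ := this
      obtain ⟨p, p1, p2, p3, p4, -⟩ := ht v c (hne' c c1 c2) c3 c4
      refine ⟨p, h11.trans p1, p3, p4, fun h => ?_⟩
      -- The older entry has a number of at least `k + 1`, so it differs from edge `k`.
      rw [← h] at p2
      exact absurd p2 (by simp)
    · have hv0 : (v : ℕ) ≠ e0 ⟨k, hk⟩ := fun h => hkv (.inl (Fin.ext h.symm))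
      have hv1 : (v : ℕ) ≠ e1 ⟨k, hk⟩ := fun h => hkv (.inr (Fin.ext h.symm))
      have h10 : t'.arr 10 v = t.arr 10 v := by simp [ht', htk, ha0, ha1, hv0, hv1]
      have h11 : t'.arr 11 v = t.arr 11 v := by simp [ht', htk, ha0, ha1, hv0, hv1]
      rw [h10, h11]
      exact hskip (.inr hkv)

/-- Every edge is a class of its own, and its tail is its first end. -/
def initTailCmd : Cmd := loopLt 3 16 (seq (put 8 (R 16) (R 16)) (put 9 (R 16) (Ar 0 (R 16))))

lemma initTailCmd_spec (hs : Setup e0 e1 s) (b : Fin m) :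
    (initTailCmd.run s).arr 8 b = b ∧ (initTailCmd.run s).arr 9 b = e0 b := by
  have := loopLt_induction (s := s) (q := 3) (r := 16)
    (c := seq (put 8 (R 16) (R 16)) (put 9 (R 16) (Ar 0 (R 16))))
    (fun k t => ∀ b : Fin m, k ≤ b.val → t.arr 8 b = b ∧ t.arr 9 b = e0 b) hs.r3
    (by rw [hs.r0]; omega) (by decide) (fun _ _ _ h => h) (fun b hb => by omega) ?_
  · exact this b (Nat.zero_le _)
  · rintro k hk t hft htk ht b hb
    have hst := hs.frame hft (by decide) (by decide)
    have ha0 : t.arr 0 b = e0 b := hst.a0 b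
    rcases hb.lt_or_eq with h | rfl
    · have h' : (b : ℕ) ≠ k := by omega
      simpa [htk, h'] using ht b h
    · simp [htk, ha0]

/-- Reverse the edges of the class of register `15`. -/
def flipCmd : Cmd := loopLt 3 9 (ifEq (Ar 8 (R 9)) (R 15)
  (put 9 (R 9) (minus (plus (Ar 0 (R 9)) (Ar 1 (R 9))) (Ar 9 (R 9)))) skip)

/-- The tail is one of the two ends, so subtracting it from their sum leaves the other; this avoids
a case distinction in the program. -/
lemma flipCmd_spec (hs : Setup e0 e1 s) (b : Fin m) : (flipCmd.run s).arr 9 b =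
    if s.arr 8 b = s.reg 15 then e0 b + e1 b - s.arr 9 b else s.arr 9 b := by
  have := loopLt_induction (s := s) (q := 3) (r := 9) (c := ifEq (Ar 8 (R 9)) (R 15)
      (put 9 (R 9) (minus (plus (Ar 0 (R 9)) (Ar 1 (R 9))) (Ar 9 (R 9)))) skip)
    (fun k t => ∀ b : Fin m, t.arr 9 b =
      if k ≤ b.val ∧ s.arr 8 b = s.reg 15 then e0 b + e1 b - s.arr 9 b else s.arr 9 b) hs.r3
    (by rw [hs.r0]; omega) (by decide) (fun _ _ _ h => h) (fun b => (if_neg (by omega)).symm) ?_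
  · simpa [flipCmd] using this b
  · rintro k hk t hft htk ht b
    have hst := hs.frame hft (by decide) (by decide)
    have h8 : t.arr 8 = s.arr 8 := hft.arr 8 (by decide)
    have h15 : t.reg 15 = s.reg 15 := hft.reg 15 (by decide)
    have ha0 : t.arr 0 b = e0 b := hst.a0 b
    have ha1 : t.arr 1 b = e1 b := hst.a1 b
    by_cases h : s.arr 8 k = s.reg 15
    · rw [run_ifEq_eq (by simpa [htk, h8, h15] using h)]
      rcases eq_or_ne (b : ℕ) k with rfl | hbk
      · have := ht b
        rw [if_neg (by omega)] at this
        simp [htk, h, ha0, ha1, this]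
      · have e : (k ≤ b.val ↔ k + 1 ≤ b.val) := by omega
        simp [htk, hbk, ht b, e]
    · rw [run_ifEq_ne (by simpa [htk, h8, h15] using h), run_skip, ht b]
      rcases eq_or_ne (b : ℕ) k with rfl | hbk
      · simp [h]
      · have e : (k ≤ b.val ↔ k + 1 ≤ b.val) := by omega
        simp [e]

/-- Merge the class of register `15` into that of register `14`. -/
def uniteCmd : Cmd := loopLt 3 9 (ifEq (Ar 8 (R 9)) (R 15) (put 8 (R 9) (R 14)) skip)

lemma uniteCmd_spec (hs : Setup e0 e1 s) (b : Fin m) : (uniteCmd.run s).arr 8 b =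
    if s.arr 8 b = s.reg 15 then s.reg 14 else s.arr 8 b := by
  have := loopLt_induction (s := s) (q := 3) (r := 9)
    (c := ifEq (Ar 8 (R 9)) (R 15) (put 8 (R 9) (R 14)) skip)
    (fun k t => ∀ b : Fin m, t.arr 8 b =
      if k ≤ b.val ∧ s.arr 8 b = s.reg 15 then s.reg 14 else s.arr 8 b) hs.r3
    (by rw [hs.r0]; omega) (by decide) (fun _ _ _ h => h) (fun b => (if_neg (by omega)).symm) ?_
  · simpa [uniteCmd] using this b
  · rintro k hk t hft htk ht b
    have h14 : t.reg 14 = s.reg 14 := hft.reg 14 (by decide)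
    have h15 : t.reg 15 = s.reg 15 := hft.reg 15 (by decide)
    have htk8 : t.arr 8 k = s.arr 8 k := by
      have := ht ⟨k, hk⟩
      rwa [if_neg (by simp)] at this
    by_cases h : s.arr 8 k = s.reg 15
    · rw [run_ifEq_eq (by simpa [htk, htk8, h15] using h)]
      rcases eq_or_ne (b : ℕ) k with rfl | hbk
      · simp [htk, h, h14]
      · have e : (k ≤ b.val ↔ k + 1 ≤ b.val) := by omega
        simp [htk, hbk, ht b, e]
    · rw [run_ifEq_ne (by simpa [htk, htk8, h15] using h), run_skip, ht b]
      rcases eq_or_ne (b : ℕ) k with rfl | hbk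
      · simp [h]
      · have e : (k ≤ b.val ↔ k + 1 ≤ b.val) := by omega
        simp [e]

/-- Reverse the class of register `15` if the edges of registers `10` and `11` both leave or both
enter the vertex of register `16`. -/
def turnCmd : Cmd := ifEq (Ar 9 (R 10)) (R 16) (ifEq (Ar 9 (R 11)) (R 16) flipCmd skip)
  (ifEq (Ar 9 (R 11)) (R 16) skip flipCmd)

/-- Balance the pair of edges at the vertex of register `16`. -/
def balanceCmd : Cmd := seq (set 10 (Ar 10 (R 16))) (seq (set 11 (Ar 11 (R 16)))
  (seq (set 14 (Ar 8 (R 10))) (seq (set 15 (Ar 8 (R 11)))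
    (ifEq (R 14) (R 15) skip (seq turnCmd uniteCmd)))))

/-- The arrays `8` and `9` hold the classes and tails of a partial balanced orientation. -/
def Oriented (e0 e1 : Fin m → Fin n) (p q : Fin n → Fin m) (k : ℕ) (s : Store) : Prop :=
  ∃ tl : Fin m → Fin n, (∀ b : Fin m, s.arr 9 b = tl b) ∧
    OrientInv e0 e1 p q (fun v => k ≤ v.val) (fun b : Fin m => s.arr 8 b) tl

lemma turnCmd_spec {k : ℕ} (hs : Setup e0 e1 s) (hne : ∀ b, e0 b ≠ e1 b)
    (hp : ∀ v, IncEnds e0 e1 (p v) v) (hq : ∀ v, IncEnds e0 e1 (q v) v) (v : Fin n)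
    (h10 : s.reg 10 = p v) (h11 : s.reg 11 = q v) (h15 : s.reg 15 = s.arr 8 (q v))
    (h16 : s.reg 16 = v) (hc : s.arr 8 (p v) ≠ s.arr 8 (q v)) (h : Oriented e0 e1 p q k s) :
    ∃ tl : Fin m → Fin n, (∀ b : Fin m, (turnCmd.run s).arr 9 b = tl b) ∧
      OrientInv e0 e1 p q (fun v => k ≤ v.val) (fun b : Fin m => s.arr 8 b) tl ∧
      (tl (p v) = v ↔ tl (q v) ≠ v) := by
  obtain ⟨tl, htl, hO⟩ := h
  have key : ¬ (tl (p v) = v ↔ tl (q v) ≠ v) → ∃ tl : Fin m → Fin n,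
      (∀ b : Fin m, (flipCmd.run s).arr 9 b = tl b) ∧
      OrientInv e0 e1 p q (fun v => k ≤ v.val) (fun b : Fin m => s.arr 8 b) tl ∧
      (tl (p v) = v ↔ tl (q v) ≠ v) := by
    intro hbad
    let tl' : Fin m → Fin n := fun b => if s.arr 8 b = s.arr 8 (q v) then
      (if e0 b = tl b then e1 b else e0 b) else tl b
    have htl' : ∀ b : Fin m, (s.arr 8 b = s.arr 8 (q v) → IncEnds e0 e1 b (tl' b) ∧ tl' b ≠ tl b) ∧
        (s.arr 8 b ≠ s.arr 8 (q v) → tl' b = tl b) := by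
      intro b
      have := hne b
      refine ⟨fun hb => ?_, fun hb => by simp [tl', hb]⟩
      by_cases e : e0 b = tl b
      · simp only [tl', hb, e, if_true]
        exact ⟨.inr rfl, e ▸ this.symm⟩
      · simp only [tl', hb, e, if_true, if_false]
        exact ⟨.inl rfl, e⟩
    refine ⟨tl', fun b => ?_, hO.flip _ hp hq htl', ?_⟩
    · rw [flipCmd_spec hs, h15, htl b]
      by_cases hb : s.arr 8 b = s.arr 8 (q v)
      · simp only [tl', hb, if_true]
        rcases hO.tail b with e | e
        · rw [if_pos e, ← e]; omega
        · rw [if_neg (fun e' => hne b (e'.trans e.symm)), ← e]; omega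
      · simp only [tl', hb, if_false]
    · rw [(htl' (p v)).2 hc]
      have h1 := (htl' (q v)).1 rfl
      have h2 := hO.tail (q v)
      have h3 := hq v
      have h4 := hne (q v)
      unfold IncEnds at *
      clear_value tl'
      clear htl' htl hO
      grind
  have hpv : s.arr 9 (s.reg 10) = tl (p v) := by rw [h10, htl]
  have hqv : s.arr 9 (s.reg 11) = tl (q v) := by rw [h11, htl]
  by_cases a : tl (p v) = v <;> by_cases b : tl (q v) = v
  · rw [turnCmd, run_ifEq_eq (by simp [hpv, h16, a]), run_ifEq_eq (by simp [hqv, h16, b])]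
    exact key (by simp [a, b])
  · rw [turnCmd, run_ifEq_eq (by simp [hpv, h16, a]),
      run_ifEq_ne (by simpa [hqv, h16, Fin.ext_iff] using b), run_skip]
    exact ⟨tl, htl, hO, by simp [a, b]⟩
  · rw [turnCmd, run_ifEq_ne (by simpa [hpv, h16, Fin.ext_iff] using a),
      run_ifEq_eq (by simp [hqv, h16, b]), run_skip]
    exact ⟨tl, htl, hO, by simp [a, b]⟩
  · rw [turnCmd, run_ifEq_ne (by simpa [hpv, h16, Fin.ext_iff] using a),
      run_ifEq_ne (by simpa [hqv, h16, Fin.ext_iff] using b)]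
    exact key (by simp [a, b])

/-- The counterpart of `exists_step` in the program. Vertices are treated in decreasing order, so
the balanced ones are those from `v + 1` on. -/
lemma balanceCmd_spec (hs : Setup e0 e1 s) (hne : ∀ b, e0 b ≠ e1 b)
    (h10 : ∀ v : Fin n, s.arr 10 v = p v) (h11 : ∀ v : Fin n, s.arr 11 v = q v)
    (hpq : ∀ v, p v ≠ q v) (hp : ∀ v, IncEnds e0 e1 (p v) v) (hq : ∀ v, IncEnds e0 e1 (q v) v)
    (v : Fin n) (h16 : s.reg 16 = v) (h : Oriented e0 e1 p q (v + 1) s) :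
    Oriented e0 e1 p q v (balanceCmd.run s) := by
  set t := (((s.setReg 10 (p v)).setReg 11 (q v)).setReg 14 (s.arr 8 (p v))).setReg 15
    (s.arr 8 (q v)) with ht
  have hr : balanceCmd.run s = (ifEq (R 14) (R 15) skip (seq turnCmd uniteCmd)).run t := by
    simp [balanceCmd, h16, h10, h11, ht]
  have hft : Frame [10, 11, 14, 15] [] s t :=
    (((Frame.setReg s (by simp)).trans (.setReg _ (by simp))).trans (.setReg _ (by simp))).trans
      (.setReg _ (by simp))
  have hst := hs.frame hft (by decide) (by decide)
  have t10 : t.reg 10 = p v := by simp [ht]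
  have t11 : t.reg 11 = q v := by simp [ht]
  have t14 : t.reg 14 = s.arr 8 (p v) := by simp [ht]
  have t15 : t.reg 15 = s.arr 8 (q v) := by simp [ht]
  have t16 : t.reg 16 = v := by simp [ht, h16]
  have tarr : t.arr = s.arr := rfl
  have hd : ∀ w : Fin n, v.val ≤ w.val ↔ v.val + 1 ≤ w.val ∨ w = v := by
    intro w
    rw [Fin.ext_iff]
    omega
  have hv : ¬ (v.val + 1 ≤ v.val) := by omega
  by_cases hc : s.arr 8 (p v) = s.arr 8 (q v)
  · rw [hr, run_ifEq_eq (by simpa [t14, t15] using hc), run_skip]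
    obtain ⟨tl, htl, hO⟩ := h
    exact ⟨tl, by rw [tarr]; exact htl, by
      rw [tarr]; exact hO.close (hpq v) (hp v) (hq v) hv hc hd⟩
  · rw [hr, run_ifEq_ne (by simpa [t14, t15] using hc), run_seq]
    obtain ⟨tl, htl, hO, hbal⟩ := turnCmd_spec (k := v + 1) hst hne hp hq v t10 t11
      (by rw [t15, tarr]) t16 (by rw [tarr]; exact hc) (by unfold Oriented; rw [tarr]; exact h)
    have hft2 := frame_run turnCmd t
    have hst2 := hst.frame hft2 (by decide) (by decide)
    have a8 : (turnCmd.run t).arr 8 = s.arr 8 := by rw [hft2.arr 8 (by decide), tarr]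
    have r14 : (turnCmd.run t).reg 14 = s.arr 8 (p v) := by rw [hft2.reg 14 (by decide), t14]
    have r15 : (turnCmd.run t).reg 15 = s.arr 8 (q v) := by rw [hft2.reg 15 (by decide), t15]
    refine ⟨tl, fun b => ?_, hO.merge (hp v) (hq v) hv (by rw [tarr]; exact hc) hbal
      (fun b => ?_) hd⟩
    · rw [(frame_run uniteCmd _).arr 9 (by decide)]
      exact htl b
    · rw [uniteCmd_spec hst2, a8, r14, r15, tarr]
      exact ⟨fun h => by rw [if_pos h], fun h => by rw [if_neg h]⟩

/-- Compute a balanced orientation. -/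
def orientCmd : Cmd := seq initTailCmd (loopLt 2 16 balanceCmd)

lemma orientCmd_spec (hs : Setup e0 e1 s) (hne : ∀ b, e0 b ≠ e1 b)
    (h10 : ∀ v : Fin n, s.arr 10 v = p v) (h11 : ∀ v : Fin n, s.arr 11 v = q v)
    (hpq : ∀ v, p v ≠ q v) (hp : ∀ v, IncEnds e0 e1 (p v) v) (hq : ∀ v, IncEnds e0 e1 (q v) v) :
    ∃ tl : Fin m → Fin n, (∀ b : Fin m, (orientCmd.run s).arr 9 b = tl b) ∧
      (∀ b, IncEnds e0 e1 b (tl b)) ∧ ∀ v, (tl (p v) = v ↔ tl (q v) ≠ v) := by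
  have hf1 := frame_run initTailCmd s
  have hst1 := hs.frame hf1 (by decide) (by decide)
  have hinit := initTailCmd_spec hs
  have : Oriented e0 e1 p q 0 (orientCmd.run s) := by
    refine loopLt_induction (s := initTailCmd.run s) (q := 2) (r := 16) (c := balanceCmd)
      (fun k t => Oriented e0 e1 p q k t) hst1.r2 (by rw [hst1.r0]; omega) (by decide)
      (fun _ _ _ h => h) ⟨e0, fun b => (hinit b).2, ?_⟩ ?_
    · refine OrientInv.init hne (fun v => by omega) (fun b b' hb => ?_) fun b => .inl rfl
      rw [(hinit b).1, (hinit b').1] at hb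
      exact Fin.ext hb
    · intro k hk t hft htk ht
      have hst := hst1.frame hft (by decide) (by decide)
      refine balanceCmd_spec hst hne ?_ ?_ hpq hp hq ⟨k, hk⟩ htk ht
      · rw [hft.arr 10 (by decide), hf1.arr 10 (by decide)]; exact h10
      · rw [hft.arr 11 (by decide), hf1.arr 11 (by decide)]; exact h11
  obtain ⟨tl, htl, hO⟩ := this
  exact ⟨tl, htl, hO.tail, fun v => (hO.paired v (Nat.zero_le _)).2⟩

/-- Write the edges that are not chosen by the vertices to the first cells. -/
def outputCmd : Cmd := seq (loopLt 3 16 (putInp (R 16) (K 1)))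
  (loopLt 2 16 (ifEq (Ar 9 (Ar 10 (R 16))) (R 16) (putInp (Ar 10 (R 16)) (K 0))
    (putInp (Ar 11 (R 16)) (K 0))))

/-- All edges are marked, then the chosen ones are unmarked. The marks overwrite the input word;
`hm` guarantees that they fit below `reg 1`. -/
lemma outputCmd_spec {tl : Fin m → Fin n} (hs : Setup e0 e1 s) (hm : m ≤ s.reg 1)
    (h9 : ∀ b : Fin m, s.arr 9 b = tl b)
    (h10 : ∀ v : Fin n, s.arr 10 v = p v) (h11 : ∀ v : Fin n, s.arr 11 v = q v) (b : Fin m) :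
    (outputCmd.run s).arr 16 b ≠ 1 ↔
      ∃ v, (tl (p v) = v ∧ b = p v) ∨ (tl (p v) ≠ v ∧ b = q v) := by
  set s1 := (loopLt 3 16 (putInp (R 16) (K 1))).run s with hs1
  have hf1 : Frame [16] [16] s s1 := frame_run (loopLt 3 16 (putInp (R 16) (K 1))) s
  have hst1 := hs.frame hf1 (by decide) (by decide)
  have h1 : ∀ b : Fin m, 0 ≤ b.val → s1.arr 16 b = 1 := by
    refine loopLt_induction (s := s) (q := 3) (r := 16) (c := putInp (R 16) (K 1))
      (fun k t => ∀ b : Fin m, k ≤ b.val → t.arr 16 b = 1) hs.r3 (by rw [hs.r0]; omega)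
      (by decide) (fun _ _ _ h => h) (fun b hb => by omega) ?_
    rintro k hk t hft htk ht b hb
    have ht1 : t.reg 1 = s.reg 1 := hft.reg 1 (by decide)
    rw [run_putInp, if_pos (by simp only [eval_R, htk, ht1]; omega)]
    rcases hb.lt_or_eq with h | rfl
    · simp [ht b h]
    · simp [htk]
  have hm1 : m ≤ s1.reg 1 := by rw [hf1.reg 1 (by decide)]; exact hm
  have h2 : ∀ b : Fin m, (outputCmd.run s).arr 16 b ≠ 1 ↔ ∃ v : Fin n, 0 ≤ v.val ∧
      ((tl (p v) = v ∧ b = p v) ∨ (tl (p v) ≠ v ∧ b = q v)) := by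
    refine loopLt_induction (s := s1) (q := 2) (r := 16)
      (c := ifEq (Ar 9 (Ar 10 (R 16))) (R 16) (putInp (Ar 10 (R 16)) (K 0))
        (putInp (Ar 11 (R 16)) (K 0)))
      (fun k t => ∀ b : Fin m, t.arr 16 b ≠ 1 ↔ ∃ v : Fin n, k ≤ v.val ∧
        ((tl (p v) = v ∧ b = p v) ∨ (tl (p v) ≠ v ∧ b = q v))) hst1.r2 (by rw [hst1.r0]; omega)
      (by decide) (fun _ _ _ h => h) (fun b => ?_) ?_
    · simp only [h1 b (Nat.zero_le _), ne_eq, not_true, false_iff]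
      rintro ⟨v, h, -⟩
      omega
    · rintro k hk t hft htk ht b
      have ht1 : m ≤ t.reg 1 := by rw [hft.reg 1 (by decide)]; exact hm1
      have t9 : t.arr 9 (p ⟨k, hk⟩) = tl (p ⟨k, hk⟩) := by
        rw [hft.arr 9 (by decide), hf1.arr 9 (by decide), h9]
      have t10 : t.arr 10 k = p ⟨k, hk⟩ := by
        rw [hft.arr 10 (by decide), hf1.arr 10 (by decide)]; exact h10 ⟨k, hk⟩
      have t11 : t.arr 11 k = q ⟨k, hk⟩ := by
        rw [hft.arr 11 (by decide), hf1.arr 11 (by decide)]; exact h11 ⟨k, hk⟩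
      have key : ∀ (c : Fin m) (t' : Store), (∀ b : Fin m, t'.arr 16 b =
          if b = c then 0 else t.arr 16 b) → (∀ b : Fin m, ((tl (p ⟨k, hk⟩) = ⟨k, hk⟩ ∧ b = p ⟨k, hk⟩) ∨
            (tl (p ⟨k, hk⟩) ≠ ⟨k, hk⟩ ∧ b = q ⟨k, hk⟩)) ↔ b = c) → (t'.arr 16 b ≠ 1 ↔
          ∃ v : Fin n, k ≤ v.val ∧ ((tl (p v) = v ∧ b = p v) ∨ (tl (p v) ≠ v ∧ b = q v))) := by
        intro c t' ht' hc
        rw [ht']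
        split_ifs with hbc
        · simp only [ne_eq, zero_ne_one, not_false_eq_true, true_iff]
          exact ⟨⟨k, hk⟩, le_rfl, (hc b).2 hbc⟩
        · rw [ht b]
          refine exists_congr fun v => and_congr_left fun hv => ⟨fun h => by omega, fun h => ?_⟩
          rcases h.lt_or_eq with h' | h'
          · exact h'
          · obtain rfl : v = ⟨k, hk⟩ := Fin.ext h'.symm
            exact absurd ((hc b).1 hv) hbc
      by_cases hk' : tl (p ⟨k, hk⟩) = ⟨k, hk⟩
      · rw [run_ifEq_eq (by simp [htk, t10, t9, hk']), run_putInp,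
          if_pos (by simp only [eval_Ar, eval_R, htk, t10]; omega)]
        exact key (p ⟨k, hk⟩) _ (fun b => by simp [htk, t10, Fin.ext_iff]) (by simp [hk'])
      · rw [run_ifEq_ne (by simpa [htk, t10, t9, Fin.ext_iff] using hk'), run_putInp,
          if_pos (by simp only [eval_Ar, eval_R, htk, t11]; omega)]
        exact key (q ⟨k, hk⟩) _ (fun b => by simp [htk, t11, Fin.ext_iff]) (by simp [hk'])
  rw [h2 b]
  simp

end TwoPPM

/-! ## The whole program -/

namespace TwoPPM

open LoopLang LoopLang.Cmd LoopLang.Ex Finset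

variable {n m : ℕ} {s t : Store} {E : Fin n → Fin m → Prop}

/-- The sizes of the graph, a bound for the loops, and the adjacency matrix. -/
structure Input (E : Fin n → Fin m → Prop) (s : Store) : Prop where
  r0 : s.reg 0 = n + m + 1
  r1 : s.reg 1 = 2 + m * n
  r2 : s.reg 2 = n
  r3 : s.reg 3 = m
  mat : ∀ (a : Fin n) (b : Fin m), s.arr 16 (2 + b * n + a) ≠ 0 ↔ E a b

lemma Input.frame (h : Input E s) {R A : List ℕ} (hf : Frame R A s t) (hR : ∀ r ∈ R, 3 < r)
    (hA : 16 ∉ A) : Input E t where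
  r0 := (hf.reg 0 fun h => by have := hR 0 h; omega).trans h.r0
  r1 := (hf.reg 1 fun h => by have := hR 1 h; omega).trans h.r1
  r2 := (hf.reg 2 fun h => by have := hR 2 h; omega).trans h.r2
  r3 := (hf.reg 3 fun h => by have := hR 3 h; omega).trans h.r3
  mat := by rw [hf.arr 16 hA]; exact h.mat

/-- Compute the address of the row of register `16`. -/
def addressCmd : Cmd := seq (set 10 (K 2)) (loopLt 16 9 (set 10 (plus (R 10) (R 2))))

lemma addressCmd_spec (hs : Input E s) {b : ℕ} (hb : b < m) (h16 : s.reg 16 = b) :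
    (addressCmd.run s).reg 10 = 2 + b * n := by
  have := loopLt_induction (s := s.setReg 10 2) (q := 16) (r := 9) (N := b)
    -- The product `b * n` is built by repeated addition, as the machine does not multiply.
    (c := set 10 (plus (R 10) (R 2))) (fun k t => k ≤ b ∧ t.reg 10 = 2 + (b - k) * n)
    (by simp [h16]) (by simp [hs.r0]; omega) (by decide) (fun k t v h => by simpa using h)
    (by simp) ?_
  · exact this.2
  · rintro k hk t hft htk ⟨-, ht⟩
    refine ⟨hk.le, ?_⟩
    have h2 : t.reg 2 = n := by rw [hft.reg 2 (by decide)]; simp [hs.r2]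
    obtain ⟨d, rfl⟩ : ∃ d, b = k + 1 + d := ⟨b - (k + 1), by omega⟩
    simp only [run_set, Store.setReg_reg, if_true, eval_plus, eval_R, ht, h2]
    rw [show k + 1 + d - (k + 1) = d by omega, show k + 1 + d - k = d + 1 by omega]
    ring

/-- Find the two neighbours of the vertex of register `16`. -/
def rowCmd : Cmd := loopLt 2 9 (seq (getInp 13 (plus (R 10) (R 9)))
  (ite (R 13) (seq (put 1 (R 16) (Ar 0 (R 16))) (put 0 (R 16) (R 9))) skip))

lemma rowCmd_spec (hs : Input E s) (b : Fin m) (h16 : s.reg 16 = b)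
    (h10 : s.reg 10 = 2 + b * n) (hE : ∃ x y, x ≠ y ∧ E x b ∧ E y b) :
    (∃ x y : Fin n, (rowCmd.run s).arr 0 b = x ∧ (rowCmd.run s).arr 1 b = y ∧ x ≠ y ∧
      E x b ∧ E y b) ∧ ∀ b' ≠ (b : ℕ), (rowCmd.run s).arr 0 b' = s.arr 0 b' ∧
        (rowCmd.run s).arr 1 b' = s.arr 1 b' := by
  have := loopLt_induction (s := s) (q := 2) (r := 9) (c := seq (getInp 13 (plus (R 10) (R 9)))
      (ite (R 13) (seq (put 1 (R 16) (Ar 0 (R 16))) (put 0 (R 16) (R 9))) skip))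
    -- The same nested invariant as for the pairs of edges: arrays `0` and `1` keep the last two
    -- neighbours met.
    (fun k t => (∀ z : Fin n, k ≤ z.val → E z b →
      ∃ x : Fin n, t.arr 0 b = x ∧ k ≤ x.val ∧ E x b ∧
        (∀ w : Fin n, k ≤ w.val → E w b → z ≠ w →
          ∃ y : Fin n, t.arr 1 b = y ∧ E y b ∧ x ≠ y)) ∧
      ∀ b' ≠ (b : ℕ), t.arr 0 b' = s.arr 0 b' ∧ t.arr 1 b' = s.arr 1 b') hs.r2
    (by rw [hs.r0]; omega) (by decide) (fun _ _ _ h => h)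
    ⟨fun z hz => by omega, fun _ _ => ⟨rfl, rfl⟩⟩ ?_
  · refine ⟨?_, this.2⟩
    obtain ⟨z, w, hzw, hz, hw⟩ := hE
    obtain ⟨x, h1, -, h2, h3⟩ := this.1 z (Nat.zero_le _) hz
    obtain ⟨y, h4, h5, h6⟩ := h3 w (Nat.zero_le _) hw hzw
    exact ⟨x, y, h1, h4, h6, h2, h5⟩
  · rintro k hk t hft htk ⟨ht, hfix⟩
    have hst := hs.frame hft (by decide) (by decide)
    have t16 : t.reg 16 = b := by rw [hft.reg 16 (by decide), h16]
    have t10 : t.reg 10 = 2 + b * n := by rw [hft.reg 10 (by decide), h10]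
    have hlt : 2 + b * n + k < 2 + m * n := by
      have : b * n + n ≤ m * n := by
        rw [← Nat.succ_mul]; exact Nat.mul_le_mul_right n b.2
      omega
    have hmat := hst.mat ⟨k, hk⟩ b
    dsimp only at hmat
    have hne' : ∀ c : Fin n, c ≠ ⟨k, hk⟩ → k ≤ c.val → k + 1 ≤ c.val := fun c hc hkc => by
      rcases hkc.lt_or_eq with h | h
      · exact h
      · exact absurd (Fin.ext h.symm) hc
    rw [run_seq, run_getInp, if_pos (by simpa [htk, t10, hst.r1] using hlt)]
    simp only [eval_plus, eval_R, htk, t10]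
    by_cases hE' : E ⟨k, hk⟩ b
    · rw [run_ite_ne (by simpa using hmat.2 hE')]
      refine ⟨fun z hz hzb => ⟨⟨k, hk⟩, by simp [t16, htk], le_rfl, hE', fun w hw hwb hzw => ?_⟩,
        fun b' hb' => ?_⟩
      · have : ∃ c : Fin n, c ≠ ⟨k, hk⟩ ∧ k ≤ c.val ∧ E c b := by
          by_cases h : z = ⟨k, hk⟩
          · exact ⟨w, fun h' => hzw (h.trans h'.symm), hw, hwb⟩
          · exact ⟨z, h, hz, hzb⟩
        obtain ⟨c, c1, c2, c3⟩ := this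
        obtain ⟨x, x1, x2, x3, -⟩ := ht c (hne' c c1 c2) c3
        refine ⟨x, by simp [t16, x1], x3, fun h => ?_⟩
        rw [← h] at x2
        exact absurd x2 (by simp)
      · simpa [t16, hb'] using hfix b' hb'
    · rw [run_ite_zero (by simpa using fun h => hE' (hmat.1 h)), run_skip]
      refine ⟨fun z hz hzb => ?_, hfix⟩
      have hk' : ∀ c : Fin n, E c b → c ≠ ⟨k, hk⟩ := by
        rintro c hc rfl
        exact hE' hc
      obtain ⟨x, h1, h2, h3, h4⟩ := ht z (hne' z (hk' z hzb) hz) hzb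
      exact ⟨x, h1, by omega, h3, fun w hw hwb => h4 w (hne' w (hk' w hwb) hw) hwb⟩

/-- Read the graph. -/
def readCmd : Cmd := loopLt 3 16 (seq addressCmd rowCmd)

lemma readCmd_spec (hs : Input E s) (hE : ∀ b, ∃ x y, x ≠ y ∧ E x b ∧ E y b) (b : Fin m) :
    ∃ x y : Fin n, (readCmd.run s).arr 0 b = x ∧ (readCmd.run s).arr 1 b = y ∧ x ≠ y ∧
      E x b ∧ E y b := by
  have := loopLt_induction (s := s) (q := 3) (r := 16) (c := seq addressCmd rowCmd)
    (fun k t => ∀ b : Fin m, k ≤ b.val → ∃ x y : Fin n, t.arr 0 b = x ∧ t.arr 1 b = y ∧ x ≠ y ∧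
      E x b ∧ E y b) hs.r3
    (by rw [hs.r0]; omega) (by decide) (fun _ _ _ h => h) (fun b hb => by omega) ?_
  · exact this b (Nat.zero_le _)
  · intro k hk t hft htk ht b hb
    have hst := hs.frame hft (by decide) (by decide)
    have hf := frame_run addressCmd t
    have hst' := hst.frame hf (by decide) (by decide)
    have h16 : (addressCmd.run t).reg 16 = k := by rw [hf.reg 16 (by decide), htk]
    obtain ⟨h1, h2⟩ := rowCmd_spec hst' ⟨k, hk⟩ h16 (addressCmd_spec hst hk htk) (hE _)
    rcases hb.lt_or_eq with h | h
    · obtain ⟨h3, h4⟩ := h2 b (by dsimp only; omega)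
      rw [run_seq, h3, h4, hf.arr 0 (by decide), hf.arr 1 (by decide)]
      exact ht b h
    · obtain rfl : b = ⟨k, hk⟩ := Fin.ext h.symm
      exact h1

/-- Solve the problem. -/
def solveCmd : Cmd := seq (getInp 2 (K 0)) (seq (getInp 3 (K 1)) (seq readCmd (seq matchingCmd
  (seq pairCmd (seq orientCmd outputCmd)))))

theorem solveCmd_spec [NeZero n] (hA : LeftRegular E 3) (hB : RightRegular E 2)
    (r0 : s.reg 0 = n + m + 1) (r1 : s.reg 1 = 2 + m * n) (i0 : s.arr 16 0 = n)
    (i1 : s.arr 16 1 = m) (mat : ∀ (a : Fin n) (b : Fin m), s.arr 16 (2 + b * n + a) ≠ 0 ↔ E a b)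
    (h2 : ∀ b, s.arr 2 b = 0) (h3 : ∀ b, s.arr 3 b = 0) :
    IsOptimal E {b | (solveCmd.run s).arr 16 b = 1} := by
  set s1 := (s.setReg 2 n).setReg 3 m with hs1
  have hr : solveCmd.run s = outputCmd.run (orientCmd.run (pairCmd.run (matchingCmd.run
      (readCmd.run s1)))) := by
    rw [solveCmd, run_seq, run_getInp, if_pos (by simp [r1]), run_seq, run_getInp,
      if_pos (by simp [r1]; omega)]
    simp [i0, i1, hs1]
  have hin : Input E s1 := ⟨by simp [hs1, r0], by simp [hs1, r1], by simp [hs1], by simp [hs1], mat⟩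
  obtain ⟨f0, f1, hfne, hf⟩ := hB.exists_ends
  have hread := readCmd_spec hin fun b =>
    ⟨f0 b, f1 b, hfne b, (hf _ _).2 (.inl rfl), (hf _ _).2 (.inr rfl)⟩
  choose e0 e1 he0 he1 hne hE0 hE1 using hread
  -- The ends found by the program need not come in the order of `f0` and `f1`; since `b` has only
  -- two neighbours, two distinct ones are all of them.
  have hE : ∀ a b, E a b ↔ IncEnds e0 e1 b a := by
    intro a b
    constructor
    · intro h
      have g := (hf _ _).1 h
      have g0 := (hf _ _).1 (hE0 b)
      have g1 := (hf _ _).1 (hE1 b)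
      have g2 := hne b
      unfold IncEnds at *
      grind
    · rintro (rfl | rfl)
      exacts [hE0 b, hE1 b]
  have hf2 := frame_run readCmd s1
  set s2 := readCmd.run s1
  have hin2 := hin.frame hf2 (by decide) (by decide)
  have hst2 : Setup e0 e1 s2 := ⟨hin2.r0, hin2.r2, hin2.r3, he0, he1⟩
  obtain ⟨M, hMc, hM, hmax⟩ := matchingCmd_spec hst2 hne
    (by rw [hf2.arr 2 (by decide)]; exact h2) (by rw [hf2.arr 3 (by decide)]; exact h3)
  have hf3 := frame_run matchingCmd s2
  set s3 := matchingCmd.run s2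
  have hst3 := hst2.frame hf3 (by decide) (by decide)
  obtain ⟨p, q, hp, hq, hpq, hpi, hqi, hpM, hqM⟩ :=
    pairCmd_spec hst3 hne hMc (hA.exists_pair hE hM)
  have hf4 := frame_run pairCmd s3
  set s4 := pairCmd.run s3
  have hst4 := hst3.frame hf4 (by decide) (by decide)
  obtain ⟨tl, htl, htli, hbal⟩ := orientCmd_spec hst4 hne hp hq hpq hpi hqi
  have hf5 := frame_run orientCmd s4
  set s5 := orientCmd.run s4
  have hst5 := hst4.frame hf5 (by decide) (by decide)
  have hm : m ≤ s5.reg 1 := by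
    rw [hf5.reg 1 (by decide), hf4.reg 1 (by decide), hf3.reg 1 (by decide), hin2.r1]
    have := Nat.le_mul_of_pos_right m (NeZero.pos n)
    omega
  have hout := outputCmd_spec hst5 hm htl (by rw [hf5.arr 10 (by decide)]; exact hp)
    (by rw [hf5.arr 11 (by decide)]; exact hq)
  obtain ⟨hS, hcard⟩ := feasible_of_orientation hA hB hE hne hM hpq hpi hqi hpM hqM htli hbal
    (S := {b | (solveCmd.run s).arr 16 b = 1}) (fun b => by rw [hr]; exact hout b)
  exact isOptimal_of_maxEnds hA hB hE hmax hS hcard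

/-! ### The input word -/

lemma length_flatMap_of_length {α : Type*} {k : ℕ} (f : α → List ℕ) (l : List α)
    (hf : ∀ x, (f x).length = k) : (l.flatMap f).length = l.length * k := by
  induction l with
  | nil => simp
  | cons x l ih => rw [List.flatMap_cons, List.length_append, ih, hf, List.length_cons]; ring

lemma getD_flatMap_of_length {α : Type*} {k : ℕ} (f : α → List ℕ) (hf : ∀ x, (f x).length = k) :
    ∀ (l : List α) (i j : ℕ) (hi : i < l.length), j < k →
      (l.flatMap f).getD (i * k + j) 0 = (f l[i]).getD j 0
  | [], i, j, hi, hj => by simp at hi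
  | x :: l, 0, j, hi, hj => by
    rw [List.flatMap_cons, List.getD_append _ _ _ _ (by rw [hf]; omega)]
    simp
  | x :: l, i + 1, j, hi, hj => by
    have h : (f x).length ≤ (i + 1) * k + j := by rw [hf, Nat.succ_mul]; omega
    rw [List.flatMap_cons, List.getD_append_right _ _ _ _ h, hf,
      show (i + 1) * k + j - k = i * k + j by rw [Nat.succ_mul]; omega,
      getD_flatMap_of_length f hf l i j (by simpa using hi) hj]
    simp

lemma length_encode (E : Fin n → Fin m → Prop) : (encode E).length = 2 + m * n := by
  classical
  rw [encode, List.length_append, length_flatMap_of_length (k := n) _ _ (by simp)]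
  simp

lemma getD_encode (E : Fin n → Fin m → Prop) (a : Fin n) (b : Fin m) :
    (encode E).getD (2 + b * n + a) 0 ≠ 0 ↔ E a b := by
  classical
  rw [encode, List.getD_append_right _ _ _ _ (by simp; omega)]
  rw [show 2 + b * n + a - [n, m].length = b * n + a by simp; omega,
    getD_flatMap_of_length (k := n) _ (by simp) _ _ _ (by simp) a.2]
  simp [List.getD_eq_getElem?_getD]

/-! ### The machine program -/

section Machine

open RAM

/-- Compute the registers `0` and `1` from the input. -/
def prepareProg : Prog :=
  .seq (.assign 0 (.add (.add (.load (.const 0)) (.load (.const 1))) (.const 1)))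
    (.seq (.assign 1 (.const 2)) (.seq (.assign 2 (.load (.const 1)))
      (.while (.reg 2) (.seq (.assign 2 (.sub (.reg 2) (.const 1)))
        (.assign 1 (.add (.reg 1) (.load (.const 0))))))))

/-- A pass takes 2 steps for the test, 4 for the decrement and 5 for the addition; the final test
takes 2. -/
lemma prepareProg_loop_runs : ∀ (k : ℕ) (s : State), s.reg 2 = k →
    ∃ s', Runs (.while (.reg 2) (.seq (.assign 2 (.sub (.reg 2) (.const 1)))
        (.assign 1 (.add (.reg 1) (.load (.const 0)))))) s (11 * k + 2) s' ∧
      s'.mem = s.mem ∧ s'.reg 0 = s.reg 0 ∧ s'.reg 1 = s.reg 1 + k * s.mem 0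
  | 0, s, h => ⟨s, .while_false (by simp [Expr.eval, h]), rfl, rfl, by simp⟩
  | k + 1, s, h => by
    set s1 : State := ⟨Function.update s.reg 2 ((Expr.sub (.reg 2) (.const 1)).eval s), s.mem⟩
      with hs1
    set s2 : State := ⟨Function.update s1.reg 1
      ((Expr.add (.reg 1) (.load (.const 0))).eval s1), s1.mem⟩ with hs2
    have h2 : s2.reg 2 = k := by simp [hs2, hs1, Expr.eval, h]
    have h1 : s2.reg 1 = s.reg 1 + s.mem 0 := by simp [hs2, hs1, Expr.eval]
    have h0 : s2.reg 0 = s.reg 0 := by simp [hs2, hs1]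
    obtain ⟨s', g1, g2, g3, g4⟩ := prepareProg_loop_runs k s2 h2
    refine ⟨s', ?_, g2, g3.trans h0, ?_⟩
    · have := Runs.while_true (e := .reg 2) (s := s) (by simp [Expr.eval, h])
        (.seq (.assign 2 (.sub (.reg 2) (.const 1)) s)
          (.assign 1 (.add (.reg 1) (.load (.const 0))) s1)) g1
      convert this using 1
      simp [Expr.cost]
      ring
    · rw [g4, h1, show s2.mem = s.mem from rfl]
      ring

lemma prepareProg_runs (s : State) : ∃ s', Runs prepareProg s (11 * s.mem 1 + 15) s' ∧
    s'.mem = s.mem ∧ s'.reg 0 = s.mem 0 + s.mem 1 + 1 ∧ s'.reg 1 = 2 + s.mem 1 * s.mem 0 := by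
  obtain ⟨s', h1, h2, h3, h4⟩ := prepareProg_loop_runs (s.mem 1) ⟨Function.update
    (Function.update (Function.update s.reg 0 (s.mem 0 + s.mem 1 + 1)) 1 2) 2 (s.mem 1), s.mem⟩
    (by simp)
  refine ⟨s', ?_, h2, by simpa using h3, by simpa using h4⟩
  have := Runs.seq (.assign 0 (.add (.add (.load (.const 0)) (.load (.const 1))) (.const 1)) s)
    (.seq (.assign 1 (.const 2) _) (.seq (.assign 2 (.load (.const 1)) _) h1))
  convert this using 1
  · rfl
  · simp [Expr.cost]
    ring

theorem solvableInPolyTime_regular :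
    SolvableInPolyTime (fun {_ _} E => LeftRegular E 3 ∧ RightRegular E 2) := by
  refine ⟨.seq prepareProg solveCmd.toProg,
    solveCmd.time.comp (2 * Polynomial.X) + (11 * Polynomial.X + 15), fun n m E hE => ?_⟩
  obtain ⟨hA, hB⟩ := hE
  have h32 := three_mul_card hA hB
  simp only [Fintype.card_fin] at h32
  obtain ⟨s, h1, hmem, hr0, hr1⟩ := prepareProg_runs (State.init (encode E))
  have i0 : (State.init (encode E)).mem 0 = n := by simp [State.init, encode]
  have i1 : (State.init (encode E)).mem 1 = m := by simp [State.init, encode]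
  rw [i0, i1] at hr0 hr1
  rw [i1] at h1
  -- The arrays start beyond the input word, where the memory is still `0`.
  let a : Store := ⟨s.reg, fun i j => if i < 16 then 0 else s.mem j⟩
  have hRep : Rep a s := by
    refine ⟨rfl, fun x _ => by simp [a], fun i hi j => ?_⟩
    have : (encode E).length ≤ a.reg 1 + (16 * j + i) := by
      rw [length_encode, show a.reg 1 = s.reg 1 from rfl, hr1]; omega
    simp only [a, hi, if_true]
    rw [hmem]
    exact List.getD_eq_default _ _ this
  obtain ⟨t, s', g1, g2, g3⟩ := solveCmd.toProg_runs (by decide) a s hRep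
  refine ⟨_, s', .seq h1 g1, ?_, ?_⟩
  -- By $3n=2m$ the sizes `n` and `m` vanish together, so both are at most `m * n`. Hence the loop
  -- length `n + m + 1` is at most twice the length `2 + m * n` of the input, which explains the
  -- argument `2 * X` in the polynomial.
  · have hn : n ≤ m * n := by
      rcases Nat.eq_zero_or_pos m with h | h
      · omega
      · exact Nat.le_mul_of_pos_left n h
    have hm : m ≤ m * n := by
      rcases Nat.eq_zero_or_pos n with h | h
      · omega
      · exact Nat.le_mul_of_pos_right m h
    have h0 : a.reg 0 ≤ 2 * (encode E).length := by
      rw [length_encode, show a.reg 0 = s.reg 0 from rfl, hr0]; omega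
    have := eval_mono solveCmd.time h0
    simp only [Polynomial.eval_add, Polynomial.eval_comp, Polynomial.eval_mul, Polynomial.eval_X,
      Polynomial.eval_ofNat]
    have := length_encode E
    omega
  · rcases Nat.eq_zero_or_pos n with hn | hn
    -- For the empty graph every output is optimal.
    · obtain rfl : m = 0 := by omega
      subst hn
      exact ⟨⟨finZeroElim, fun x => x.elim0, fun x => x.elim0⟩, fun T _ => by
        rw [(Set.ncard_eq_zero (Set.toFinite _)).2 (Set.eq_empty_of_isEmpty _)]; exact Nat.zero_le _⟩
    · have : NeZero n := ⟨hn.ne'⟩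
      have ho := solveCmd_spec (s := a) hA hB hr0 hr1 (by simp [a, hmem, i0])
        (by simp [a, hmem, i1]) (fun x b => ?_) (by simp [a]) (by simp [a])
      · have e : output m s' = {b : Fin m | (solveCmd.run a).arr 16 b = 1} := by
          ext b
          have hb : (b : ℕ) < (solveCmd.run a).reg 1 := by
            rw [(frame_run solveCmd a).reg 1 (by decide), show a.reg 1 = s.reg 1 from rfl, hr1]
            have := b.2
            have := Nat.le_mul_of_pos_right m hn
            omega
          simp only [output, Set.mem_ofPred_eq]
          rw [g2.inp b hb]
        rw [e]
        exact ho
      · rw [← getD_encode E x b]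
        simp only [a, hmem]
        exact Iff.rfl

end Machine

end TwoPPM

theorem mainTheorem1 :
    TwoPPM.SolvableInPolyTime
      (fun {_ _} E => TwoPPM.LeftRegular E 3 ∧ TwoPPM.RightRegular E 2) ∧
    ∀ (A : Type*) (B : Type*) [Fintype A] [Fintype B] (E : A → B → Prop)
      (_hA : TwoPPM.LeftRegular E 3) (hB : TwoPPM.RightRegular E 2),
      ∃ opt : ℕ, IsGreatest (TwoPPM.feasibleValues E) opt ∧
        (opt : ℚ) = (Fintype.card A : ℚ) / 2 +
          (TwoPPM.matchingNumber (TwoPPM.auxGraph E hB) : ℚ) := by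
  exact ⟨TwoPPM.solvableInPolyTime_regular,
    fun _ _ _ _ _ hA hB => TwoPPM.exists_isGreatest_feasibleValues hA hB⟩
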